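/- All logarithms are natural. A *binary finite type constraint* is a set $\mathcal S$ of finite words over $\{0,1\}$ consisting of all words that contain no element of some given finite set of forbidden words as a contiguous subword; it is *irreducible* if for all $u,v\in\mathcal S$ there is $w\in\mathcal S$ with $uwv\in\mathcal S$. Its *topological order* $\hat m=\hat m(\mathcal S)$ is the least $m\ge 0$ for which there is a set $\mathcal F$ of words of length $m+1$ such that a word of length at least $m+1$ belongs to $\mathcal S$ if and only if it contains no element of $\mathcal F$ as a contiguous subword. For a binary input $X$ (a random word or a process) let $Z_i(\varepsilon)=X_i\oplus E_i$ be the output of the binary symmetric channel, where the $E_i$ are i.i.d., independent of $X$, with $P(E_i=1)=\varepsilon=1-P(E_i=0)$. Let $\mathcal A(X)$ be the set of words of positive probability. For $0\le\varepsilon\le1$ the noisy constrained capacity is $$C(\mathcal S,\varepsilon)=\lim_{n\to\infty}\ \sup_{\mathcal A(X_{-n}^0)\subseteq\mathcal S}\ \frac{1}{n+1}\Bigl(H(Z_{-n}^0(\varepsilon))-H(Z_{-n}^0(\varepsilon)\mid X_{-n}^0)\Bigr),$$ the supremum being over all (not necessarily stationary) laws of $X_{-n}^0$, and $C(\mathcal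 S)=C(\mathcal S,0)$. Let $$h_m(\mathcal S,\varepsilon)=\sup_X H(Z_\varepsilon),$$ where $X$ runs over the stationary irreducible Markov chains of order $m$ (the next symbol depends only on the last $m$ symbols) with $\mathcal A(X)\subseteq\mathcal S$, irreducibility of the chain meaning that for all $u,v\in\mathcal A(X)$ there is $w\in\mathcal A(X)$ with $uwv\in\mathcal A(X)$, and where $H(Z_\varepsilon)=\lim_n \frac1{n+1}H(Z_{-n}^0(\varepsilon))$ is the entropy rate of the output process. Let $H(\varepsilon)=\varepsilon\log\frac1\varepsilon+(1-\varepsilon)\log\frac1{1-\varepsilon}$. For a stationary process $X$ and a word $u$ of length $n$ put $p_X(u)=P(X_{-n+1}^0=u)$ and $$h(u)=\sum_{i=1}^{n}p_X(u_1\cdots u_{i-1}\,\bar u_i\,u_{i+1}\cdots u_n)-n\,p_X(u).$$ Let $\mathcal B(X)$ be the set of words $u\notin\mathcal A(X)$ such that flipping some single bit of $u$ gives a word in $\mathcal A(X)$. With $w$ running over the words of length $n$ and $v$ over $\{0,1\}$, put $$f_n(X)=\sum_{w\in\mathcal A(X),\,wv\notin\mathcal A(X)}h(wv),$$ $$g_n(X)=-\sum_{wv\in\mathcal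 A(X)}\Bigl(h(wv)\log\frac{p_X(wv)}{p_X(w)}+\frac{h(wv)p_X(w)-h(w)p_X(wv)}{p_X(w)}\Bigr)-\sum_{w\in\mathcal A(X),\,wv\notin\mathcal A(X)}h(wv)\log\frac{h(wv)}{p_X(w)}-\sum_{w\in\mathcal B(X),\,wv\in\mathcal B(X)}h(wv)\log\frac{h(wv)}{h(w)} .$$ **Corollary 3.3.** Let $\mathcal S$ be a binary irreducible finite type constraint that contains a nonempty word. Then the limit defining $C(\mathcal S,\varepsilon)$ exists for every $\varepsilon\in[0,1]$. There is a stationary process $X_{\max}$ such that, for every $m\ge\hat m$, $X_{\max}$ is the unique (in law) maximizer of the entropy rate $H(X)$ among the stationary Markov chains $X$ of order $m$ with $\mathcal A(X)=\mathcal S$. With $f(X_{\max})=f_{2\hat m}(X_{\max})$ and $g(X_{\max})=g_{3\hat m}(X_{\max})$, as $\varepsilon\to0^+$, $$C(\mathcal S,\varepsilon)=C(\mathcal S)+(f(X_{\max})-1)\,\varepsilon\log(1/\varepsilon)+(g(X_{\max})-1)\,\varepsilon+O(\varepsilon^2\log^2\varepsilon).$$ Moreover, for every $m\ge\hat m$,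 as $\varepsilon\to0^+$, $$h_m(\mathcal S,\varepsilon)-H(\varepsilon)=C(\mathcal S)+(f(X_{\max})-1)\,\varepsilon\log(1/\varepsilon)+(g(X_{\max})-1)\,\varepsilon+O(\varepsilon^2\log^2\varepsilon),$$ where the constant in $O$ may depend on $\mathcal S$ and $m$. -/

import Mathlib

open Filter Topology Asymptotics

noncomputable section

/-! ### Constraints: sets of finite binary words -/

/-- A set of binary words is of finite type if it consists of all words that avoid a finite set of
forbidden words (as contiguous subwords). -/
def IsFiniteType (S : Set (List Bool)) : Prop :=
  ∃ F : Finset (List Bool), S = {w | ∀ u ∈ F, ¬ u <:+: w}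

/-- Irreducibility: any two words of the set can be connected inside the set. -/
def IsIrreducibleConstraint (S : Set (List Bool)) : Prop :=
  ∀ u ∈ S, ∀ v ∈ S, ∃ w ∈ S, u ++ w ++ v ∈ S

/-- The topological order: the least `m` such that `S` can be described by forbidden words that all
have length `m + 1`. Words shorter than `m + 1` cannot be tested by such a list, so the description
concerns the words of length at least `m + 1`; e.g. the order of the `(d, k)`-RLL constraint
is `k`. -/
def topologicalOrder (S : Set (List Bool)) : ℕ :=
  sInf {m | ∃ F : Finset (List Bool), (∀ u ∈ F, u.length = m + 1) ∧
    ∀ w : List Bool, m + 1 ≤ w.length → (w ∈ S ↔ ∀ u ∈ F, ¬ u <:+: w)}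

/-! ### Entropy of finite distributions (natural logarithm) -/

/-- Shannon entropy `- ∑ p log p`. -/
def entropy {α : Type} [Fintype α] (p : α → ℝ) : ℝ :=
  ∑ a, Real.negMulLog (p a)

/-- Conditional entropy `H(B | A) = - ∑ p(a, b) log p(b | a)` of a joint distribution
`q a b = P(A = a, B = b)`. -/
def condEntropy {α β : Type} [Fintype α] [Fintype β] (q : α → β → ℝ) : ℝ :=
  - ∑ a, ∑ b, q a b * Real.log (q a b / ∑ b', q a b')

/-! ### The binary symmetric channel -/

/-- The law of one noise bit `E`: `P(E = 1) = ε`, `P(E = 0) = 1 - ε`. -/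
def noiseProb (ε : ℝ) (e : Bool) : ℝ := if e then ε else 1 - ε

/-- The joint law of the input block `X` (with law `p`) and the output block `Z = X ⊕ E`, where the
noise `E` is i.i.d. and independent of `X`. -/
def bscJoint {n : ℕ} (ε : ℝ) (p : (Fin n → Bool) → ℝ) (x z : Fin n → Bool) : ℝ :=
  p x * ∏ i, noiseProb ε (xor (x i) (z i))

/-- The law of the output block. -/
def bscOutput {n : ℕ} (ε : ℝ) (p : (Fin n → Bool) → ℝ) (z : Fin n → Bool) : ℝ :=
  ∑ x, bscJoint ε p x z

/-- The supremum of `(H(Z) - H(Z | X)) / (n + 1)` over all (not necessarily stationary) input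
distributions on words of length `n + 1` whose allowed words lie in `S`. -/
def blockCapacity (S : Set (List Bool)) (ε : ℝ) (n : ℕ) : ℝ :=
  sSup {r : ℝ | ∃ p ∈ stdSimplex ℝ (Fin (n + 1) → Bool),
    (∀ w, 0 < p w → List.ofFn w ∈ S) ∧
    r = (entropy (bscOutput ε p) - condEntropy (bscJoint ε p)) / ((n : ℝ) + 1)}

/-- The noisy constrained capacity `C(S, ε)`. The noiseless capacity is `C(S) = C(S, 0)`. -/
def noisyCapacity (S : Set (List Bool)) (ε : ℝ) : ℝ :=
  limUnder atTop (blockCapacity S ε)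

/-! ### Stationary binary processes -/

/-- A (left-infinite) stationary binary process, given by its law: `prob w` is the probability that
a block of `w.length` consecutive symbols, read in the order of time, equals `w`. By Kolmogorov's
extension theorem the families below are exactly the laws of stationary binary processes; the last
two fields say that the law is consistent (at the present end) and stationary. -/
@[ext]
structure StationaryProcess where
  prob : List Bool → ℝ
  nonneg : ∀ w, 0 ≤ prob w
  prob_nil : prob [] = 1
  sum_append : ∀ w, prob (w ++ [false]) + prob (w ++ [true]) = prob w
  sum_cons : ∀ w, prob (false :: w) + prob (true :: w) = prob w

namespace StationaryProcess

/-- The law of a block of length `n`. -/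
def law (X : StationaryProcess) (n : ℕ) (w : Fin n → Bool) : ℝ := X.prob (List.ofFn w)

/-- The set `𝒜(X)` of allowed words. -/
def allowed (X : StationaryProcess) : Set (List Bool) := {w | 0 < X.prob w}

/-- `X` is a Markov chain of order `m`: given the last `m` symbols `w`, the next symbol `v` is
independent of the earlier symbols `u`. -/
def IsMarkov (X : StationaryProcess) (m : ℕ) : Prop :=
  ∀ (u w : List Bool) (v : Bool), w.length = m →
    X.prob (u ++ w ++ [v]) * X.prob w = X.prob (u ++ w) * X.prob (w ++ [v])

end StationaryProcess

/-- The entropy rate `lim H(X₀, …, Xₙ) / (n + 1)` of a process with block laws `q n`. -/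
def entropyRate (q : (n : ℕ) → (Fin n → Bool) → ℝ) : ℝ :=
  limUnder atTop fun n : ℕ => entropy (q (n + 1)) / ((n : ℝ) + 1)

/-- `h_m(S, ε)`: the supremum of the output entropy rates `H(Z_ε)` over all irreducible Markov
chains `X` of order `m` with `𝒜(X) ⊆ S`. -/
def markovOutputEntropy (S : Set (List Bool)) (m : ℕ) (ε : ℝ) : ℝ :=
  sSup {r : ℝ | ∃ X : StationaryProcess, X.IsMarkov m ∧ IsIrreducibleConstraint X.allowed ∧
    X.allowed ⊆ S ∧ r = entropyRate fun n => bscOutput ε (X.law n)}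

/-- `X` has maximal entropy rate among the Markov chains of order `m` with `𝒜(X) = S`. -/
def IsMaxEntropyMarkov (S : Set (List Bool)) (m : ℕ) (X : StationaryProcess) : Prop :=
  X.IsMarkov m ∧ X.allowed = S ∧
    ∀ Y : StationaryProcess, Y.IsMarkov m → Y.allowed = S →
      entropyRate Y.law ≤ entropyRate X.law

/-! ### The coefficients of the entropy rate expansion -/

/-- Flip the `i`-th bit of a word. -/
def flipBit {n : ℕ} (u : Fin n → Bool) (i : Fin n) : Fin n → Bool := Function.update u i (!u i)

/-- Append the symbol `v` to the word `w`. -/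
def snocBit {n : ℕ} (w : Fin n → Bool) (v : Bool) : Fin (n + 1) → Bool :=
  Fin.snoc (α := fun _ => Bool) w v

namespace StationaryProcess

/-- `h(u) = ∑ᵢ p_X(u with its i-th bit flipped) - n p_X(u)` for a word `u` of length `n`; it is the
derivative at `ε = 0` of the output probability of `u`. -/
def hCoeff (X : StationaryProcess) {n : ℕ} (u : Fin n → Bool) : ℝ :=
  ∑ i, X.law n (flipBit u i) - (n : ℝ) * X.law n u

/-- `u` is not allowed, but becomes allowed after flipping one bit; equivalently, the output
probability of `u` is `Θ(ε)`. -/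
def OneFlip (X : StationaryProcess) {n : ℕ} (u : Fin n → Bool) : Prop :=
  ¬ 0 < X.law n u ∧ ∃ i, 0 < X.law n (flipBit u i)

open Classical in
/-- The coefficient `f_n(X) = ∑ h(wv)`, over words `w` of length `n` and bits `v` with
`w ∈ 𝒜(X)`, `wv ∉ 𝒜(X)`. -/
def fBlock (X : StationaryProcess) (n : ℕ) : ℝ :=
  ∑ w : Fin n → Bool, ∑ v : Bool,
    if 0 < X.law n w ∧ ¬ 0 < X.law (n + 1) (snocBit w v) then X.hCoeff (snocBit w v) else 0

open Classical in
/-- The coefficient `g_n(X)`; in all sums `w` is a word of length `n` and `v` is a bit. -/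
def gBlock (X : StationaryProcess) (n : ℕ) : ℝ :=
  - (∑ w : Fin n → Bool, ∑ v : Bool,
      if 0 < X.law (n + 1) (snocBit w v) then
        X.hCoeff (snocBit w v) * Real.log (X.law (n + 1) (snocBit w v) / X.law n w) +
          (X.hCoeff (snocBit w v) * X.law n w - X.hCoeff w * X.law (n + 1) (snocBit w v)) /
            X.law n w
      else 0)
  - (∑ w : Fin n → Bool, ∑ v : Bool,
      if 0 < X.law n w ∧ ¬ 0 < X.law (n + 1) (snocBit w v) then
        X.hCoeff (snocBit w v) * Real.log (X.hCoeff (snocBit w v) / X.law n w)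
      else 0)
  - (∑ w : Fin n → Bool, ∑ v : Bool,
      if X.OneFlip w ∧ X.OneFlip (snocBit w v) then
        X.hCoeff (snocBit w v) * Real.log (X.hCoeff (snocBit w v) / X.hCoeff w)
      else 0)

/-- `f(X) = f_{2m}(X)` for a Markov chain `X` of order `m`. -/
def fCoeff (X : StationaryProcess) (m : ℕ) : ℝ := X.fBlock (2 * m)

/-- `g(X) = g_{3m}(X)` for a Markov chain `X` of order `m`. -/
def gCoeff (X : StationaryProcess) (m : ℕ) : ℝ := X.gBlock (3 * m)

end StationaryProcess

end

/-!
The proof squeezes both quantities between two expressions that have the same expansion. Let `X` be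
the Parry measure of `S`, of order `m = m̂(S)`, and let `Hₙ(Y, ε)` be the conditional entropy of an
output symbol given the `n` preceding output symbols, for the stationary input `Y`
(`condEnt (noisy ε Y.prob) n`). For every order at least `m`,

  entropy rate of the output of `X` ≤ `h(S, ε)` ≤ `C(S, ε) + H(ε)` ≤ `Hₙ(Y, ε)`,

where `Y` is some stationary input in `S`, depending on `ε`, but not on `n`. The middle inequality
holds because `H(Z | X)` is the entropy of the noise. For the last one
(`exists_noisyCapacity_add_le`) nearly optimal block laws are averaged over time, `Y` is a limit of
these averages, and the output of long blocks is predicted with the conditional probabilities of the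
output of `Y`. The limits exist by Fekete's lemma.

*Upper bound.* `exists_condEnt_le_add_sq` shows `Hₙ(Y, ε) ≤ Hₙ(X, ε) + O(ε² log² ε)`, uniformly
in `Y`. The entropy `Hₙ(Y, ε)` is the cross entropy of the output of `Y` with respect to that of `X`,
minus a relative entropy. Logarithms of the transition probabilities of the Parry measure are a
constant plus a coboundary, so at `ε = 0` the cross entropy is the same for all stationary `Y` in `S`;
for `ε > 0` it varies by `O(ε log (1 / ε)) d`, where `d` is the distance of the block laws of `Y`
and `X`. The relative entropy is at least a multiple of `d²`, because a stationary law is determined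
by its transition probabilities. The maximum over `d` of the difference is `O(ε² log² ε)`. At `ε = 0`
the same bound shows that the Parry measure is the unique maximizer of the entropy rate.

*Lower bound.* `IsMarkov.exists_le_iInf_condEnt_noisy` shows that for a Markov chain of order `m` and
`n = 3 m` the entropy rate of the output is at least `Hₙ(X, ε) - O(ε² log² ε)`. What is lost by
forgetting the output before the last `n` symbols is a relative entropy; by convexity it suffices to
bound it given the far past of the input. The chi-square divergence does this: among `3 m` symbols, a
single error is far from the beginning or far from the end, so by the Markov property the first
nonvanishing terms of the conditional probabilities of the next symbol, with and without knowledge of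
the far past, agree (`IsMarkov.flipSum_snoc_mul` and its companions).

*Expansion.* Output probabilities are polynomials in `ε`, whose first derivative at `0` is the sum over
single flips. Expanding `- Z(wv) log (Z(wv) / Z(w))` for each word gives
`Hₙ(X, ε) = Hₙ(X, 0) + fₙ(X) ε log (1 / ε) + gₙ(X) ε + O(ε² log² ε)`
(`StationaryProcess.condEnt_noisy_expansion`), with `Hₙ(X, 0) = C(S)`. For a Markov chain of order
`m` the coefficient `fₙ` does not depend on `n ≥ 2 m`, so `n = 3 m` gives the stated coefficients.
-/

noncomputable section

/-! ### Sums over words of a fixed length -/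

/-- The finite set of binary words of length `n`. -/
def words (n : ℕ) : Finset (List Bool) :=
  (Finset.univ : Finset (Fin n → Bool)).map ⟨List.ofFn, List.ofFn_injective⟩

@[simp]
theorem mem_words {n : ℕ} {w : List Bool} : w ∈ words n ↔ w.length = n := by
  constructor
  · intro h
    obtain ⟨f, -, rfl⟩ := Finset.mem_map.1 h
    simp
  · rintro rfl
    exact Finset.mem_map.2 ⟨w.get, Finset.mem_univ _, by simp⟩

theorem sum_ofFn (n : ℕ) (G : List Bool → ℝ) :
    ∑ x : Fin n → Bool, G (List.ofFn x) = ∑ w ∈ words n, G w := by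
  simp [words]

theorem sum_words_zero (G : List Bool → ℝ) : ∑ w ∈ words 0, G w = G [] := by
  rw [← sum_ofFn]
  simp

theorem sum_words_add (k n : ℕ) (G : List Bool → ℝ) :
    ∑ u ∈ words (k + n), G u = ∑ a ∈ words k, ∑ w ∈ words n, G (a ++ w) := by
  rw [← Finset.sum_product']
  refine Finset.sum_nbij' (fun u => (u.take k, u.drop k)) (fun p => p.1 ++ p.2) ?_ ?_ ?_ ?_ ?_
  · intro u hu
    simp only [mem_words, Finset.mem_product, List.length_take, List.length_drop] at hu ⊢
    omega
  · rintro ⟨a, w⟩ h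
    simp only [mem_words, Finset.mem_product, List.length_append] at h ⊢
    omega
  · intro u _
    simp
  · rintro ⟨a, w⟩ h
    simp only [mem_words, Finset.mem_product] at h
    simp [← h.1]
  · intro u _
    simp

theorem sum_words_one (G : List Bool → ℝ) : ∑ w ∈ words 1, G w = ∑ v : Bool, G [v] := by
  rw [← sum_ofFn]
  exact Fintype.sum_equiv (Equiv.funUnique (Fin 1) Bool) _ _ (by intro x; simp [List.ofFn_succ])

theorem sum_words_snoc (n : ℕ) (G : List Bool → ℝ) :
    ∑ u ∈ words (n + 1), G u = ∑ w ∈ words n, ∑ v : Bool, G (w ++ [v]) := by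
  rw [sum_words_add]
  exact Finset.sum_congr rfl fun w _ => sum_words_one _

theorem sum_words_cons (n : ℕ) (G : List Bool → ℝ) :
    ∑ u ∈ words (n + 1), G u = ∑ b : Bool, ∑ w ∈ words n, G (b :: w) := by
  rw [add_comm n 1, sum_words_add, sum_words_one]
  rfl

theorem card_words (n : ℕ) : (words n).card = 2 ^ n := by
  simp [words]

/-! ### The channel and its first-order behaviour, on functions of words -/

/-- The average of `F x` over the words `x` of the same length as `z`, weighted by the transition
probability of the binary symmetric channel from `x` to `z`. If `F` gives the block probabilities
of the input, this is the output probability of `z`. -/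
def noisy (ε : ℝ) : (List Bool → ℝ) → List Bool → ℝ
  | F, [] => F []
  | F, v :: w => (1 - ε) * noisy ε (fun x => F (v :: x)) w + ε * noisy ε (fun x => F ((!v) :: x)) w

/-- The sum of `F` over the words that differ from the given word in exactly one bit. -/
def flipSum : (List Bool → ℝ) → List Bool → ℝ
  | _, [] => 0
  | F, v :: w => F ((!v) :: w) + flipSum (fun x => F (v :: x)) w

theorem noisy_append (ε : ℝ) (F : List Bool → ℝ) (y u : List Bool) :
    noisy ε F (y ++ u) = noisy ε (fun x => noisy ε (fun t => F (x ++ t)) u) y := by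
  induction y generalizing F with
  | nil => rfl
  | cons v y ih => simp only [List.cons_append, noisy, ih]

theorem noisy_congr {ε : ℝ} {F G : List Bool → ℝ} {z : List Bool}
    (h : ∀ x, x.length = z.length → F x = G x) : noisy ε F z = noisy ε G z := by
  induction z generalizing F G with
  | nil => exact h [] rfl
  | cons v z ih =>
    simp only [noisy]
    rw [ih fun x hx => h (v :: x) (by simp [hx]), ih fun x hx => h ((!v) :: x) (by simp [hx])]

theorem noisy_add (ε : ℝ) (F G : List Bool → ℝ) (z : List Bool) :
    noisy ε (fun x => F x + G x) z = noisy ε F z + noisy ε G z := by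
  induction z generalizing F G with
  | nil => rfl
  | cons v z ih => simp only [noisy, ih]; ring

theorem noisy_mul_left (ε c : ℝ) (F : List Bool → ℝ) (z : List Bool) :
    noisy ε (fun x => c * F x) z = c * noisy ε F z := by
  induction z generalizing F with
  | nil => rfl
  | cons v z ih => simp only [noisy, ih]; ring

theorem noisy_sub (ε : ℝ) (F G : List Bool → ℝ) (z : List Bool) :
    noisy ε (fun x => F x - G x) z = noisy ε F z - noisy ε G z := by
  induction z generalizing F G with
  | nil => rfl
  | cons v z ih => simp only [noisy, ih]; ring

theorem noisy_const (ε c : ℝ) (z : List Bool) : noisy ε (fun _ => c) z = c := by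
  induction z with
  | nil => rfl
  | cons v z ih => simp only [noisy, ih]; ring

theorem noisy_zero (F : List Bool → ℝ) (z : List Bool) : noisy 0 F z = F z := by
  induction z generalizing F with
  | nil => rfl
  | cons v z ih => simp only [noisy, ih]; ring

theorem noisy_mono {ε : ℝ} (h0 : 0 ≤ ε) (h1 : ε ≤ 1) {F G : List Bool → ℝ} {z : List Bool}
    (h : ∀ x, x.length = z.length → F x ≤ G x) : noisy ε F z ≤ noisy ε G z := by
  induction z generalizing F G with
  | nil => exact h [] rfl
  | cons v z ih =>
    simp only [noisy]
    have a := ih (F := fun x => F (v :: x)) (G := fun x => G (v :: x))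
      fun x hx => h (v :: x) (by simp [hx])
    have b := ih (F := fun x => F ((!v) :: x)) (G := fun x => G ((!v) :: x))
      fun x hx => h ((!v) :: x) (by simp [hx])
    have := sub_nonneg.2 h1
    gcongr

theorem noisy_nonneg {ε : ℝ} (h0 : 0 ≤ ε) (h1 : ε ≤ 1) {F : List Bool → ℝ} {z : List Bool}
    (h : ∀ x, x.length = z.length → 0 ≤ F x) : 0 ≤ noisy ε F z := by
  have := noisy_mono h0 h1 (F := fun _ => 0) h
  rwa [noisy_const] at this

theorem sum_noisy (ε : ℝ) (F : List Bool → ℝ) (n : ℕ) :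
    ∑ z ∈ words n, noisy ε F z = ∑ x ∈ words n, F x := by
  induction n generalizing F with
  | zero => simp only [sum_words_zero, noisy]
  | succ n ih =>
    simp only [sum_words_cons, noisy, Fintype.sum_bool, Finset.sum_add_distrib, ← Finset.mul_sum, ih,
      Bool.not_true, Bool.not_false]
    ring

theorem noisy_sum {ι : Type*} (s : Finset ι) (ε : ℝ) (F : ι → List Bool → ℝ) (z : List Bool) :
    noisy ε (fun x => ∑ i ∈ s, F i x) z = ∑ i ∈ s, noisy ε (F i) z := by
  induction z generalizing F with
  | nil => rfl
  | cons v z ih => simp only [noisy, ih, Finset.sum_add_distrib, Finset.mul_sum]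

theorem noisy_snoc (ε : ℝ) (F : List Bool → ℝ) (w : List Bool) (v : Bool) :
    noisy ε F (w ++ [v]) =
      (1 - ε) * noisy ε (fun x => F (x ++ [v])) w + ε * noisy ε (fun x => F (x ++ [!v])) w := by
  rw [noisy_append]
  simp only [noisy]
  rw [noisy_add, noisy_mul_left, noisy_mul_left]

theorem noisy_marginal_snoc (ε : ℝ) {F : List Bool → ℝ} {w : List Bool}
    (h : ∀ x, x.length = w.length → F (x ++ [false]) + F (x ++ [true]) = F x) :
    noisy ε F (w ++ [false]) + noisy ε F (w ++ [true]) = noisy ε F w := by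
  rw [noisy_snoc, noisy_snoc, ← noisy_congr h, noisy_add]
  simp only [Bool.not_true, Bool.not_false]
  ring

theorem noisy_marginal_cons (ε : ℝ) {F : List Bool → ℝ} {w : List Bool}
    (h : ∀ x, x.length = w.length → F (false :: x) + F (true :: x) = F x) :
    noisy ε F (false :: w) + noisy ε F (true :: w) = noisy ε F w := by
  simp only [noisy]
  rw [← noisy_congr h, noisy_add]
  simp only [Bool.not_true, Bool.not_false]
  ring

/-- Every output symbol has conditional probability at least `ε`. -/
theorem mul_noisy_le_noisy_snoc {ε : ℝ} (h0 : 0 ≤ ε) (h1 : ε ≤ 1 / 2) {F : List Bool → ℝ}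
    {w : List Bool} (hF : ∀ x, 0 ≤ F x)
    (h : ∀ x, x.length = w.length → F (x ++ [false]) + F (x ++ [true]) = F x) (v : Bool) :
    ε * noisy ε F w ≤ noisy ε F (w ++ [v]) := by
  rw [noisy_snoc, ← noisy_congr h, noisy_add]
  have a := noisy_nonneg h0 (by linarith) (F := fun x => F (x ++ [false])) (z := w)
    fun x _ => hF _
  have b := noisy_nonneg h0 (by linarith) (F := fun x => F (x ++ [true])) (z := w)
    fun x _ => hF _
  cases v <;> simp only [Bool.not_true, Bool.not_false] <;> nlinarith

/-- A word has positive output probability as soon as its length carries some input mass. -/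
theorem noisy_pos {ε : ℝ} (h0 : 0 < ε) (h1 : ε < 1) {F : List Bool → ℝ} {z : List Bool}
    (hF : ∀ x, 0 ≤ F x) (h : ∃ x, x.length = z.length ∧ 0 < F x) : 0 < noisy ε F z := by
  induction z generalizing F with
  | nil =>
    obtain ⟨x, hx, hp⟩ := h
    rw [List.length_nil, List.length_eq_zero_iff] at hx
    subst hx
    exact hp
  | cons v z ih =>
    obtain ⟨x, hx, hp⟩ := h
    have a := noisy_nonneg h0.le h1.le (F := fun x => F (v :: x)) (z := z) fun x _ => hF _
    have b := noisy_nonneg h0.le h1.le (F := fun x => F ((!v) :: x)) (z := z) fun x _ => hF _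
    simp only [noisy]
    have h1' : 0 < 1 - ε := by linarith
    match x, hx, hp with
    | c :: x, hx, hp =>
      have hx' : x.length = z.length := by simpa using hx
      by_cases hc : c = v
      · subst hc
        have := ih (F := fun x => F (c :: x)) (fun x => hF _) ⟨x, hx', hp⟩
        positivity
      · have hc' : c = !v := by cases c <;> cases v <;> simp_all
        subst hc'
        have := ih (F := fun x => F ((!v) :: x)) (fun x => hF _) ⟨x, hx', hp⟩
        positivity

theorem flipSum_append (F : List Bool → ℝ) (p q : List Bool) :
    flipSum F (p ++ q) = flipSum (fun x => F (x ++ q)) p + flipSum (fun x => F (p ++ x)) q := by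
  induction p generalizing F with
  | nil => simp [flipSum]
  | cons v p ih =>
    simp only [List.cons_append, flipSum, ih]
    ring

theorem flipSum_congr {F G : List Bool → ℝ} {z : List Bool}
    (h : ∀ x, x.length = z.length → F x = G x) : flipSum F z = flipSum G z := by
  induction z generalizing F G with
  | nil => rfl
  | cons v z ih =>
    simp only [flipSum]
    rw [h _ (by simp), ih fun x hx => h (v :: x) (by simp [hx])]

theorem flipSum_mul_left (c : ℝ) (F : List Bool → ℝ) (z : List Bool) :
    flipSum (fun x => c * F x) z = c * flipSum F z := by
  induction z generalizing F with
  | nil => simp [flipSum]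
  | cons v z ih => simp only [flipSum, ih]; ring

theorem flipSum_zero (z : List Bool) : flipSum (fun _ => 0) z = 0 := by
  induction z with
  | nil => rfl
  | cons v z ih => simp only [flipSum, ih]; ring

theorem flipSum_sum {ι : Type*} (s : Finset ι) (F : ι → List Bool → ℝ) (z : List Bool) :
    flipSum (fun x => ∑ i ∈ s, F i x) z = ∑ i ∈ s, flipSum (F i) z := by
  induction z generalizing F with
  | nil => simp [flipSum]
  | cons v z ih => simp only [flipSum, ih, Finset.sum_add_distrib]

theorem flipSum_nonneg {F : List Bool → ℝ} (hF : ∀ x, 0 ≤ F x) (z : List Bool) :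
    0 ≤ flipSum F z := by
  induction z generalizing F with
  | nil => exact le_rfl
  | cons v z ih => exact add_nonneg (hF _) (ih fun x => hF _)

theorem flipSum_mono {F G : List Bool → ℝ} (h : ∀ x, F x ≤ G x) (z : List Bool) :
    flipSum F z ≤ flipSum G z := by
  induction z generalizing F G with
  | nil => exact le_rfl
  | cons v z ih => exact add_le_add (h _) (ih fun x => h _)

/-- The derivative at `ε = 0` of the output probability `noisy ε F w`. -/
def noisyDeriv (F : List Bool → ℝ) (w : List Bool) : ℝ := flipSum F w - w.length * F w

/-- The output probabilities are polynomials in `ε`; this is their second-order Taylor expansion. -/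
theorem exists_noisy_eq_taylor (F : List Bool → ℝ) (w : List Bool) :
    ∃ R : ℝ → ℝ, Continuous R ∧
      ∀ ε, noisy ε F w = F w + ε * noisyDeriv F w + ε ^ 2 * R ε := by
  induction w generalizing F with
  | nil => exact ⟨fun _ => 0, continuous_const, fun ε => by simp [noisy, noisyDeriv, flipSum]⟩
  | cons v w ih =>
    obtain ⟨R, hR, h⟩ := ih fun x => F (v :: x)
    obtain ⟨R', hR', h'⟩ := ih fun x => F ((!v) :: x)
    refine ⟨fun ε => (1 - ε) * R ε + ε * R' ε + (noisyDeriv (fun x => F ((!v) :: x)) w -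
      noisyDeriv (fun x => F (v :: x)) w), by fun_prop, fun ε => ?_⟩
    simp only [noisy, h, h', noisyDeriv, flipSum, List.length_cons, Nat.cast_add, Nat.cast_one]
    ring

theorem noisy_sub_isBigO (F : List Bool → ℝ) (w : List Bool) :
    (fun ε => noisy ε F w - (F w + ε * noisyDeriv F w)) =O[𝓝[>] 0] fun ε : ℝ => ε ^ 2 := by
  obtain ⟨R, hR, h⟩ := exists_noisy_eq_taylor F w
  have : (fun ε => noisy ε F w - (F w + ε * noisyDeriv F w)) = fun ε => ε ^ 2 * R ε := by
    funext ε
    rw [h]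
    ring
  rw [this]
  have hb : R =O[𝓝[>] 0] fun _ : ℝ => (1 : ℝ) :=
    ((hR.tendsto 0).mono_left nhdsWithin_le_nhds).isBigO_one ℝ
  simpa using (isBigO_refl (fun ε : ℝ => ε ^ 2) (𝓝[>] 0)).mul hb

/-- The channel moves a word function by at most a multiple of `ε` of its total variation. -/
theorem abs_noisy_sub_le {ε : ℝ} (h0 : 0 ≤ ε) (h1 : ε ≤ 1) (F : List Bool → ℝ) (w : List Bool) :
    |noisy ε F w - F w| ≤ ε * (w.length * ∑ x ∈ words w.length, |F x|) := by
  induction w generalizing F with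
  | nil => simp [noisy]
  | cons v w ih =>
    have a := ih fun x => F (v :: x)
    have b : |noisy ε (fun x => F ((!v) :: x)) w| ≤ ∑ x ∈ words w.length, |F ((!v) :: x)| := by
      have hb : |noisy ε (fun x => F ((!v) :: x)) w| ≤ noisy ε (fun x => |F ((!v) :: x)|) w := by
        refine abs_le.2 ⟨?_, noisy_mono h0 h1 fun x _ => le_abs_self _⟩
        have := noisy_mono h0 h1 (F := fun x => -1 * |F ((!v) :: x)|)
          (G := fun x => F ((!v) :: x)) (z := w) fun x _ => by
            simpa using neg_abs_le (F ((!v) :: x))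
        rw [noisy_mul_left] at this
        linarith
      refine hb.trans ?_
      rw [← sum_noisy ε]
      exact Finset.single_le_sum (f := noisy ε fun x => |F ((!v) :: x)|)
        (fun z _ => noisy_nonneg h0 h1 fun x _ => abs_nonneg _) (by simp)
    have c : |F (v :: w)| ≤ ∑ x ∈ words w.length, |F (v :: x)| :=
      Finset.single_le_sum (f := fun x => |F (v :: x)|) (fun x _ => abs_nonneg _) (by simp)
    have hs : ∑ x ∈ words (v :: w).length, |F x| =
        (∑ x ∈ words w.length, |F (v :: x)|) + ∑ x ∈ words w.length, |F ((!v) :: x)| := by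
      rw [List.length_cons, sum_words_cons, Fintype.sum_bool]
      cases v <;> simp [add_comm]
    rw [hs, List.length_cons]
    push_cast
    simp only [noisy]
    set A := ∑ x ∈ words w.length, |F (v :: x)|
    set B := ∑ x ∈ words w.length, |F ((!v) :: x)|
    set p := noisy ε (fun x => F (v :: x)) w
    set q := noisy ε (fun x => F ((!v) :: x)) w
    have hA : 0 ≤ A := Finset.sum_nonneg fun _ _ => abs_nonneg _
    have hB : 0 ≤ B := Finset.sum_nonneg fun _ _ => abs_nonneg _
    have e : (1 - ε) * p + ε * q - F (v :: w) =
        (1 - ε) * (p - F (v :: w)) + ε * q - ε * F (v :: w) := by ring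
    rw [e]
    have t1 : |(1 - ε) * (p - F (v :: w))| ≤ ε * (w.length * A) := by
      rw [abs_mul, abs_of_nonneg (by linarith : 0 ≤ 1 - ε)]
      have : (1 - ε) * |p - F (v :: w)| ≤ 1 * |p - F (v :: w)| := by
        gcongr
        linarith
      linarith
    have t2 : |ε * q| ≤ ε * B := by
      rw [abs_mul, abs_of_nonneg h0]
      gcongr
    have t3 : |ε * F (v :: w)| ≤ ε * A := by
      rw [abs_mul, abs_of_nonneg h0]
      gcongr
    have t4 : |(1 - ε) * (p - F (v :: w)) + ε * q - ε * F (v :: w)| ≤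
        ε * (w.length * A) + ε * B + ε * A :=
      (abs_sub _ _).trans (add_le_add ((abs_add_le _ _).trans (add_le_add t1 t2)) t3)
    refine t4.trans ?_
    have : 0 ≤ ε * (w.length * B) := by positivity
    linarith

/-! ### Comparison with the channel on tuples -/

theorem sum_fin_succ {n : ℕ} (f : (Fin (n + 1) → Bool) → ℝ) :
    ∑ x, f x = ∑ b : Bool, ∑ x : Fin n → Bool, f (Fin.cons b x : Fin (n + 1) → Bool) := by
  rw [← (Fin.consEquiv fun _ => Bool).sum_comp, Fintype.sum_prod_type]
  rfl

theorem bscOutput_eq_noisy {n : ℕ} (ε : ℝ) (F : List Bool → ℝ) (z : Fin n → Bool) :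
    bscOutput ε (fun x => F (List.ofFn x)) z = noisy ε F (List.ofFn z) := by
  induction n generalizing F with
  | zero => simp [bscOutput, bscJoint, noisy]
  | succ n ih =>
    have h1 := ih (fun x => F (z 0 :: x)) fun i => z i.succ
    have h2 := ih (fun x => F ((!z 0) :: x)) fun i => z i.succ
    simp only [bscOutput, bscJoint] at h1 h2 ⊢
    rw [sum_fin_succ, List.ofFn_succ]
    simp only [noisy, ← h1, ← h2, Finset.mul_sum, Fintype.sum_bool, Fin.prod_univ_succ,
      Fin.cons_zero, Fin.cons_succ, List.ofFn_succ]
    cases z 0 <;> simp only [noiseProb, Bool.not_true, Bool.not_false, Bool.xor_false,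
      Bool.xor_true, if_true, if_false, Bool.false_eq_true]
    · rw [add_comm]
      congr 1 <;> exact Finset.sum_congr rfl fun _ _ => by ring
    · congr 1 <;> exact Finset.sum_congr rfl fun _ _ => by ring

theorem flipSum_ofFn {n : ℕ} (F : List Bool → ℝ) (u : Fin n → Bool) :
    flipSum F (List.ofFn u) = ∑ i, F (List.ofFn (flipBit u i)) := by
  induction n generalizing F with
  | zero => simp [flipSum]
  | succ n ih =>
    have h := ih (fun x => F (u 0 :: x)) fun i => u i.succ
    rw [List.ofFn_succ, flipSum, h, Fin.sum_univ_succ]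
    congr 1
    · congr 1
      rw [List.ofFn_succ]
      simp [flipBit, Function.update]
    · refine Finset.sum_congr rfl fun i _ => ?_
      rw [List.ofFn_succ]
      congr 2
      congr 1
      funext j
      simp [flipBit, Function.update, Fin.succ_inj]

theorem ofFn_snocBit {n : ℕ} (w : Fin n → Bool) (v : Bool) :
    List.ofFn (snocBit w v) = List.ofFn w ++ [v] := by
  rw [snocBit, List.ofFn_succ', List.concat_eq_append]
  simp

namespace StationaryProcess

theorem hCoeff_eq (X : StationaryProcess) {n : ℕ} (u : Fin n → Bool) :
    X.hCoeff u = noisyDeriv X.prob (List.ofFn u) := by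
  simp [hCoeff, noisyDeriv, law, flipSum_ofFn]

/-- The output of the channel with a stationary input, as a stationary process. -/
def output (X : StationaryProcess) (ε : ℝ) (h0 : 0 ≤ ε) (h1 : ε ≤ 1) : StationaryProcess where
  prob := noisy ε X.prob
  nonneg _ := noisy_nonneg h0 h1 fun x _ => X.nonneg x
  prob_nil := X.prob_nil
  sum_append _ := noisy_marginal_snoc ε fun x _ => X.sum_append x
  sum_cons _ := noisy_marginal_cons ε fun x _ => X.sum_cons x

end StationaryProcess

/-! ### Elementary inequalities for `x log (x / y)` -/

/-- A quantitative form of `x log (x / y) ≥ x - y`; it replaces Pinsker's inequality. -/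
theorem sub_add_sq_le_mul_log_div {x y : ℝ} (hx : 0 ≤ x) (hy : 0 ≤ y) (hx1 : x ≤ 1) (hy1 : y ≤ 1)
    (h : y = 0 → x = 0) : x - y + (x - y) ^ 2 / 4 ≤ x * Real.log (x / y) := by
  rcases hx.eq_or_lt with rfl | hx0
  · nlinarith
  have hy0 : 0 < y := lt_of_le_of_ne hy fun e => hx0.ne' (h e.symm)
  set s := √x
  set t := √y
  have hs : 0 < s := Real.sqrt_pos.2 hx0
  have ht : 0 < t := Real.sqrt_pos.2 hy0
  have hxs : x = s ^ 2 := (Real.sq_sqrt hx).symm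
  have hyt : y = t ^ 2 := (Real.sq_sqrt hy).symm
  have hs1 : s ≤ 1 := Real.sqrt_le_one.2 hx1
  have ht1 : t ≤ 1 := Real.sqrt_le_one.2 hy1
  have hl : Real.log (x / y) = -(2 * Real.log (t / s)) := by
    rw [hxs, hyt, ← div_pow, Real.log_pow, ← inv_div t s, Real.log_inv]
    push_cast
    ring
  have hlog : Real.log (t / s) ≤ t / s - 1 := Real.log_le_sub_one_of_pos (by positivity)
  have h1 : 2 * s ^ 2 - 2 * s * t ≤ x * Real.log (x / y) := by
    rw [hl]
    have : x * (2 * Real.log (t / s)) ≤ x * (2 * (t / s - 1)) := by gcongr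
    have e : x * (2 * (t / s - 1)) = 2 * s * t - 2 * s ^ 2 := by
      rw [hxs]
      field_simp
    linarith
  have h2 : (s - t) ^ 2 * (s + t) ^ 2 ≤ (s - t) ^ 2 * 4 := by
    gcongr
    nlinarith
  rw [hxs, hyt] at *
  nlinarith

theorem sub_le_mul_log_div {x y : ℝ} (hx : 0 ≤ x) (hy : 0 ≤ y) (h : y = 0 → x = 0) :
    x - y ≤ x * Real.log (x / y) := by
  rcases hx.eq_or_lt with rfl | hx0
  · linarith
  have hy0 : 0 < y := lt_of_le_of_ne hy fun e => hx0.ne' (h e.symm)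
  have : Real.log (y / x) ≤ y / x - 1 := Real.log_le_sub_one_of_pos (by positivity)
  rw [← inv_div y x, Real.log_inv]
  have h2 : x * Real.log (y / x) ≤ x * (y / x - 1) := by gcongr
  have e : x * (y / x - 1) = y - x := by field_simp
  linarith

/-- The log-sum inequality for two terms. -/
theorem mul_log_div_add_le {a a' b b' : ℝ} (ha : 0 ≤ a) (ha' : 0 ≤ a') (hb : 0 ≤ b) (hb' : 0 ≤ b')
    (h : b = 0 → a = 0) (h' : b' = 0 → a' = 0) :
    (a + a') * Real.log ((a + a') / (b + b')) ≤
      a * Real.log (a / b) + a' * Real.log (a' / b') := by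
  rcases (add_nonneg ha ha').eq_or_lt with h0 | h0
  · have e : a = 0 := by linarith
    have e' : a' = 0 := by linarith
    simp [e, e']
  rcases (add_nonneg hb hb').eq_or_lt with h1 | h1
  · have := h (by linarith)
    have := h' (by linarith)
    linarith
  set c := (a + a') / (b + b')
  have hc : 0 < c := div_pos h0 h1
  have key : ∀ x y : ℝ, 0 ≤ x → 0 ≤ y → (y = 0 → x = 0) →
      x * Real.log c + (x - c * y) ≤ x * Real.log (x / y) := by
    intro x y hx hy hxy
    have := sub_le_mul_log_div hx (mul_nonneg hc.le hy) fun e => hxy (by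
      rcases mul_eq_zero.1 e with e | e
      · exact absurd e hc.ne'
      · exact e)
    rcases hx.eq_or_lt with rfl | hx0
    · simpa using this
    have hy0 : y ≠ 0 := fun e => hx0.ne' (hxy e)
    have e : Real.log (x / (c * y)) = Real.log (x / y) - Real.log c := by
      rw [← Real.log_div (by positivity) hc.ne']
      congr 1
      field_simp
    rw [e] at this
    linarith
  have k1 := key a b ha hb h
  have k2 := key a' b' ha' hb' h'
  have e : c * b + c * b' = a + a' := by
    rw [← mul_add]
    exact div_mul_cancel₀ _ h1.ne'
  linarith

/-! ### Consistent families of block weights -/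

/-- A family of nonnegative weights of words that is consistent on the right: a measure on
one-sided sequences, given by its values on cylinders. -/
structure IsWordMeasure (F : List Bool → ℝ) : Prop where
  nonneg : ∀ w, 0 ≤ F w
  snoc : ∀ w, F (w ++ [false]) + F (w ++ [true]) = F w

namespace IsWordMeasure

variable {F G : List Bool → ℝ}

theorem sum_bool (hF : IsWordMeasure F) (w : List Bool) : ∑ v : Bool, F (w ++ [v]) = F w := by
  rw [Fintype.sum_bool, add_comm, hF.snoc]

theorem snoc_le (hF : IsWordMeasure F) (w : List Bool) (v : Bool) : F (w ++ [v]) ≤ F w := by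
  have := hF.snoc w
  have := hF.nonneg (w ++ [false])
  have := hF.nonneg (w ++ [true])
  cases v <;> linarith

theorem append_le (hF : IsWordMeasure F) (w u : List Bool) : F (w ++ u) ≤ F w := by
  induction u using List.reverseRecOn with
  | nil => simp
  | append_singleton u v ih =>
    rw [← List.append_assoc]
    exact (hF.snoc_le _ _).trans ih

theorem append_eq_zero (hF : IsWordMeasure F) {w : List Bool} (h : F w = 0) (u : List Bool) :
    F (w ++ u) = 0 :=
  le_antisymm (h ▸ hF.append_le w u) (hF.nonneg _)

theorem append (hF : IsWordMeasure F) (y : List Bool) : IsWordMeasure fun x => F (y ++ x) :=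
  ⟨fun _ => hF.nonneg _, fun w => by simpa using hF.snoc (y ++ w)⟩

theorem const_mul (hF : IsWordMeasure F) {c : ℝ} (hc : 0 ≤ c) : IsWordMeasure fun x => c * F x :=
  ⟨fun _ => mul_nonneg hc (hF.nonneg _), fun w => by rw [← mul_add, hF.snoc]⟩

theorem sum {ι : Type*} {s : Finset ι} {F : ι → List Bool → ℝ}
    (hF : ∀ i ∈ s, IsWordMeasure (F i)) : IsWordMeasure fun x => ∑ i ∈ s, F i x :=
  ⟨fun _ => Finset.sum_nonneg fun i hi => (hF i hi).nonneg _, fun w => by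
    rw [← Finset.sum_add_distrib]
    exact Finset.sum_congr rfl fun i hi => (hF i hi).snoc w⟩

theorem noisy (hF : IsWordMeasure F) {ε : ℝ} (h0 : 0 ≤ ε) (h1 : ε ≤ 1) :
    IsWordMeasure (noisy ε F) :=
  ⟨fun _ => noisy_nonneg h0 h1 fun _ _ => hF.nonneg _,
    fun _ => noisy_marginal_snoc ε fun _ _ => hF.snoc _⟩

theorem sum_append (hF : IsWordMeasure F) (w : List Bool) (n : ℕ) :
    ∑ u ∈ words n, F (w ++ u) = F w := by
  induction n with
  | zero => simp [sum_words_zero]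
  | succ n ih =>
    rw [sum_words_snoc, ← ih]
    refine Finset.sum_congr rfl fun u _ => ?_
    simpa using hF.sum_bool (w ++ u)

theorem sum_words (hF : IsWordMeasure F) (n : ℕ) : ∑ u ∈ words n, F u = F [] := by
  simpa using hF.sum_append [] n

theorem exists_append_pos (hF : IsWordMeasure F) {w : List Bool} (h : 0 < F w) (n : ℕ) :
    ∃ u, u.length = n ∧ 0 < F (w ++ u) := by
  by_contra! hc
  have : ∑ u ∈ words n, F (w ++ u) ≤ 0 := Finset.sum_nonpos fun u hu => hc u (mem_words.1 hu)
  rw [hF.sum_append] at this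
  linarith

theorem le_nil (hF : IsWordMeasure F) (w : List Bool) : F w ≤ F [] := by
  simpa using hF.append_le [] w

end IsWordMeasure

theorem StationaryProcess.isWordMeasure (X : StationaryProcess) : IsWordMeasure X.prob :=
  ⟨X.nonneg, X.sum_append⟩

/-- The family of block weights obtained by ignoring the first `k` symbols. -/
def shiftBy (k : ℕ) (F : List Bool → ℝ) (w : List Bool) : ℝ := ∑ a ∈ words k, F (a ++ w)

theorem IsWordMeasure.shiftBy {F : List Bool → ℝ} (hF : IsWordMeasure F) (k : ℕ) :
    IsWordMeasure (shiftBy k F) :=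
  IsWordMeasure.sum fun a _ => hF.append a

theorem shiftBy_zero (F : List Bool → ℝ) : shiftBy 0 F = F := by
  funext w
  simp [shiftBy, sum_words_zero]

theorem shiftBy_cons (k : ℕ) (F : List Bool → ℝ) (w : List Bool) :
    shiftBy k F (false :: w) + shiftBy k F (true :: w) = shiftBy (k + 1) F w := by
  simp only [shiftBy, sum_words_snoc, Fintype.sum_bool, ← Finset.sum_add_distrib]
  exact Finset.sum_congr rfl fun a _ => by rw [add_comm]; simp

theorem StationaryProcess.shiftBy_prob (X : StationaryProcess) (k : ℕ) :
    shiftBy k X.prob = X.prob := by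
  induction k with
  | zero => exact shiftBy_zero _
  | succ k ih =>
    funext w
    rw [← shiftBy_cons, ih, X.sum_cons]

theorem shiftBy_noisy (ε : ℝ) (k : ℕ) (F : List Bool → ℝ) (w : List Bool) :
    shiftBy k (noisy ε F) w = noisy ε (shiftBy k F) w := by
  simp only [shiftBy, noisy_append]
  rw [sum_noisy, ← noisy_sum]
  rfl

/-! ### Entropies of block weights -/

/-- The entropy of the block of the first `n` symbols. -/
def blockEntropy (F : List Bool → ℝ) (n : ℕ) : ℝ := ∑ w ∈ words n, Real.negMulLog (F w)

/-- The conditional entropy of symbol `n + 1` given the first `n` symbols. -/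
def condEnt (F : List Bool → ℝ) (n : ℕ) : ℝ :=
  -∑ w ∈ words n, ∑ v : Bool, F (w ++ [v]) * Real.log (F (w ++ [v]) / F w)

/-- The cross entropy of symbol `n + 1` under `F`, when it is predicted by the conditional
probabilities of `G`. -/
def crossEnt (n : ℕ) (F G : List Bool → ℝ) : ℝ :=
  -∑ w ∈ words n, ∑ v : Bool, F (w ++ [v]) * Real.log (G (w ++ [v]) / G w)

/-- The conditional relative entropy of symbol `n + 1` given the first `n` symbols. -/
def klCond (n : ℕ) (F G : List Bool → ℝ) : ℝ :=
  ∑ w ∈ words n, ∑ v : Bool,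
    F (w ++ [v]) * Real.log (F (w ++ [v]) / (F w * (G (w ++ [v]) / G w)))

theorem crossEnt_self (n : ℕ) (F : List Bool → ℝ) : crossEnt n F F = condEnt F n := rfl

theorem entropy_law {n : ℕ} (F : List Bool → ℝ) :
    entropy (fun x : Fin n → Bool => F (List.ofFn x)) = blockEntropy F n := by
  simp only [entropy, blockEntropy]
  exact sum_ofFn n fun w => Real.negMulLog (F w)

theorem blockEntropy_succ {F : List Bool → ℝ} (hF : IsWordMeasure F) (n : ℕ) :
    blockEntropy F (n + 1) = blockEntropy F n + condEnt F n := by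
  simp only [blockEntropy, condEnt, sum_words_snoc]
  rw [← sub_eq_add_neg, ← Finset.sum_sub_distrib]
  refine Finset.sum_congr rfl fun w _ => ?_
  have key : ∀ v : Bool, Real.negMulLog (F (w ++ [v])) =
      F (w ++ [v]) * -Real.log (F w) - F (w ++ [v]) * Real.log (F (w ++ [v]) / F w) := by
    intro v
    by_cases h : F (w ++ [v]) = 0
    · simp [h]
    · have hw : F w ≠ 0 := fun e => h (hF.append_eq_zero e _)
      rw [Real.log_div h hw, Real.negMulLog]
      ring
  simp only [key]
  rw [Finset.sum_sub_distrib, ← Finset.sum_mul, hF.sum_bool, Real.negMulLog]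
  ring

theorem blockEntropy_eq_sum {F : List Bool → ℝ} (hF : IsWordMeasure F) (h1 : F [] = 1) (n : ℕ) :
    blockEntropy F n = ∑ j ∈ Finset.range n, condEnt F j := by
  induction n with
  | zero => simp [blockEntropy, sum_words_zero, h1]
  | succ n ih => rw [blockEntropy_succ hF, ih, Finset.sum_range_succ]

theorem condEnt_add (F : List Bool → ℝ) (k n : ℕ) :
    condEnt F (k + n) = ∑ y ∈ words k, condEnt (fun x => F (y ++ x)) n := by
  simp [condEnt, sum_words_add]

theorem crossEnt_sum {ι : Type*} (s : Finset ι) (n : ℕ) (F : ι → List Bool → ℝ)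
    (G : List Bool → ℝ) :
    crossEnt n (fun x => ∑ i ∈ s, F i x) G = ∑ i ∈ s, crossEnt n (F i) G := by
  simp only [crossEnt, Finset.sum_mul]
  rw [Finset.sum_neg_distrib]
  refine congrArg Neg.neg (Eq.symm ?_)
  rw [Finset.sum_comm]
  refine Finset.sum_congr rfl fun w _ => ?_
  rw [Finset.sum_comm]

theorem crossEnt_const_mul (n : ℕ) (c : ℝ) (F G : List Bool → ℝ) :
    crossEnt n (fun x => c * F x) G = c * crossEnt n F G := by
  simp only [crossEnt, mul_assoc, ← Finset.mul_sum, mul_neg]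

theorem condEnt_eq_crossEnt_sub_klCond {F G : List Bool → ℝ} {n : ℕ} (hF : IsWordMeasure F)
    (hG : IsWordMeasure G)
    (h : ∀ w v, w.length = n → G (w ++ [v]) = 0 → F (w ++ [v]) = 0) :
    condEnt F n = crossEnt n F G - klCond n F G := by
  simp only [condEnt, crossEnt, klCond]
  rw [← neg_add', ← Finset.sum_add_distrib, neg_inj]
  refine Finset.sum_congr rfl fun w hw => ?_
  rw [← Finset.sum_add_distrib]
  refine Finset.sum_congr rfl fun v _ => ?_
  by_cases hz : F (w ++ [v]) = 0
  · simp [hz]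
  have hFw : F w ≠ 0 := fun e => hz (hF.append_eq_zero e _)
  have hGv : G (w ++ [v]) ≠ 0 := fun e => hz (h w v (mem_words.1 hw) e)
  have hGw : G w ≠ 0 := fun e => hGv (hG.append_eq_zero e _)
  rw [← mul_add, ← Real.log_mul (by positivity) (by positivity)]
  congr 2
  field_simp

/-- Quadratic lower bound for the conditional relative entropy. -/
theorem sum_sq_le_klCond {F G : List Bool → ℝ} {n : ℕ} (hF : IsWordMeasure F) (hF1 : F [] ≤ 1)
    (hG : IsWordMeasure G)
    (h : ∀ w v, w.length = n → G (w ++ [v]) = 0 → F (w ++ [v]) = 0) :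
    (∑ w ∈ words n, ∑ v : Bool, (F (w ++ [v]) - F w * (G (w ++ [v]) / G w)) ^ 2) / 4 ≤
      klCond n F G := by
  have key : ∀ w ∈ words n, ∑ v : Bool, (F (w ++ [v]) - F w * (G (w ++ [v]) / G w)) ^ 2 / 4 ≤
      ∑ v : Bool, F (w ++ [v]) * Real.log (F (w ++ [v]) / (F w * (G (w ++ [v]) / G w))) := by
    intro w hw
    have hw' := mem_words.1 hw
    have hle : ∀ v, G (w ++ [v]) / G w ≤ 1 := fun v =>
      div_le_one_of_le₀ (hG.snoc_le w v) (hG.nonneg _)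
    have hge : ∀ v, 0 ≤ G (w ++ [v]) / G w := fun v => div_nonneg (hG.nonneg _) (hG.nonneg _)
    have hb : ∑ v : Bool, F w * (G (w ++ [v]) / G w) ≤ F w := by
      rw [← Finset.mul_sum, ← Finset.sum_div, hG.sum_bool]
      exact mul_le_of_le_one_right (hF.nonneg w) (div_self_le_one _)
    have hq : ∀ v : Bool, (F (w ++ [v]) - F w * (G (w ++ [v]) / G w)) +
        (F (w ++ [v]) - F w * (G (w ++ [v]) / G w)) ^ 2 / 4 ≤
        F (w ++ [v]) * Real.log (F (w ++ [v]) / (F w * (G (w ++ [v]) / G w))) := by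
      intro v
      refine sub_add_sq_le_mul_log_div (hF.nonneg _) (mul_nonneg (hF.nonneg _) (hge v))
        ((hF.le_nil _).trans hF1)
        (mul_le_one₀ ((hF.le_nil _).trans hF1) (hge v) (hle v)) fun e => ?_
      rcases mul_eq_zero.1 e with e | e
      · exact hF.append_eq_zero e _
      · rcases div_eq_zero_iff.1 e with e | e
        · exact h w v hw' e
        · exact h w v hw' (hG.append_eq_zero e _)
    have hs := Finset.sum_le_sum fun v (_ : v ∈ Finset.univ) => hq v
    rw [Finset.sum_add_distrib, Finset.sum_sub_distrib, hF.sum_bool] at hs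
    linarith
  have := Finset.sum_le_sum key
  simp only [← Finset.sum_div] at this
  exact this

theorem klCond_nonneg {F G : List Bool → ℝ} {n : ℕ} (hF : IsWordMeasure F) (hF1 : F [] ≤ 1)
    (hG : IsWordMeasure G)
    (h : ∀ w v, w.length = n → G (w ++ [v]) = 0 → F (w ++ [v]) = 0) : 0 ≤ klCond n F G :=
  le_trans (div_nonneg (Finset.sum_nonneg fun _ _ => Finset.sum_nonneg fun _ _ => sq_nonneg _)
    (by norm_num)) (sum_sq_le_klCond hF hF1 hG h)

/-- The entropy of a symbol given all the past is the cross entropy of the shifted process with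
respect to a predictor of memory `n`, minus the information lost by that predictor. -/
theorem condEnt_add_eq {F G : List Bool → ℝ} {k n : ℕ} (hF : IsWordMeasure F)
    (hG : IsWordMeasure G)
    (h : ∀ y w v, y.length = k → w.length = n → G (w ++ [v]) = 0 → F (y ++ (w ++ [v])) = 0) :
    condEnt F (k + n) =
      crossEnt n (shiftBy k F) G - ∑ y ∈ words k, klCond n (fun x => F (y ++ x)) G := by
  rw [condEnt_add, show shiftBy k F = fun x => ∑ y ∈ words k, F (y ++ x) from rfl, crossEnt_sum,
    ← Finset.sum_sub_distrib]
  exact Finset.sum_congr rfl fun y hy =>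
    condEnt_eq_crossEnt_sub_klCond (hF.append y) hG fun w v => h y w v (mem_words.1 hy)

theorem condEnt_add_le {F G : List Bool → ℝ} {k n : ℕ} (hF : IsWordMeasure F) (hF1 : F [] ≤ 1)
    (hG : IsWordMeasure G)
    (h : ∀ y w v, y.length = k → w.length = n → G (w ++ [v]) = 0 → F (y ++ (w ++ [v])) = 0) :
    condEnt F (k + n) ≤ crossEnt n (shiftBy k F) G := by
  rw [condEnt_add_eq hF hG h]
  have : 0 ≤ ∑ y ∈ words k, klCond n (fun x => F (y ++ x)) G :=
    Finset.sum_nonneg fun y hy => klCond_nonneg (hF.append y)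
      (by simpa using (hF.le_nil y).trans hF1) hG fun w v => h y w v (mem_words.1 hy)
  linarith

theorem append_eq_zero_of_shiftBy_eq_zero {F : List Bool → ℝ} (hF : IsWordMeasure F) {k : ℕ}
    {w : List Bool} (h : shiftBy k F w = 0) {y : List Bool} (hy : y.length = k) :
    F (y ++ w) = 0 :=
  (Finset.sum_eq_zero_iff_of_nonneg fun _ _ => hF.nonneg _).1 h y (mem_words.2 hy)

/-- Conditioning on a longer past reduces entropy. -/
theorem condEnt_add_le_shiftBy {F : List Bool → ℝ} (hF : IsWordMeasure F) (hF1 : F [] ≤ 1)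
    (k n : ℕ) : condEnt F (k + n) ≤ condEnt (shiftBy k F) n := by
  rw [condEnt_add, show condEnt (shiftBy k F) n = crossEnt n (shiftBy k F) (shiftBy k F) from rfl]
  conv_rhs => rw [show crossEnt n (shiftBy k F) (shiftBy k F) =
    crossEnt n (fun x => ∑ y ∈ words k, F (y ++ x)) (shiftBy k F) from rfl, crossEnt_sum]
  refine Finset.sum_le_sum fun y hy => ?_
  have hz : ∀ w v, w.length = n → shiftBy k F (w ++ [v]) = 0 → F (y ++ (w ++ [v])) = 0 :=
    fun w v _ e => append_eq_zero_of_shiftBy_eq_zero hF e (mem_words.1 hy)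
  rw [condEnt_eq_crossEnt_sub_klCond (hF.append y) (hF.shiftBy k) hz]
  have := klCond_nonneg (hF.append y) (by simpa using (hF.le_nil y).trans hF1) (hF.shiftBy k) hz
  linarith

theorem crossEnt_nonneg {F G : List Bool → ℝ} (n : ℕ) (hF : IsWordMeasure F)
    (hG : IsWordMeasure G) : 0 ≤ crossEnt n F G := by
  rw [crossEnt, neg_nonneg]
  refine Finset.sum_nonpos fun w _ => Finset.sum_nonpos fun v _ => ?_
  exact mul_nonpos_of_nonneg_of_nonpos (hF.nonneg _)
    (Real.log_nonpos (div_nonneg (hG.nonneg _) (hG.nonneg _))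
      (div_le_one_of_le₀ (hG.snoc_le w v) (hG.nonneg _)))

theorem condEnt_nonneg {F : List Bool → ℝ} (hF : IsWordMeasure F) (n : ℕ) : 0 ≤ condEnt F n :=
  crossEnt_nonneg n hF hF

theorem condEnt_le_log_two {F : List Bool → ℝ} (hF : IsWordMeasure F) (hF1 : F [] = 1) (n : ℕ) :
    condEnt F n ≤ Real.log 2 := by
  have hG : IsWordMeasure fun w : List Bool => (1 / 2 : ℝ) ^ w.length :=
    ⟨fun w => by positivity, fun w => by
      simp only [List.length_append, List.length_singleton, pow_succ]
      ring⟩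
  have := condEnt_add_le (k := 0) (n := n) hF hF1.le hG
    (by intro y w v _ _ e; exact absurd e (by positivity))
  rw [zero_add, shiftBy_zero] at this
  refine this.trans_eq ?_
  have hl : ∀ (w : List Bool) (v : Bool),
      Real.log ((1 / 2 : ℝ) ^ (w ++ [v]).length / (1 / 2 : ℝ) ^ w.length) = -Real.log 2 := by
    intro w v
    rw [← Real.log_inv]
    congr 1
    simp only [List.length_append, List.length_singleton, pow_succ]
    field_simp
  simp only [crossEnt, hl, ← Finset.sum_mul, hF.sum_bool, hF.sum_words, hF1]
  ring

/-! ### Entropy rates of stationary processes -/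

namespace StationaryProcess

theorem condEnt_antitone (X : StationaryProcess) : Antitone (condEnt X.prob) := by
  intro n N h
  obtain ⟨k, rfl⟩ := Nat.exists_eq_add_of_le' h
  have := condEnt_add_le_shiftBy X.isWordMeasure X.prob_nil.le k n
  rwa [X.shiftBy_prob] at this

theorem tendsto_condEnt (X : StationaryProcess) :
    Tendsto (condEnt X.prob) atTop (𝓝 (⨅ n, condEnt X.prob n)) :=
  tendsto_atTop_ciInf X.condEnt_antitone
    ⟨0, by rintro _ ⟨n, rfl⟩; exact condEnt_nonneg X.isWordMeasure n⟩

theorem tendsto_blockEntropy_div (X : StationaryProcess) :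
    Tendsto (fun n : ℕ => blockEntropy X.prob (n + 1) / ((n : ℝ) + 1)) atTop
      (𝓝 (⨅ n, condEnt X.prob n)) := by
  have h := (X.tendsto_condEnt.cesaro).comp (tendsto_add_atTop_nat 1)
  refine h.congr fun n => ?_
  simp only [Function.comp]
  rw [blockEntropy_eq_sum X.isWordMeasure X.prob_nil]
  push_cast
  rw [div_eq_inv_mul]

/-- The entropy rate is the limit (here: the infimum) of the conditional entropies. -/
theorem entropyRate_law (X : StationaryProcess) :
    entropyRate X.law = ⨅ n, condEnt X.prob n := by
  refine Tendsto.limUnder_eq ?_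
  have e : ∀ n, entropy (X.law n) = blockEntropy X.prob n := fun n => entropy_law X.prob
  simpa only [e] using X.tendsto_blockEntropy_div

theorem entropyRate_output (X : StationaryProcess) {ε : ℝ} (h0 : 0 ≤ ε) (h1 : ε ≤ 1) :
    (entropyRate fun n => bscOutput ε (X.law n)) = ⨅ n, condEnt (noisy ε X.prob) n := by
  have e : (fun n => bscOutput ε (X.law n)) = (X.output ε h0 h1).law := by
    funext n z
    exact bscOutput_eq_noisy ε X.prob z
  rw [e, entropyRate_law]
  rfl

theorem iInf_condEnt_le (X : StationaryProcess) (n : ℕ) :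
    ⨅ n, condEnt X.prob n ≤ condEnt X.prob n :=
  ciInf_le ⟨0, by rintro _ ⟨n, rfl⟩; exact condEnt_nonneg X.isWordMeasure n⟩ n

theorem le_iInf_condEnt (X : StationaryProcess) {c : ℝ} {N : ℕ}
    (h : ∀ k, c ≤ condEnt X.prob (k + N)) : c ≤ ⨅ n, condEnt X.prob n :=
  le_ciInf fun n => (h n).trans (X.condEnt_antitone (Nat.le_add_right n N))

end StationaryProcess

/-! ### The block capacity as a maximal output entropy -/

/-- `F` is (the extension to all words of) a law of the first `n` input symbols that is supported
on the constraint `S`. -/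
structure IsInput (S : Set (List Bool)) (n : ℕ) (F : List Bool → ℝ) : Prop where
  isWordMeasure : IsWordMeasure F
  nil : F [] = 1
  mem : ∀ w, w.length = n → 0 < F w → w ∈ S

/-- The output entropies of `n` symbols that the inputs in `S` can produce. -/
def outputEntropies (S : Set (List Bool)) (ε : ℝ) (n : ℕ) : Set ℝ :=
  {r | ∃ F, IsInput S n F ∧ r = blockEntropy (noisy ε F) n}

/-- The largest output entropy of `n` symbols for inputs in `S`. -/
def maxOutputEntropy (S : Set (List Bool)) (ε : ℝ) (n : ℕ) : ℝ := sSup (outputEntropies S ε n)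

theorem StationaryProcess.isInput (X : StationaryProcess) {S : Set (List Bool)}
    (hX : X.allowed ⊆ S) (n : ℕ) : IsInput S n X.prob :=
  ⟨X.isWordMeasure, X.prob_nil, fun _ _ h => hX h⟩

/-- Every law of a block of length `n` extends to a measure on one-sided sequences; the block is
continued by zeros. -/
theorem exists_isWordMeasure_extension {n : ℕ} {p : (Fin n → Bool) → ℝ}
    (hp : p ∈ stdSimplex ℝ (Fin n → Bool)) :
    ∃ F, IsWordMeasure F ∧ F [] = 1 ∧ ∀ x, F (List.ofFn x) = p x := by
  have key : ∀ (x : List Bool), IsWordMeasure fun w : List Bool =>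
      if w <+: x ++ List.replicate w.length false then (1 : ℝ) else 0 := by
    intro x
    refine ⟨fun w => by positivity, fun w => ?_⟩
    have e : ∀ v : Bool, (w ++ [v] <+: x ++ List.replicate (w ++ [v]).length false) ↔
        w <+: x ++ List.replicate w.length false ∧
          (x ++ List.replicate (w.length + 1) false)[w.length]? = some v := by
      intro v
      simp only [List.prefix_iff_getElem?, List.length_append, List.length_singleton]
      constructor
      · intro h
        refine ⟨fun i hi => ?_, ?_⟩
        · have := h i (by omega)
          rw [List.getElem_append_left hi] at this
          rw [← this]
          simp only [List.getElem?_append, List.getElem?_replicate]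
          grind
        · have := h w.length (by omega)
          simpa using this
      · rintro ⟨h, hv⟩ i hi
        by_cases hi' : i < w.length
        · have := h i hi'
          rw [List.getElem_append_left hi', ← this]
          simp only [List.getElem?_append, List.getElem?_replicate]
          grind
        · have : i = w.length := by omega
          subst this
          simpa using hv
    have hlen : w.length < (x ++ List.replicate (w.length + 1) false).length := by
      simp
      omega
    simp only [e, List.getElem?_eq_getElem hlen, Option.some.injEq]
    cases (x ++ List.replicate (w.length + 1) false)[w.length] <;> simp
  refine ⟨fun w => ∑ x : Fin n → Bool, p x *
    (if w <+: List.ofFn x ++ List.replicate w.length false then (1 : ℝ) else 0),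
    IsWordMeasure.sum fun x _ => (key _).const_mul (hp.1 x), ?_, ?_⟩
  · simpa using hp.2
  · intro x
    dsimp only
    rw [Finset.sum_eq_single x]
    · simp
    · intro y _ hy
      have : ¬ List.ofFn x <+: List.ofFn y ++ List.replicate (List.ofFn x).length false := by
        intro h
        have h2 := List.prefix_of_prefix_length_le h (List.prefix_append _ _) (by simp)
        exact hy (List.ofFn_injective (h2.eq_of_length (by simp))).symm
      rw [if_neg this, mul_zero]
    · simp

theorem entropy_noise_block (ε : ℝ) {n : ℕ} (x : Fin n → Bool) :
    (∑ z : Fin n → Bool, ∏ i, noiseProb ε (xor (x i) (z i)) = 1) ∧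
      ∑ z : Fin n → Bool, Real.negMulLog (∏ i, noiseProb ε (xor (x i) (z i))) =
        n * Real.binEntropy ε := by
  induction n with
  | zero => simp
  | succ n ih =>
    obtain ⟨h1, h2⟩ := ih fun i => x i.succ
    have hs : noiseProb ε (xor (x 0) true) + noiseProb ε (xor (x 0) false) = 1 := by
      cases x 0 <;> simp [noiseProb]
    have he : Real.negMulLog (noiseProb ε (xor (x 0) true)) +
        Real.negMulLog (noiseProb ε (xor (x 0) false)) = Real.binEntropy ε := by
      rw [Real.binEntropy_eq_negMulLog_add_negMulLog_one_sub]
      cases x 0 <;> simp [noiseProb, add_comm]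
    constructor
    · simp only [sum_fin_succ, Fin.prod_univ_succ, Fin.cons_zero, Fin.cons_succ, ← Finset.mul_sum,
        h1, Fintype.sum_bool, mul_one, hs]
    · simp only [sum_fin_succ, Fin.prod_univ_succ, Fin.cons_zero, Fin.cons_succ, Fintype.sum_bool,
        Real.negMulLog_mul, Finset.sum_add_distrib, ← Finset.mul_sum, ← Finset.sum_mul, h1, h2]
      push_cast
      linear_combination (n * Real.binEntropy ε) * hs + he

/-- Given the input, the output has the entropy of the noise. -/
theorem condEntropy_bscJoint (ε : ℝ) {n : ℕ} {p : (Fin n → Bool) → ℝ}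
    (hp : p ∈ stdSimplex ℝ (Fin n → Bool)) :
    condEntropy (bscJoint ε p) = n * Real.binEntropy ε := by
  have key : ∀ x, ∑ z, bscJoint ε p x z *
      Real.log (bscJoint ε p x z / ∑ z', bscJoint ε p x z') = p x * -(n * Real.binEntropy ε) := by
    intro x
    obtain ⟨h1, h2⟩ := entropy_noise_block ε x
    by_cases h0 : p x = 0
    · simp [bscJoint, h0]
    · simp only [bscJoint, ← Finset.mul_sum, h1, mul_one]
      simp only [mul_div_cancel_left₀ _ h0, mul_assoc, ← Finset.mul_sum]
      rw [← h2, ← Finset.sum_neg_distrib]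
      simp only [Real.negMulLog, neg_mul, neg_neg]
  simp only [condEntropy, key, ← Finset.sum_mul, hp.2]
  ring

theorem blockEntropy_output_le {S : Set (List Bool)} {ε : ℝ} (h0 : 0 ≤ ε) (h1 : ε ≤ 1) {n : ℕ}
    {F : List Bool → ℝ} (hF : IsInput S n F) :
    blockEntropy (noisy ε F) n ≤ n * Real.log 2 := by
  have hZ := hF.isWordMeasure.noisy h0 h1
  rw [blockEntropy_eq_sum hZ hF.nil]
  refine (Finset.sum_le_sum fun j _ => condEnt_le_log_two hZ hF.nil j).trans_eq ?_
  simp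

theorem bddAbove_outputEntropies (S : Set (List Bool)) {ε : ℝ} (h0 : 0 ≤ ε) (h1 : ε ≤ 1) (n : ℕ) :
    BddAbove (outputEntropies S ε n) := by
  refine ⟨n * Real.log 2, ?_⟩
  rintro _ ⟨F, hF, rfl⟩
  exact blockEntropy_output_le h0 h1 hF

/-- In the mutual information of input and output, only the output entropy depends on the input. -/
theorem blockCapacity_eq {S : Set (List Bool)} {X : StationaryProcess} (hX : X.allowed ⊆ S) {ε : ℝ}
    (h0 : 0 ≤ ε) (h1 : ε ≤ 1) (n : ℕ) :
    blockCapacity S ε n = maxOutputEntropy S ε (n + 1) / ((n : ℝ) + 1) - Real.binEntropy ε := by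
  have hn : (0 : ℝ) < (n : ℝ) + 1 := by positivity
  have hset : {r : ℝ | ∃ p ∈ stdSimplex ℝ (Fin (n + 1) → Bool),
      (∀ w, 0 < p w → List.ofFn w ∈ S) ∧
      r = (entropy (bscOutput ε p) - condEntropy (bscJoint ε p)) / ((n : ℝ) + 1)} =
      (fun r => r / ((n : ℝ) + 1) - Real.binEntropy ε) '' outputEntropies S ε (n + 1) := by
    have hH : ∀ F : List Bool → ℝ, entropy (bscOutput ε fun x : Fin (n + 1) → Bool =>
        F (List.ofFn x)) = blockEntropy (noisy ε F) (n + 1) := by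
      intro F
      rw [← entropy_law]
      congr 1
      funext z
      exact bscOutput_eq_noisy ε F z
    ext r
    constructor
    · rintro ⟨p, hp, hpS, rfl⟩
      obtain ⟨F, hF, hF1, hFp⟩ := exists_isWordMeasure_extension hp
      refine ⟨_, ⟨F, ⟨hF, hF1, fun w hw hpos => ?_⟩, rfl⟩, ?_⟩
      · obtain ⟨x, -, rfl⟩ := Finset.mem_map.1 (mem_words.2 hw)
        exact hpS x (by simpa [← hFp x] using hpos)
      · have hp' : p = fun x => F (List.ofFn x) := funext fun x => (hFp x).symm
        rw [condEntropy_bscJoint ε hp, hp', hH]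
        push_cast
        field_simp
    · rintro ⟨_, ⟨F, hF, rfl⟩, rfl⟩
      have hp : (fun x : Fin (n + 1) → Bool => F (List.ofFn x)) ∈
          stdSimplex ℝ (Fin (n + 1) → Bool) :=
        ⟨fun x => hF.isWordMeasure.nonneg _, by
          rw [sum_ofFn, hF.isWordMeasure.sum_words, hF.nil]⟩
      refine ⟨_, hp, fun w hw => hF.mem _ (by simp) hw, ?_⟩
      rw [condEntropy_bscJoint ε hp, hH]
      push_cast
      field_simp
  rw [blockCapacity, hset, maxOutputEntropy]
  have hmono : Monotone fun r : ℝ => r / ((n : ℝ) + 1) - Real.binEntropy ε := by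
    intro a b hab
    dsimp only
    gcongr
  have hne : (outputEntropies S ε (n + 1)).Nonempty := ⟨_, X.prob, X.isInput hX _, rfl⟩
  exact (hmono.map_csSup_of_continuousAt (by fun_prop) hne
    (bddAbove_outputEntropies S h0 h1 _)).symm

theorem le_maxOutputEntropy {S : Set (List Bool)} {ε : ℝ} (h0 : 0 ≤ ε) (h1 : ε ≤ 1) {n : ℕ}
    {F : List Bool → ℝ} (hF : IsInput S n F) :
    blockEntropy (noisy ε F) n ≤ maxOutputEntropy S ε n :=
  le_csSup (bddAbove_outputEntropies S h0 h1 n) ⟨F, hF, rfl⟩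

/-- `S` is closed under passing to contiguous subwords. -/
def IsFactorial (S : Set (List Bool)) : Prop := ∀ u w, u <:+: w → w ∈ S → u ∈ S

theorem IsFiniteType.isFactorial {S : Set (List Bool)} (hS : IsFiniteType S) : IsFactorial S := by
  obtain ⟨F, rfl⟩ := hS
  exact fun u w huw hw f hf hfu => hw f hf (hfu.trans huw)

theorem IsInput.mono {S : Set (List Bool)} (hS : IsFactorial S) {n k : ℕ} (hk : k ≤ n)
    {F : List Bool → ℝ} (hF : IsInput S n F) {w : List Bool} (hw : w.length = k) (h : 0 < F w) :
    w ∈ S := by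
  obtain ⟨u, hu, hp⟩ := hF.isWordMeasure.exists_append_pos h (n - k)
  exact hS w _ (List.prefix_append w u).isInfix (hF.mem _ (by simp; omega) hp)

theorem IsInput.mem_of_shiftBy_pos {S : Set (List Bool)} (hS : IsFactorial S) {n k : ℕ}
    {F : List Bool → ℝ} (hF : IsInput S (k + n) F) {w : List Bool} (hw : w.length ≤ n)
    (h : 0 < shiftBy k F w) : w ∈ S := by
  by_contra hc
  have : shiftBy k F w = 0 := Finset.sum_eq_zero fun a ha => by
    refine le_antisymm (not_lt.1 fun hp => hc ?_) (hF.isWordMeasure.nonneg _)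
    exact hS w _ (List.suffix_append a w).isInfix
      (hF.mono hS (k := k + w.length) (by omega) (by simp [mem_words.1 ha]) hp)
  exact h.ne' this

theorem shiftBy_nil {F : List Bool → ℝ} (hF : IsWordMeasure F) (h : F [] = 1) (k : ℕ) :
    shiftBy k F [] = 1 := by
  simp [shiftBy, hF.sum_words, h]

theorem blockEntropy_add_le {F : List Bool → ℝ} (hF : IsWordMeasure F) (hF1 : F [] = 1)
    (k n : ℕ) : blockEntropy F (k + n) ≤ blockEntropy F k + blockEntropy (shiftBy k F) n := by
  rw [blockEntropy_eq_sum hF hF1, blockEntropy_eq_sum hF hF1,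
    blockEntropy_eq_sum (hF.shiftBy k) (shiftBy_nil hF hF1 k), Finset.sum_range_add]
  gcongr with j
  exact condEnt_add_le_shiftBy hF hF1.le k j

/-- Parts of an input in `S` are inputs in `S`, and conditioning reduces entropy; Fekete's lemma
then gives the limit of the block capacities. -/
theorem subadditive_maxOutputEntropy {S : Set (List Bool)} (hS : IsFactorial S)
    {X : StationaryProcess} (hX : X.allowed ⊆ S) {ε : ℝ} (h0 : 0 ≤ ε) (h1 : ε ≤ 1) :
    Subadditive (maxOutputEntropy S ε) := by
  intro k n
  refine csSup_le ⟨_, X.prob, X.isInput hX _, rfl⟩ ?_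
  rintro _ ⟨F, hF, rfl⟩
  refine (blockEntropy_add_le (hF.isWordMeasure.noisy h0 h1) hF.nil k n).trans ?_
  have e : shiftBy k (noisy ε F) = noisy ε (shiftBy k F) :=
    funext fun w => shiftBy_noisy ε k F w
  rw [e]
  refine add_le_add (le_maxOutputEntropy h0 h1 ?_) (le_maxOutputEntropy h0 h1 ?_)
  · exact ⟨hF.isWordMeasure, hF.nil, fun w hw h => hF.mono hS (by omega) hw h⟩
  · exact ⟨hF.isWordMeasure.shiftBy k, shiftBy_nil hF.isWordMeasure hF.nil k,
      fun w hw h => hF.mem_of_shiftBy_pos hS hw.le h⟩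

/-- The limit that defines the capacity exists. -/
theorem tendsto_blockCapacity {S : Set (List Bool)} (hS : IsFactorial S)
    {X : StationaryProcess} (hX : X.allowed ⊆ S) {ε : ℝ} (h0 : 0 ≤ ε) (h1 : ε ≤ 1) :
    Tendsto (blockCapacity S ε) atTop (𝓝 (noisyCapacity S ε)) := by
  have hsub := subadditive_maxOutputEntropy hS hX h0 h1
  have hnn : ∀ n, 0 ≤ maxOutputEntropy S ε n := fun n => by
    refine le_trans ?_ (le_maxOutputEntropy h0 h1 (X.isInput hX n))
    rw [blockEntropy_eq_sum (X.isWordMeasure.noisy h0 h1) X.prob_nil]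
    exact Finset.sum_nonneg fun j _ => condEnt_nonneg (X.isWordMeasure.noisy h0 h1) j
  have hlim := hsub.tendsto_lim ⟨0, by
    rintro _ ⟨n, rfl⟩
    exact div_nonneg (hnn n) n.cast_nonneg⟩
  have h2 := ((hlim.comp (tendsto_add_atTop_nat 1)).sub_const (Real.binEntropy ε))
  have h3 : Tendsto (blockCapacity S ε) atTop (𝓝 (hsub.lim - Real.binEntropy ε)) := by
    refine h2.congr fun n => ?_
    rw [blockCapacity_eq hX h0 h1]
    simp
  rw [noisyCapacity, h3.limUnder_eq]
  exact h3

theorem tendsto_maxOutputEntropy_div {S : Set (List Bool)} (hS : IsFactorial S)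
    {X : StationaryProcess} (hX : X.allowed ⊆ S) {ε : ℝ} (h0 : 0 ≤ ε) (h1 : ε ≤ 1) :
    Tendsto (fun n : ℕ => maxOutputEntropy S ε (n + 1) / ((n : ℝ) + 1)) atTop
      (𝓝 (noisyCapacity S ε + Real.binEntropy ε)) := by
  refine ((tendsto_blockCapacity hS hX h0 h1).add_const (Real.binEntropy ε)).congr fun n => ?_
  rw [blockCapacity_eq hX h0 h1]
  ring

/-- The noisy capacity, increased by the entropy of the noise, bounds the output entropy rate of all
stationary inputs in `S`. -/
theorem iInf_condEnt_le_noisyCapacity_add {S : Set (List Bool)} (hS : IsFactorial S)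
    {X : StationaryProcess} (hX : X.allowed ⊆ S) {ε : ℝ} (h0 : 0 ≤ ε) (h1 : ε ≤ 1) :
    ⨅ n, condEnt (noisy ε X.prob) n ≤ noisyCapacity S ε + Real.binEntropy ε := by
  refine le_of_tendsto_of_tendsto' (X.output ε h0 h1).tendsto_blockEntropy_div
    (tendsto_maxOutputEntropy_div hS hX h0 h1) fun n => ?_
  gcongr
  exact le_maxOutputEntropy h0 h1 (X.isInput hX _)

/-! ### A stationary process that bounds the capacity from above -/

theorem tendsto_noisy {ι : Type*} {l : Filter ι} {P : ι → List Bool → ℝ} {F : List Bool → ℝ}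
    (h : ∀ w, Tendsto (fun i => P i w) l (𝓝 (F w))) (ε : ℝ) (w : List Bool) :
    Tendsto (fun i => noisy ε (P i) w) l (𝓝 (noisy ε F w)) := by
  induction w generalizing P F with
  | nil => exact h []
  | cons v w ih =>
    exact ((ih fun x => h (v :: x)).const_mul _).add ((ih fun x => h ((!v) :: x)).const_mul _)

/-- The law seen from a uniformly chosen time among the first `N`. -/
def timeAverage (N : ℕ) (F : List Bool → ℝ) (w : List Bool) : ℝ :=
  (N : ℝ)⁻¹ * ∑ t ∈ Finset.range N, shiftBy t F w

theorem timeAverage_isWordMeasure {F : List Bool → ℝ} (hF : IsWordMeasure F) (N : ℕ) :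
    IsWordMeasure (timeAverage N F) :=
  (IsWordMeasure.sum fun t _ => hF.shiftBy t).const_mul (by positivity)

theorem timeAverage_nil {F : List Bool → ℝ} (hF : IsWordMeasure F) (h : F [] = 1) {N : ℕ}
    (hN : N ≠ 0) : timeAverage N F [] = 1 := by
  simp [timeAverage, shiftBy_nil hF h, hN]

theorem abs_timeAverage_cons_sub_le {F : List Bool → ℝ} (hF : IsWordMeasure F) (h : F [] = 1)
    (N : ℕ) (w : List Bool) :
    |timeAverage N F (false :: w) + timeAverage N F (true :: w) - timeAverage N F w| ≤
      (N : ℝ)⁻¹ := by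
  have e : timeAverage N F (false :: w) + timeAverage N F (true :: w) - timeAverage N F w =
      (N : ℝ)⁻¹ * (shiftBy N F w - shiftBy 0 F w) := by
    rw [← Finset.sum_range_sub (fun t => shiftBy t F w)]
    simp only [timeAverage, ← shiftBy_cons, Finset.sum_sub_distrib, Finset.sum_add_distrib]
    ring
  have b : ∀ t, 0 ≤ shiftBy t F w ∧ shiftBy t F w ≤ 1 := fun t =>
    ⟨(hF.shiftBy t).nonneg w, ((hF.shiftBy t).le_nil w).trans_eq (shiftBy_nil hF h t)⟩
  rw [e, abs_mul, abs_of_nonneg (by positivity : (0 : ℝ) ≤ (N : ℝ)⁻¹)]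
  refine mul_le_of_le_one_right (by positivity) (abs_le.2 ⟨?_, ?_⟩) <;>
    linarith [(b N).1, (b N).2, (b 0).1, (b 0).2]

theorem timeAverage_le_of_notMem {S : Set (List Bool)} (hS : IsFactorial S) {N : ℕ}
    {F : List Bool → ℝ} (hF : IsInput S N F) {w : List Bool} (hw : w ∉ S) :
    timeAverage N F w ≤ (N : ℝ)⁻¹ * w.length := by
  unfold timeAverage
  gcongr
  have b : ∀ t, shiftBy t F w ≤ 1 := fun t =>
    ((hF.isWordMeasure.shiftBy t).le_nil w).trans_eq (shiftBy_nil hF.isWordMeasure hF.nil t)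
  have z : ∀ t ∈ Finset.range N, shiftBy t F w ≤ if N < t + w.length then 1 else 0 := by
    intro t ht
    split_ifs with hc
    · exact b t
    · have ht' := Finset.mem_range.1 ht
      refine not_lt.1 fun hp => hw ?_
      have hF' : IsInput S (t + (N - t)) F := by rwa [Nat.add_sub_cancel' ht'.le]
      exact hF'.mem_of_shiftBy_pos hS (by omega) hp
  refine (Finset.sum_le_sum z).trans ?_
  rw [← Finset.sum_filter, Finset.sum_const, nsmul_eq_mul, mul_one]
  have hc : (Finset.filter (fun t => N < t + w.length) (Finset.range N)).card ≤ w.length := by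
    have hsub : Finset.filter (fun t => N < t + w.length) (Finset.range N) ⊆
        Finset.Ico (N - w.length) N := by
      intro t ht
      simp only [Finset.mem_filter, Finset.mem_range, Finset.mem_Ico] at ht ⊢
      omega
    refine (Finset.card_le_card hsub).trans ?_
    simp only [Nat.card_Ico]
    omega
  exact_mod_cast hc

/-- Predicting every symbol of a block but the first `n` with the conditional probabilities of `G`
costs, on average, the cross entropy of the time average of the block law. -/
theorem blockEntropy_le_crossEnt {F G : List Bool → ℝ} {ε : ℝ} (h0 : 0 ≤ ε) (h1 : ε ≤ 1)
    (hF : IsWordMeasure F) (hF1 : F [] = 1) (hG : IsWordMeasure G) (hpos : ∀ w, 0 < G w)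
    (n : ℕ) {N : ℕ} (hN : N ≠ 0) :
    blockEntropy (noisy ε F) N ≤
      n * Real.log 2 + N * crossEnt n (noisy ε (timeAverage N F)) G := by
  have hZ := hF.noisy h0 h1
  have hZ1 : noisy ε F [] = 1 := hF1
  have hsum : N * crossEnt n (noisy ε (timeAverage N F)) G =
      ∑ t ∈ Finset.range N, crossEnt n (shiftBy t (noisy ε F)) G := by
    have e : noisy ε (timeAverage N F) =
        fun w => (N : ℝ)⁻¹ * ∑ t ∈ Finset.range N, shiftBy t (noisy ε F) w := by
      funext w
      simp only [shiftBy_noisy]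
      rw [← noisy_sum, ← noisy_mul_left]
      rfl
    rw [e, crossEnt_const_mul, crossEnt_sum]
    field_simp
  calc blockEntropy (noisy ε F) N = ∑ j ∈ Finset.range N, condEnt (noisy ε F) j :=
        blockEntropy_eq_sum hZ hZ1 N
    _ ≤ ∑ j ∈ Finset.range (n + N), condEnt (noisy ε F) j := by
        refine Finset.sum_le_sum_of_subset_of_nonneg ?_ fun j _ _ => condEnt_nonneg hZ j
        exact Finset.range_mono (by omega)
    _ = ∑ j ∈ Finset.range n, condEnt (noisy ε F) j +
          ∑ t ∈ Finset.range N, condEnt (noisy ε F) (n + t) := Finset.sum_range_add _ _ _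
    _ ≤ ∑ j ∈ Finset.range n, Real.log 2 +
          ∑ t ∈ Finset.range N, crossEnt n (shiftBy t (noisy ε F)) G := by
        gcongr with j _ t
        · exact condEnt_le_log_two hZ hZ1 j
        · rw [add_comm n t]
          exact condEnt_add_le hZ hZ1.le hG fun y w v _ _ e => absurd e (hpos _).ne'
    _ = _ := by
        rw [hsum]
        simp

/-- There is a stationary input in `S` all of whose conditional output entropies are at least the
maximal output entropy rate: a limit of time averages of optimal block laws. -/
theorem exists_noisyCapacity_add_le {S : Set (List Bool)} (hS : IsFactorial S)
    {X : StationaryProcess} (hX : X.allowed ⊆ S) {ε : ℝ} (h0 : 0 < ε) (h1 : ε < 1) :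
    ∃ Y : StationaryProcess, Y.allowed ⊆ S ∧
      ∀ n, noisyCapacity S ε + Real.binEntropy ε ≤ condEnt (noisy ε Y.prob) n := by
  have hch : ∀ N : ℕ, ∃ F, IsInput S (N + 1) F ∧
      maxOutputEntropy S ε (N + 1) - 1 ≤ blockEntropy (noisy ε F) (N + 1) := by
    intro N
    obtain ⟨_, ⟨F, hF, rfl⟩, hlt⟩ := exists_lt_of_lt_csSup
      (s := outputEntropies S ε (N + 1)) (b := maxOutputEntropy S ε (N + 1) - 1)
      ⟨_, X.prob, X.isInput hX _, rfl⟩ (sub_one_lt _)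
    exact ⟨F, hF, hlt.le⟩
  choose F hF hFH using hch
  -- an ultrafilter limit of the time averages of nearly optimal block laws is stationary
  set P : ℕ → List Bool → ℝ := fun N => timeAverage (N + 1) (F N) with hP
  have hPm : ∀ N, IsWordMeasure (P N) := fun N => timeAverage_isWordMeasure (hF N).isWordMeasure _
  have hP1 : ∀ N, P N [] = 1 := fun N =>
    timeAverage_nil (hF N).isWordMeasure (hF N).nil N.succ_ne_zero
  have hK : IsCompact (Set.univ.pi fun _ : List Bool => Set.Icc (0 : ℝ) 1) :=
    isCompact_univ_pi fun _ => isCompact_Icc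
  obtain ⟨x, -, hx⟩ := hK.ultrafilter_le_nhds ((hyperfilter ℕ).map P) (by
    rw [le_principal_iff]
    refine Filter.mem_map.2 (Filter.univ_mem' fun N w _ => ?_)
    exact ⟨(hPm N).nonneg w, ((hPm N).le_nil w).trans_eq (hP1 N)⟩)
  have hlim : ∀ w, Tendsto (fun N => P N w) (hyperfilter ℕ) (𝓝 (x w)) :=
    fun w => (tendsto_pi_nhds.1 (show Tendsto P (hyperfilter ℕ) (𝓝 x) from hx)) w
  have hU : (hyperfilter ℕ : Filter ℕ) ≤ atTop := Nat.hyperfilter_le_atTop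
  have hinv : Tendsto (fun N : ℕ => ((N + 1 : ℕ) : ℝ)⁻¹) (hyperfilter ℕ) (𝓝 0) :=
    ((tendsto_inv_atTop_zero.comp tendsto_natCast_atTop_atTop).comp
      (tendsto_add_atTop_nat 1)).mono_left hU
  let Y : StationaryProcess :=
    { prob := x
      nonneg := fun w => ge_of_tendsto' (hlim w) fun N => (hPm N).nonneg w
      prob_nil := tendsto_nhds_unique (hlim []) (by simp only [hP1]; exact tendsto_const_nhds)
      sum_append := fun w => tendsto_nhds_unique ((hlim _).add (hlim _)) (by
        simpa only [(hPm _).snoc] using hlim w)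
      sum_cons := fun w => by
        have h := (((hlim (false :: w)).add (hlim (true :: w))).sub (hlim w))
        have h' := squeeze_zero_norm
          (f := fun N => P N (false :: w) + P N (true :: w) - P N w)
          (fun N => by
            rw [Real.norm_eq_abs]
            exact abs_timeAverage_cons_sub_le (hF N).isWordMeasure (hF N).nil (N + 1) w) hinv
        have := tendsto_nhds_unique h h'
        linarith }
  refine ⟨Y, fun w hw => ?_, fun n => ?_⟩
  · by_contra hc
    have h := hinv.mul_const (w.length : ℝ)
    rw [zero_mul] at h
    have : x w ≤ 0 := le_of_tendsto_of_tendsto' (hlim w) h fun N =>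
      timeAverage_le_of_notMem hS (hF N) hc
    exact absurd hw (not_lt.2 this)
  · have hG : IsWordMeasure (noisy ε x) := Y.isWordMeasure.noisy h0.le h1.le
    have hpos : ∀ w, 0 < noisy ε x w := fun w => by
      obtain ⟨u, hu, hp⟩ := Y.isWordMeasure.exists_append_pos (w := [])
        (by rw [Y.prob_nil]; exact one_pos) w.length
      exact noisy_pos h0 h1 Y.nonneg ⟨u, hu, by simpa using hp⟩
    have hc : Tendsto (fun N => crossEnt n (noisy ε (P N)) (noisy ε x)) (hyperfilter ℕ)
        (𝓝 (crossEnt n (noisy ε x) (noisy ε x))) := by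
      refine Tendsto.neg (tendsto_finsetSum _ fun w _ => tendsto_finsetSum _ fun v _ => ?_)
      exact (tendsto_noisy hlim ε _).mul_const _
    have hmax := (tendsto_maxOutputEntropy_div hS hX h0.le h1.le).mono_left hU
    have hr := ((hinv.const_mul (n * Real.log 2 + 1)).add hc)
    rw [mul_zero, zero_add] at hr
    refine le_of_tendsto_of_tendsto' hmax hr fun N => ?_
    have hb := blockEntropy_le_crossEnt h0.le h1.le (hF N).isWordMeasure (hF N).nil hG hpos n
      N.succ_ne_zero
    have hb' := (hFH N).trans hb
    have hN : (0 : ℝ) < (N : ℝ) + 1 := by positivity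
    simp only [Nat.succ_eq_add_one] at hb'
    push_cast at hb' ⊢
    rw [div_le_iff₀ hN]
    have e : ((n * Real.log 2 + 1) * ((N : ℝ) + 1)⁻¹ +
        crossEnt n (noisy ε (P N)) (noisy ε x)) * ((N : ℝ) + 1) =
        n * Real.log 2 + 1 + ((N : ℝ) + 1) * crossEnt n (noisy ε (P N)) (noisy ε x) := by
      field_simp
    rw [e]
    linarith

/-! ### Words of finite type constraints -/

/-- The constraint has memory `m`: words of the constraint that overlap in `m` symbols can be
glued. -/
def HasMemory (S : Set (List Bool)) (m : ℕ) : Prop :=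
  ∀ a s b : List Bool, s.length = m → a ++ s ∈ S → s ++ b ∈ S → a ++ (s ++ b) ∈ S

/-- A subword `f` of `w` can be enlarged to a subword of any length between theirs. -/
theorem exists_infix_of_length {f w : List Bool} {k : ℕ} (h : f <:+: w) (hf : f.length ≤ k)
    (hk : k ≤ w.length) : ∃ u, u.length = k ∧ f <:+: u ∧ u <:+: w := by
  obtain ⟨p, q, rfl⟩ := h
  by_cases hc : k ≤ (f ++ q).length
  · refine ⟨(f ++ q).take k, by simpa using hc, ?_, ?_⟩
    · refine (List.prefix_of_prefix_length_le (List.prefix_append f q) (List.take_prefix k _)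
        ?_).isInfix
      rw [List.length_take]
      omega
    · refine (List.take_prefix k _).isInfix.trans ?_
      rw [List.append_assoc]
      exact (List.suffix_append _ _).isInfix
  · have hl : ((p ++ f ++ q).drop ((p ++ f ++ q).length - k)).length = k := by
      rw [List.length_drop]
      omega
    refine ⟨_, hl, ?_, (List.drop_suffix _ _).isInfix⟩
    have hs : f ++ q <:+ p ++ f ++ q := by
      rw [List.append_assoc]
      exact List.suffix_append _ _
    exact (List.prefix_append f q).isInfix.trans
      (List.suffix_of_suffix_length_le hs (List.drop_suffix _ _) (by rw [hl]; omega)).isInfix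

theorem infix_append_cases {u a s b : List Bool} (h : u <:+: a ++ (s ++ b))
    (hu : u.length ≤ s.length + 1) : u <:+: a ++ s ∨ u <:+: s ++ b := by
  obtain ⟨p, q, e⟩ := h
  by_cases hc : (p ++ u).length ≤ (a ++ s).length
  · left
    have h1 : p ++ u <+: a ++ (s ++ b) := ⟨q, e⟩
    have h2 : a ++ s <+: a ++ (s ++ b) := ⟨b, by simp⟩
    exact (List.suffix_append p u).isInfix.trans (List.prefix_of_prefix_length_le h1 h2 hc).isInfix
  · right
    have h1 : u ++ q <:+ a ++ (s ++ b) := ⟨p, by simpa using e⟩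
    have h2 : s ++ b <:+ a ++ (s ++ b) := ⟨a, rfl⟩
    have hl := congrArg List.length e
    simp only [List.length_append] at hl hc
    exact (List.prefix_append u q).isInfix.trans
      (List.suffix_of_suffix_length_le h1 h2 (by simp only [List.length_append]; omega)).isInfix

open Classical in
/-- The infimum that defines the topological order is attained: all forbidden words can be extended
to forbidden words of the same length. -/
theorem IsFiniteType.topologicalOrder_spec {S : Set (List Bool)} (hS : IsFiniteType S) :
    ∃ F : Finset (List Bool), (∀ u ∈ F, u.length = topologicalOrder S + 1) ∧
      ∀ w : List Bool, topologicalOrder S + 1 ≤ w.length → (w ∈ S ↔ ∀ u ∈ F, ¬ u <:+: w) := by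
  have hfac := hS.isFactorial
  obtain ⟨F, hF⟩ := hS
  have hne : {m | ∃ F : Finset (List Bool), (∀ u ∈ F, u.length = m + 1) ∧
      ∀ w : List Bool, m + 1 ≤ w.length → (w ∈ S ↔ ∀ u ∈ F, ¬ u <:+: w)}.Nonempty := by
    refine ⟨F.sup List.length, (words (F.sup List.length + 1)).filter (· ∉ S), ?_, ?_⟩
    · intro u hu
      exact mem_words.1 (Finset.mem_filter.1 hu).1
    · intro w hw
      constructor
      · intro hwS u hu huw
        exact (Finset.mem_filter.1 hu).2 (hfac u w huw hwS)
      · intro h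
        by_contra hwS
        rw [hF] at hwS
        simp only [Set.mem_ofPred_eq, not_forall, not_not] at hwS
        obtain ⟨f, hfF, hfw⟩ := hwS
        have hfl : f.length ≤ F.sup List.length := Finset.le_sup (f := List.length) hfF
        obtain ⟨u, hul, hfu, huw⟩ := exists_infix_of_length hfw (hfl.trans (Nat.le_succ _)) hw
        refine h u (Finset.mem_filter.2 ⟨mem_words.2 hul, ?_⟩) huw
        rw [hF]
        exact fun hc => hc f hfF hfu
  exact Nat.sInf_mem hne

theorem IsFiniteType.hasMemory {S : Set (List Bool)} (hS : IsFiniteType S) :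
    HasMemory S (topologicalOrder S) := by
  obtain ⟨F, hFl, hF⟩ := hS.topologicalOrder_spec
  intro a s b hs ha hb
  rcases a with _ | ⟨x, a⟩
  · exact hb
  rcases b with _ | ⟨y, b⟩
  · simpa using ha
  rw [hF _ (by simp; omega)] at ha hb ⊢
  intro u hu hc
  rcases infix_append_cases hc (by rw [hFl u hu, hs]) with h | h
  · exact ha u hu h
  · exact hb u hu h

theorem exists_cons_mem {S : Set (List Bool)} (hfac : IsFactorial S)
    (hirr : IsIrreducibleConstraint S) (hne : ∃ w ∈ S, w ≠ []) {w : List Bool} (hw : w ∈ S) :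
    ∃ b, b :: w ∈ S := by
  obtain ⟨z, hz, hz0⟩ := hne
  obtain ⟨x, -, hx⟩ := hirr z hz w hw
  have h0 : z ++ x ≠ [] := by simp [hz0]
  refine ⟨(z ++ x).getLast h0, hfac _ _ ?_ hx⟩
  conv_rhs => rw [← List.dropLast_append_getLast h0]
  simp only [List.append_assoc, List.singleton_append]
  exact (List.suffix_append _ _).isInfix

theorem exists_snoc_mem {S : Set (List Bool)} (hfac : IsFactorial S)
    (hirr : IsIrreducibleConstraint S) (hne : ∃ w ∈ S, w ≠ []) {w : List Bool} (hw : w ∈ S) :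
    ∃ b, w ++ [b] ∈ S := by
  obtain ⟨z, hz, hz0⟩ := hne
  obtain ⟨x, -, hx⟩ := hirr w hw z hz
  rw [List.append_assoc] at hx
  have h0 : x ++ z ≠ [] := by simp [hz0]
  obtain ⟨b, l, hbl⟩ := List.exists_cons_of_ne_nil h0
  refine ⟨b, hfac _ _ ?_ hx⟩
  rw [hbl]
  exact ⟨[], l, by simp⟩

theorem exists_append_mem {S : Set (List Bool)} (hfac : IsFactorial S)
    (hirr : IsIrreducibleConstraint S) (hne : ∃ w ∈ S, w ≠ []) {w : List Bool} (hw : w ∈ S)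
    (n : ℕ) : ∃ s, s.length = n ∧ s ++ w ∈ S := by
  induction n with
  | zero => exact ⟨[], rfl, hw⟩
  | succ n ih =>
    obtain ⟨s, hs, hsw⟩ := ih
    obtain ⟨b, hb⟩ := exists_cons_mem hfac hirr hne hsw
    exact ⟨b :: s, by simp [hs], hb⟩

/-! ### The Perron–Frobenius theorem -/

open Matrix in
/-- A nonnegative matrix whose graph is strongly connected has a positive eigenvector. The
eigenvalue is the largest `t` with `t x ≤ A x` for some probability vector `x`. -/
theorem exists_pos_eigenvector {V : Type} [Fintype V] [DecidableEq V] [Nonempty V]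
    (A : Matrix V V ℝ) (hA : ∀ i j, 0 ≤ A i j)
    (hconn : ∀ i j, Relation.ReflTransGen (fun a b => 0 < A a b) i j) :
    ∃ t : ℝ, 0 ≤ t ∧ ∃ x : V → ℝ, (∀ i, 0 < x i) ∧ A *ᵥ x = t • x := by
  have hpow0 : ∀ k i j, 0 ≤ (A ^ k) i j := by
    intro k
    induction k with
    | zero =>
      intro i j
      rw [pow_zero, Matrix.one_apply]
      split_ifs <;> norm_num
    | succ k ih =>
      intro i j
      rw [pow_succ, Matrix.mul_apply]
      exact Finset.sum_nonneg fun l _ => mul_nonneg (ih i l) (hA l j)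
  have hpow : ∀ i j, ∃ k, 0 < (A ^ k) i j := by
    intro i j
    induction hconn i j with
    | refl => exact ⟨0, by simp⟩
    | @tail l j _ hlj ih =>
      obtain ⟨k, hk⟩ := ih
      refine ⟨k + 1, ?_⟩
      rw [pow_succ, Matrix.mul_apply]
      exact Finset.sum_pos' (fun l _ => mul_nonneg (hpow0 k i l) (hA l j))
        ⟨l, Finset.mem_univ l, mul_pos hk hlj⟩
  choose k hk using hpow
  -- an upper bound for the lengths of connecting paths, so that `B` below is positive
  set K := (∑ i, ∑ j, k i j) + 1 with hK
  set B : Matrix V V ℝ := ∑ n ∈ Finset.range K, A ^ n with hB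
  have hBpos : ∀ i j, 0 < B i j := by
    intro i j
    rw [hB, Matrix.sum_apply]
    refine Finset.sum_pos' (fun n _ => hpow0 n i j) ⟨k i j, ?_, hk i j⟩
    rw [Finset.mem_range, hK, Nat.lt_succ_iff]
    exact (Finset.single_le_sum (f := fun j => k i j) (fun _ _ => Nat.zero_le _)
      (Finset.mem_univ j)).trans (Finset.single_le_sum (f := fun i => ∑ j, k i j)
      (fun _ _ => Nat.zero_le _) (Finset.mem_univ i))
  have hcomm : A * B = B * A := by
    rw [hB, Finset.mul_sum, Finset.sum_mul]
    exact Finset.sum_congr rfl fun n _ => by rw [← pow_succ, ← pow_succ']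
  have hBvec : ∀ y : V → ℝ, (∀ i, 0 ≤ y i) → y ≠ 0 → ∀ i, 0 < (B *ᵥ y) i := by
    intro y hy hy0 i
    obtain ⟨j, hj⟩ := Function.ne_iff.1 hy0
    exact Finset.sum_pos' (fun l _ => mul_nonneg (hBpos i l).le (hy l))
      ⟨j, Finset.mem_univ j, mul_pos (hBpos i j) (lt_of_le_of_ne (hy j) (Ne.symm hj))⟩
  -- the set `T` of pairs `(t, x)` with `t x ≤ A x` is compact, since `t ≤ M` on it
  set M := ∑ i, ∑ j, A i j
  have hM : ∀ (t : ℝ) (x : V → ℝ), x ∈ stdSimplex ℝ V → (∀ i, t * x i ≤ (A *ᵥ x) i) → t ≤ M := by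
    intro t x hx h
    have h1 : ∑ i, t * x i ≤ ∑ i, (A *ᵥ x) i := Finset.sum_le_sum fun i _ => h i
    rw [← Finset.mul_sum, hx.2, mul_one] at h1
    refine h1.trans (Finset.sum_le_sum fun i _ => Finset.sum_le_sum fun j _ => ?_)
    refine mul_le_of_le_one_right (hA i j) ?_
    rw [← hx.2]
    exact Finset.single_le_sum (fun i _ => hx.1 i) (Finset.mem_univ j)
  set T : Set (ℝ × (V → ℝ)) :=
    (Set.Icc 0 M ×ˢ stdSimplex ℝ V) ∩ {q | ∀ i, q.1 * q.2 i ≤ (A *ᵥ q.2) i}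
  have hTc : IsCompact T := by
    refine (isCompact_Icc.prod (isCompact_stdSimplex ℝ V)).inter_right ?_
    simp only [Set.ofPred_forall]
    refine isClosed_iInter fun i => isClosed_le (by fun_prop) ?_
    simp only [Matrix.mulVec, dotProduct]
    fun_prop
  have hTn : T.Nonempty := by
    obtain ⟨x, hx⟩ : (stdSimplex ℝ V).Nonempty :=
      ⟨Pi.single (Classical.arbitrary V) 1, single_mem_stdSimplex ℝ _⟩
    have h0 : ∀ i, 0 * x i ≤ (A *ᵥ x) i := fun i => by
      rw [zero_mul]
      exact Finset.sum_nonneg fun j _ => mul_nonneg (hA i j) (hx.1 j)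
    exact ⟨(0, x), ⟨⟨le_rfl, hM 0 x hx h0⟩, hx⟩, h0⟩
  obtain ⟨⟨t, x⟩, ⟨⟨⟨ht0, -⟩, hx⟩, htx⟩, hmax⟩ :=
    hTc.exists_isMaxOn hTn (f := Prod.fst) continuous_fst.continuousOn
  dsimp only at ht0 hx htx
  have hx0 : x ≠ 0 := by
    rintro rfl
    simpa using hx.2
  have heig : A *ᵥ x = t • x := by
    by_contra hne
    -- `B *ᵥ x` then admits a value larger than `t`, against the choice of `t`
    set y := A *ᵥ x - t • x with hy
    have hyp := hBvec y (fun i => sub_nonneg.2 (htx i)) (sub_ne_zero.2 hne)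
    have hz := hBvec x hx.1 hx0
    set z := B *ᵥ x with hzdef
    have hAz : A *ᵥ z = t • z + B *ᵥ y := by
      rw [hy, Matrix.mulVec_sub, Matrix.mulVec_smul, hzdef, Matrix.mulVec_mulVec, hcomm,
        Matrix.mulVec_mulVec]
      abel
    obtain ⟨i₀, -, hi₀⟩ := Finset.exists_min_image Finset.univ (fun i => (B *ᵥ y) i / z i)
      Finset.univ_nonempty
    set d := (B *ᵥ y) i₀ / z i₀
    have hd : 0 < d := div_pos (hyp i₀) (hz i₀)
    have hzs : 0 < ∑ i, z i := Finset.sum_pos (fun i _ => hz i) Finset.univ_nonempty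
    set c := (∑ i, z i)⁻¹
    have hc : 0 < c := inv_pos.2 hzs
    have hmem : c • z ∈ stdSimplex ℝ V :=
      ⟨fun i => mul_nonneg hc.le (hz i).le, by
        simp only [Pi.smul_apply, smul_eq_mul, ← Finset.mul_sum]
        exact inv_mul_cancel₀ hzs.ne'⟩
    have hineq : ∀ i, (t + d) * (c • z) i ≤ (A *ᵥ (c • z)) i := by
      intro i
      rw [Matrix.mulVec_smul, hAz]
      simp only [Pi.smul_apply, Pi.add_apply, smul_eq_mul]
      have : d * z i ≤ (B *ᵥ y) i := (le_div_iff₀ (hz i)).1 (hi₀ i (Finset.mem_univ i))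
      nlinarith
    have h2 := hmax (a := (t + d, c • z)) ⟨⟨⟨by positivity, hM _ _ hmem hineq⟩, hmem⟩, hineq⟩
    simp only [Set.mem_ofPred_eq] at h2
    linarith
  refine ⟨t, ht0, x, fun i => ?_, heig⟩
  have hAn : ∀ n, A ^ n *ᵥ x = t ^ n • x := by
    intro n
    induction n with
    | zero => simp
    | succ n ih => rw [pow_succ, ← Matrix.mulVec_mulVec, heig, Matrix.mulVec_smul, ih, smul_smul,
        pow_succ, mul_comm]
  have hBx : B *ᵥ x = (∑ n ∈ Finset.range K, t ^ n) • x := by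
    rw [hB, Matrix.sum_mulVec, Finset.sum_smul]
    exact Finset.sum_congr rfl fun n _ => hAn n
  have h1 := hBvec x hx.1 hx0 i
  rw [hBx, Pi.smul_apply, smul_eq_mul] at h1
  exact pos_of_mul_pos_right h1 (Finset.sum_nonneg fun n _ => pow_nonneg ht0 n)

open Classical Matrix in
/-- The Perron eigenvectors of the graph whose vertices are the words of length `m` in `S` and whose
edges are the words of length `m + 1` in `S`. -/
theorem exists_perron_weights {S : Set (List Bool)} {m : ℕ} (hfac : IsFactorial S)
    (hirr : IsIrreducibleConstraint S) (hne : ∃ w ∈ S, w ≠ []) :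
    ∃ (t : ℝ) (L R : List Bool → ℝ), 0 < t ∧
      (∀ s ∈ S, s.length = m → 0 < L s ∧ 0 < R s) ∧
      (∀ s ∈ S, s.length = m →
        ∑ v : Bool, (if s ++ [v] ∈ S then R ((s ++ [v]).drop 1) else 0) = t * R s) ∧
      (∀ s ∈ S, s.length = m →
        ∑ b : Bool, (if b :: s ∈ S then L ((b :: s).take m) else 0) = t * L s) ∧
      ∑ s ∈ words m, (if s ∈ S then L s * R s else 0) = 1 := by
  set V := {w : List Bool // w ∈ (words m).filter (· ∈ S)}
  have hVS : ∀ i : V, i.1 ∈ S ∧ i.1.length = m := fun i => by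
    have := Finset.mem_filter.1 i.2
    exact ⟨this.2, mem_words.1 this.1⟩
  have hV : ∀ s ∈ S, s.length = m → s ∈ (words m).filter (· ∈ S) := fun s hs hl =>
    Finset.mem_filter.2 ⟨mem_words.2 hl, hs⟩
  have hnil : [] ∈ S := by
    obtain ⟨w, hw, -⟩ := hne
    exact hfac [] w (List.nil_infix) hw
  obtain ⟨s₀, hs₀, hs₀S⟩ := exists_append_mem hfac hirr hne hnil m
  rw [List.append_nil] at hs₀S
  have : Nonempty V := ⟨⟨s₀, hV s₀ hs₀S hs₀⟩⟩
  set A : Matrix V V ℝ := fun i j =>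
    ∑ u ∈ words (m + 1), if u ∈ S ∧ u.take m = i.1 ∧ u.drop 1 = j.1 then 1 else 0
  have hAe : ∀ i j, A i j =
      ∑ u ∈ words (m + 1), if u ∈ S ∧ u.take m = i.1 ∧ u.drop 1 = j.1 then 1 else 0 :=
    fun _ _ => rfl
  have hA : ∀ i j, 0 ≤ A i j := fun i j => Finset.sum_nonneg fun u _ => by positivity
  -- a word of `S` that begins with `i` and ends with `j` is a path from `i` to `j`
  have hpath : ∀ (n : ℕ) (y : List Bool) (i j : V), y.length = n + m → y ∈ S → y.take m = i.1 →
      y.drop n = j.1 → Relation.ReflTransGen (fun a b => 0 < A a b) i j := by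
    intro n
    induction n with
    | zero =>
      intro y i j hl hy hi hj
      have : i = j := by
        apply Subtype.ext
        rw [← hi, ← hj, List.drop_zero, List.take_of_length_le (by omega)]
      exact this ▸ Relation.ReflTransGen.refl
    | succ n ih =>
      intro y i j hl hy hi hj
      have hu : (y.take (m + 1)) ∈ S := hfac _ _ (List.take_prefix _ _).isInfix hy
      have hdS : (y.drop 1) ∈ S := hfac _ _ (List.drop_suffix _ _).isInfix hy
      have hkS : (y.drop 1).take m ∈ S := hfac _ _ (List.take_prefix _ _).isInfix hdS
      let l : V := ⟨(y.drop 1).take m, hV _ hkS (by simp; omega)⟩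
      refine Relation.ReflTransGen.head (b := l) ?_
        (ih (y.drop 1) l j (by simp; omega) hdS rfl (by rw [List.drop_drop, add_comm, hj]))
      refine Finset.sum_pos' (fun u _ => by positivity)
        ⟨y.take (m + 1), mem_words.2 (by simp; omega), ?_⟩
      have e1 : (y.take (m + 1)).take m = i.1 := by
        rw [List.take_take, min_eq_left (Nat.le_succ m), hi]
      have e2 : (y.take (m + 1)).drop 1 = l.1 := by simp [l, List.drop_take]
      rw [if_pos ⟨hu, e1, e2⟩]
      exact one_pos
  have hconn : ∀ i j, Relation.ReflTransGen (fun a b => 0 < A a b) i j := by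
    intro i j
    obtain ⟨x, -, hx⟩ := hirr i.1 (hVS i).1 j.1 (hVS j).1
    refine hpath (i.1 ++ x).length _ i j ?_ hx ?_ ?_
    · simp only [List.length_append, (hVS j).2]
    · rw [List.append_assoc]
      exact List.take_left' (hVS i).2
    · exact List.drop_left' rfl
  obtain ⟨t, ht0, r, hr, hAr⟩ := exists_pos_eigenvector A hA hconn
  obtain ⟨t', -, l, hl, hAl⟩ := exists_pos_eigenvector Aᵀ (fun i j => hA j i) fun i j =>
    Relation.reflTransGen_swap.2 (hconn j i)
  have hlr : 0 < l ⬝ᵥ r := Finset.sum_pos (fun i _ => mul_pos (hl i) (hr i)) Finset.univ_nonempty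
  have htt : t' = t := by
    have h1 : l ⬝ᵥ (A *ᵥ r) = (Aᵀ *ᵥ l) ⬝ᵥ r := by
      rw [Matrix.dotProduct_mulVec, Matrix.mulVec_transpose]
    rw [hAr, hAl, dotProduct_smul, smul_dotProduct, smul_eq_mul, smul_eq_mul] at h1
    exact (mul_right_cancel₀ hlr.ne' h1).symm
  subst htt
  have hR' : ∀ i : V, ∑ u ∈ words (m + 1), (if u ∈ S ∧ u.take m = i.1 then
      (if h : u.drop 1 ∈ (words m).filter (· ∈ S) then r ⟨u.drop 1, h⟩ else 0) else 0) =
      t' * r i := by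
    intro i
    have h1 := congrFun hAr i
    simp only [Matrix.mulVec, dotProduct, hAe, Finset.sum_mul, Pi.smul_apply, smul_eq_mul] at h1
    rw [← h1, Finset.sum_comm]
    refine Finset.sum_congr rfl fun u hu => ?_
    by_cases hc : u ∈ S ∧ u.take m = i.1
    · have hd : u.drop 1 ∈ (words m).filter (· ∈ S) :=
        hV _ (hfac _ _ (List.drop_suffix _ _).isInfix hc.1) (by simp [mem_words.1 hu])
      rw [if_pos hc, dif_pos hd, Finset.sum_eq_single ⟨u.drop 1, hd⟩]
      · simp [hc]
      · intro j _ hj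
        rw [if_neg, zero_mul]
        rintro ⟨-, -, e⟩
        exact hj (Subtype.ext e.symm)
      · simp
    · rw [if_neg hc]
      refine (Finset.sum_eq_zero fun j _ => ?_).symm
      rw [if_neg, zero_mul]
      exact fun e => hc ⟨e.1, e.2.1⟩
  have hL' : ∀ j : V, ∑ u ∈ words (m + 1), (if u ∈ S ∧ u.drop 1 = j.1 then
      (if h : u.take m ∈ (words m).filter (· ∈ S) then l ⟨u.take m, h⟩ else 0) else 0) =
      t' * l j := by
    intro j
    have h1 := congrFun hAl j
    simp only [Matrix.mulVec, dotProduct, Matrix.transpose_apply, hAe, Finset.sum_mul,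
      Pi.smul_apply, smul_eq_mul] at h1
    rw [← h1, Finset.sum_comm]
    refine Finset.sum_congr rfl fun u hu => ?_
    by_cases hc : u ∈ S ∧ u.drop 1 = j.1
    · have hd : u.take m ∈ (words m).filter (· ∈ S) :=
        hV _ (hfac _ _ (List.take_prefix _ _).isInfix hc.1) (by simp [mem_words.1 hu])
      rw [if_pos hc, dif_pos hd, Finset.sum_eq_single ⟨u.take m, hd⟩]
      · simp [hc]
      · intro j _ hj
        rw [if_neg, zero_mul]
        rintro ⟨-, e, -⟩
        exact hj (Subtype.ext e.symm)
      · simp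
    · rw [if_neg hc]
      refine (Finset.sum_eq_zero fun j _ => ?_).symm
      rw [if_neg, zero_mul]
      exact fun e => hc ⟨e.1, e.2.2⟩
  set R : List Bool → ℝ := fun w =>
    if h : w ∈ (words m).filter (· ∈ S) then r ⟨w, h⟩ else 0 with hRdef
  set L : List Bool → ℝ := fun w =>
    if h : w ∈ (words m).filter (· ∈ S) then l ⟨w, h⟩ / (l ⬝ᵥ r) else 0 with hLdef
  have hRe : ∀ s (hs : s ∈ S) (hsm : s.length = m), R s = r ⟨s, hV s hs hsm⟩ := fun s hs hsm =>
    dif_pos (hV s hs hsm)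
  have hLe : ∀ s (hs : s ∈ S) (hsm : s.length = m), L s = l ⟨s, hV s hs hsm⟩ / (l ⬝ᵥ r) :=
    fun s hs hsm => dif_pos (hV s hs hsm)
  have hRs : ∀ s ∈ S, s.length = m →
      ∑ v : Bool, (if s ++ [v] ∈ S then R ((s ++ [v]).drop 1) else 0) = t' * R s := by
    intro s hs hsm
    rw [hRe s hs hsm, ← hR' ⟨s, hV s hs hsm⟩, sum_words_snoc,
      Finset.sum_eq_single_of_mem s (mem_words.2 hsm)]
    · refine Finset.sum_congr rfl fun v _ => ?_
      simp [hRdef, ← hsm]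
    · intro w hw hws
      refine Finset.sum_eq_zero fun v _ => if_neg ?_
      rw [List.take_left' (mem_words.1 hw)]
      exact fun e => hws e.2
  refine ⟨t', L, R, ?_, ?_, hRs, ?_, ?_⟩
  · obtain ⟨v, hv⟩ := exists_snoc_mem hfac hirr hne hs₀S
    have h1 := hRs s₀ hs₀S hs₀
    have hR0 : ∀ w, 0 ≤ R w := fun w => by
      simp only [hRdef]
      split_ifs
      · exact (hr _).le
      · exact le_rfl
    have h2 : 0 < ∑ v : Bool, (if s₀ ++ [v] ∈ S then R ((s₀ ++ [v]).drop 1) else 0) := by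
      refine Finset.sum_pos' (fun v _ => by split_ifs; exacts [hR0 _, le_rfl])
        ⟨v, Finset.mem_univ v, ?_⟩
      rw [if_pos hv, hRe _ (hfac _ _ (List.drop_suffix _ _).isInfix hv) (by simp [hs₀])]
      exact hr _
    rw [h1] at h2
    exact pos_of_mul_pos_left h2 (hR0 _)
  · intro s hs hsm
    rw [hRe s hs hsm, hLe s hs hsm]
    exact ⟨div_pos (hl _) hlr, hr _⟩
  · intro s hs hsm
    rw [hLe s hs hsm, mul_div_assoc', ← hL' ⟨s, hV s hs hsm⟩, sum_words_cons, Finset.sum_div]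
    refine Finset.sum_congr rfl fun b _ => ?_
    rw [Finset.sum_eq_single_of_mem s (mem_words.2 hsm)]
    · by_cases hb : b :: s ∈ S
      · have hm : (b :: s).take m ∈ (words m).filter (· ∈ S) :=
          hV _ (hfac _ _ (List.take_prefix _ _).isInfix hb) (by simp [hsm])
        rw [if_pos hb, if_pos ⟨hb, rfl⟩, dif_pos hm]
        exact dif_pos hm
      · rw [if_neg hb, if_neg fun e => hb e.1, zero_div]
    · intro w _ hws
      exact if_neg fun e => hws e.2
  · rw [← Finset.sum_filter, ← Finset.sum_coe_sort]
    have e : ∀ i : V, L i.1 * R i.1 = l i * r i / (l ⬝ᵥ r) := fun i => by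
      rw [hLe _ (hVS i).1 (hVS i).2, hRe _ (hVS i).1 (hVS i).2]
      ring
    rw [Finset.sum_congr rfl fun i _ => e i, ← Finset.sum_div]
    exact div_self hlr.ne'

/-! ### The Markov property -/

namespace StationaryProcess

variable (X : StationaryProcess)

theorem sum_prepend (k : ℕ) (w : List Bool) : ∑ a ∈ words k, X.prob (a ++ w) = X.prob w :=
  congrFun (X.shiftBy_prob k) w

theorem prepend_le (a w : List Bool) : X.prob (a ++ w) ≤ X.prob w := by
  rw [← X.sum_prepend a.length w]
  exact Finset.single_le_sum (f := fun a => X.prob (a ++ w)) (fun _ _ => X.nonneg _) (by simp)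

theorem prepend_eq_zero {w : List Bool} (h : X.prob w = 0) (a : List Bool) :
    X.prob (a ++ w) = 0 :=
  le_antisymm (h ▸ X.prepend_le a w) (X.nonneg _)

theorem append_eq_zero {w : List Bool} (h : X.prob w = 0) (b : List Bool) :
    X.prob (w ++ b) = 0 := X.isWordMeasure.append_eq_zero h b

variable {X} {m : ℕ}

/-- The past and the future are independent given a block of length at least `m`. -/
theorem IsMarkov.split (hX : X.IsMarkov m) {s : List Bool} (hs : m ≤ s.length) (a b : List Bool) :
    X.prob (a ++ (s ++ b)) * X.prob s = X.prob (a ++ s) * X.prob (s ++ b) := by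
  have step : ∀ (a w : List Bool) (v : Bool), m ≤ w.length →
      X.prob (a ++ (w ++ [v])) * X.prob w = X.prob (a ++ w) * X.prob (w ++ [v]) := by
    intro a w v hw
    obtain ⟨p, q, rfl, hq⟩ : ∃ p q, w = p ++ q ∧ q.length = m :=
      ⟨w.take (w.length - m), w.drop (w.length - m), by simp, by simp; omega⟩
    have h1 := hX (a ++ p) q v hq
    have h2 := hX p q v hq
    by_cases h0 : X.prob q = 0
    · have e1 : X.prob (p ++ q) = 0 := X.prepend_eq_zero h0 _
      have e2 : X.prob (a ++ (p ++ q)) = 0 := X.prepend_eq_zero e1 _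
      rw [e1, e2]
      ring
    · apply mul_right_cancel₀ h0
      simp only [List.append_assoc] at h1 h2 ⊢
      linear_combination X.prob (p ++ q) * h1 - X.prob (a ++ (p ++ q)) * h2
  induction b using List.reverseRecOn with
  | nil => simp [mul_comm]
  | append_singleton b v ih =>
    have h1 := step a (s ++ b) v (by simp; omega)
    by_cases h0 : X.prob (s ++ b) = 0
    · have e1 : X.prob (s ++ (b ++ [v])) = 0 := by
        rw [← List.append_assoc]
        exact X.append_eq_zero h0 _
      rw [e1, X.prepend_eq_zero e1 a]
      ring
    · apply mul_right_cancel₀ h0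
      simp only [List.append_assoc] at h1 ih ⊢
      linear_combination X.prob s * h1 + X.prob (s ++ (b ++ [v])) * ih

theorem IsMarkov.mono (hX : X.IsMarkov m) {n : ℕ} (h : m ≤ n) : X.IsMarkov n := by
  intro u w v hw
  have := hX.split (s := w) (by omega) u [v]
  simpa using this

theorem pos_iff (X : StationaryProcess) (w : List Bool) : 0 < X.prob w ↔ X.prob w ≠ 0 :=
  ⟨ne_of_gt, fun h => lt_of_le_of_ne (X.nonneg w) h.symm⟩

end StationaryProcess

/-! ### The measure of maximal entropy -/

/-- `X` is a Markov chain of order `m` with allowed words `S`, whose transition probabilities are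
`e⁻ᶜ r(wv) / r(w)`, where `log r = ρ` depends on the last `m` symbols only. This is the defining
property of the Parry measure; `c` is its entropy rate. -/
structure IsParryMeasure (S : Set (List Bool)) (m : ℕ) (X : StationaryProcess) (c : ℝ)
    (ρ : List Bool → ℝ) : Prop where
  allowed_eq : X.allowed = S
  isMarkov : X.IsMarkov m
  rho_cons : ∀ b w, m ≤ w.length → ρ (b :: w) = ρ w
  log_eq : ∀ w v, m ≤ w.length → w ++ [v] ∈ S →
    Real.log (X.prob (w ++ [v]) / X.prob w) = -c + ρ (w ++ [v]) - ρ w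

open Classical in
/-- With left and right Perron eigenvectors `L`, `R` and eigenvalue `t`, the Parry measure gives `w`
the weight `t⁻ⁿ ∑ L s * R q`, `n = |w|`, summed over the words `s` of length `m` with `s ++ w ∈ S`,
where `q` consists of the last `m` symbols of `s ++ w`. -/
theorem exists_isParryMeasure {S : Set (List Bool)} {m : ℕ} (hfac : IsFactorial S)
    (hirr : IsIrreducibleConstraint S) (hne : ∃ w ∈ S, w ≠ []) (hmem : HasMemory S m) :
    ∃ X c ρ, IsParryMeasure S m X c ρ := by
  obtain ⟨t, L, R, ht, hpos, hR, hL, hLR⟩ := exists_perron_weights (m := m) hfac hirr hne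
  have hdropS : ∀ w ∈ S, ∀ k, w.drop k ∈ S := fun w hw k =>
    hfac _ _ (List.drop_suffix k w).isInfix hw
  have hglue : ∀ a s b : List Bool, s.length = m →
      (a ++ (s ++ b) ∈ S ↔ a ++ s ∈ S ∧ s ++ b ∈ S) := by
    intro a s b hs
    refine ⟨fun h => ⟨hfac _ _ ?_ h, hfac _ _ (List.suffix_append _ _).isInfix h⟩,
      fun h => hmem a s b hs h.1 h.2⟩
    rw [← List.append_assoc]
    exact (List.prefix_append _ _).isInfix
  set P : List Bool → ℝ := fun w => ∑ s ∈ words m,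
    (if s ++ w ∈ S then L s * R ((s ++ w).drop w.length) else 0) * t⁻¹ ^ w.length with hP
  have hRdrop : ∀ s w : List Bool, s.length = m → s ++ w ∈ S →
      0 < R ((s ++ w).drop w.length) := fun s w hs hsw =>
    (hpos _ (hdropS _ hsw _) (by simp [hs])).2
  have hLs : ∀ s w : List Bool, s.length = m → s ++ w ∈ S → 0 < L s := fun s w hs hsw =>
    (hpos _ (hfac _ _ (List.prefix_append s w).isInfix hsw) hs).1
  have hPnn : ∀ w, 0 ≤ P w := fun w => Finset.sum_nonneg fun s hs => by
    refine mul_nonneg ?_ (by positivity)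
    split_ifs with h
    · exact (mul_pos (hLs s w (mem_words.1 hs) h) (hRdrop s w (mem_words.1 hs) h)).le
    · exact le_rfl
  -- The last `m` symbols of a word `s ++ w` with `|s| = m`, split off.
  have hsplit : ∀ s w : List Bool, s.length = m → ∃ p q, s ++ w = p ++ q ∧ q.length = m ∧
      q = (s ++ w).drop w.length ∧ p.length = w.length := fun s w hs =>
    ⟨(s ++ w).take w.length, (s ++ w).drop w.length, by rw [List.take_append_drop],
      by simp [hs], rfl, by simp [hs]⟩
  have hsnoc : ∀ w, P (w ++ [false]) + P (w ++ [true]) = P w := by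
    intro w
    simp only [hP, ← Finset.sum_add_distrib]
    refine Finset.sum_congr rfl fun s hs => ?_
    have hs := mem_words.1 hs
    obtain ⟨p, q, hpq, hq, hqd, hpl⟩ := hsplit s w hs
    by_cases hsw : s ++ w ∈ S
    · have hqS : q ∈ S := hqd ▸ hdropS _ hsw _
      have h1 := hR q hqS hq
      have hv : ∀ v : Bool, (if s ++ (w ++ [v]) ∈ S then
          L s * R ((s ++ (w ++ [v])).drop (w ++ [v]).length) else 0) =
          L s * (if q ++ [v] ∈ S then R ((q ++ [v]).drop 1) else 0) := by
        intro v
        have e : s ++ (w ++ [v]) = p ++ (q ++ [v]) := by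
          rw [← List.append_assoc, hpq, List.append_assoc]
        have e2 : (p ++ (q ++ [v])).drop (w ++ [v]).length = (q ++ [v]).drop 1 := by
          rw [List.length_append, ← hpl, ← List.drop_drop, List.drop_left]
          rfl
        rw [e, e2]
        have : p ++ (q ++ [v]) ∈ S ↔ q ++ [v] ∈ S := by
          rw [hglue p q [v] hq, ← hpq]
          exact and_iff_right hsw
        simp only [this]
        split_ifs <;> simp
      rw [hv, hv, if_pos hsw, ← hqd]
      rw [Fintype.sum_bool] at h1
      simp only [List.length_append, List.length_singleton, pow_succ]
      have : ∀ x y : ℝ, y + x = t * R q → L s * x * (t⁻¹ ^ w.length * t⁻¹) +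
          L s * y * (t⁻¹ ^ w.length * t⁻¹) = L s * R q * t⁻¹ ^ w.length := by
        intro x y hxy
        have : L s * x * (t⁻¹ ^ w.length * t⁻¹) + L s * y * (t⁻¹ ^ w.length * t⁻¹) =
          L s * (y + x) * (t⁻¹ ^ w.length * t⁻¹) := by ring
        rw [this, hxy]
        field_simp
      exact this _ _ h1
    · have : ∀ v : Bool, s ++ (w ++ [v]) ∉ S := fun v h => hsw <| by
        rw [← List.append_assoc] at h
        exact hfac _ _ (List.prefix_append _ _).isInfix h
      rw [if_neg (this _), if_neg (this _), if_neg hsw]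
      ring
  have hcons : ∀ w, P (false :: w) + P (true :: w) = P w := by
    intro w
    have h1 : P (false :: w) + P (true :: w) = ∑ u ∈ words (m + 1), (if u ++ w ∈ S then
        L (u.take m) * R ((u ++ w).drop (w.length + 1)) else 0) * t⁻¹ ^ (w.length + 1) := by
      rw [sum_words_snoc, hP]
      simp only [← Finset.sum_add_distrib]
      refine Finset.sum_congr rfl fun s hs => ?_
      have hs := mem_words.1 hs
      simp only [Fintype.sum_bool, List.take_left' hs, List.append_assoc, List.singleton_append,
        List.length_cons]
      exact add_comm _ _
    rw [h1, sum_words_cons, Finset.sum_comm]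
    refine Finset.sum_congr rfl fun s hs => ?_
    have hs := mem_words.1 hs
    by_cases hsw : s ++ w ∈ S
    · have hsS : s ∈ S := hfac _ _ (List.prefix_append _ _).isInfix hsw
      have hb : ∀ b : Bool, (if b :: s ++ w ∈ S then
          L ((b :: s).take m) * R ((b :: s ++ w).drop (w.length + 1)) else 0) =
          (if b :: s ∈ S then L ((b :: s).take m) else 0) * R ((s ++ w).drop w.length) := by
        intro b
        have : b :: (s ++ w) ∈ S ↔ b :: s ∈ S := by
          have := hglue [b] s w hs
          simpa only [List.singleton_append, hsw, and_true] using this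
        simp only [List.cons_append, this, List.drop_succ_cons]
        split_ifs <;> simp
      simp only [hb, ← Finset.sum_mul]
      rw [hL s hsS hs, if_pos hsw, pow_succ]
      field_simp
    · rw [if_neg hsw, zero_mul]
      refine Finset.sum_eq_zero fun b _ => ?_
      rw [if_neg, zero_mul]
      exact fun h => hsw (hfac _ _ (List.suffix_cons b _).isInfix h)
  have hnil : P [] = 1 := by
    rw [← hLR, hP]
    refine Finset.sum_congr rfl fun s _ => ?_
    simp
  let X : StationaryProcess := ⟨P, hPnn, hnil, hsnoc, hcons⟩
  have hallowed : ∀ w, 0 < P w ↔ w ∈ S := by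
    intro w
    constructor
    · intro h
      by_contra hw
      refine h.ne' (Finset.sum_eq_zero fun s _ => ?_)
      rw [if_neg, zero_mul]
      exact fun hs => hw (hfac _ _ (List.suffix_append _ _).isInfix hs)
    · intro hw
      obtain ⟨s, hs, hsw⟩ := exists_append_mem hfac hirr hne hw m
      refine Finset.sum_pos' (fun s hs => ?_) ⟨s, mem_words.2 hs, ?_⟩
      · refine mul_nonneg ?_ (by positivity)
        split_ifs with h
        · exact (mul_pos (hLs s w (mem_words.1 hs) h) (hRdrop s w (mem_words.1 hs) h)).le
        · exact le_rfl
      · rw [if_pos hsw]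
        exact mul_pos (mul_pos (hLs s w hs hsw) (hRdrop s w hs hsw)) (by positivity)
  -- the transition probabilities `R (last m symbols of w ++ [v]) / (t * R w)`
  have hstep : ∀ (u w : List Bool) (v : Bool), w.length = m →
      P (u ++ (w ++ [v])) * (t * R w) =
        P (u ++ w) * (if w ++ [v] ∈ S then R ((w ++ [v]).drop 1) else 0) := by
    intro u w v hw
    simp only [hP, Finset.sum_mul]
    refine Finset.sum_congr rfl fun s hs => ?_
    have hs := mem_words.1 hs
    have e1 : (s ++ (u ++ (w ++ [v]))).drop (u ++ (w ++ [v])).length = (w ++ [v]).drop 1 := by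
      have : (u ++ (w ++ [v])).length = (s ++ u).length + 1 := by
        simp only [List.length_append, List.length_singleton]
        omega
      rw [this, ← List.append_assoc, ← List.drop_drop, List.drop_left]
    have e2 : (s ++ (u ++ w)).drop (u ++ w).length = w := by
      have : (u ++ w).length = (s ++ u).length := by
        simp only [List.length_append]
        omega
      rw [this, ← List.append_assoc, List.drop_left]
    have hiff : s ++ (u ++ (w ++ [v])) ∈ S ↔ s ++ (u ++ w) ∈ S ∧ w ++ [v] ∈ S := by
      have := hglue (s ++ u) w [v] hw
      simpa only [List.append_assoc] using this
    rw [e1, e2]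
    simp only [hiff, ite_and]
    have hlen : (u ++ (w ++ [v])).length = (u ++ w).length + 1 := by simp; omega
    rw [hlen, pow_succ]
    split_ifs
    · field_simp
    all_goals simp
  refine ⟨X, Real.log t, fun w => Real.log (R (w.drop (w.length - m))), Set.ext hallowed, ?_, ?_,
    ?_⟩
  · intro u w v hw
    change P (u ++ w ++ [v]) * P w = P (u ++ w) * P (w ++ [v])
    rw [List.append_assoc]
    by_cases hwS : w ∈ S
    · have h1 := hstep u w v hw
      have h2 := hstep [] w v hw
      simp only [List.nil_append] at h2
      have h0 : t * R w ≠ 0 := (mul_pos ht (hpos w hwS hw).2).ne'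
      apply mul_right_cancel₀ h0
      linear_combination P w * h1 - P (u ++ w) * h2
    · have h0 : P w = 0 := le_antisymm (not_lt.1 fun h => hwS ((hallowed w).1 h)) (hPnn w)
      have h1 : P (u ++ w) = 0 := X.prepend_eq_zero h0 u
      rw [h0, h1]
      ring
  · intro b w hw
    have : (b :: w).length - m = (w.length - m) + 1 := by simp; omega
    simp only [this, List.drop_succ_cons]
  · intro w v hw hwv
    obtain ⟨p, q, rfl, hq⟩ : ∃ p q, w = p ++ q ∧ q.length = m :=
      ⟨w.take (w.length - m), w.drop (w.length - m), by simp, by simp; omega⟩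
    change Real.log (P (p ++ q ++ [v]) / P (p ++ q)) = _
    have hwS : p ++ q ∈ S := hfac _ _ (List.prefix_append _ _).isInfix hwv
    have hqS : q ∈ S := hfac _ _ (List.suffix_append _ _).isInfix hwS
    rw [List.append_assoc] at hwv ⊢
    have hqv : q ++ [v] ∈ S := hfac _ _ (List.suffix_append _ _).isInfix hwv
    have h1 := hstep p q v hq
    rw [if_pos hqv] at h1
    have hRq := (hpos q hqS hq).2
    have hRv : 0 < R ((q ++ [v]).drop 1) := (hpos _ (hdropS _ hqv 1) (by simp [hq])).2
    have hP0 := (hallowed _).2 hwS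
    have e1 : (p ++ (q ++ [v])).drop ((p ++ (q ++ [v])).length - m) = (q ++ [v]).drop 1 := by
      have : (p ++ (q ++ [v])).length - m = p.length + 1 := by
        simp only [List.length_append, List.length_singleton]
        omega
      rw [this, ← List.drop_drop, List.drop_left]
    have e2 : (p ++ q).drop ((p ++ q).length - m) = q := by
      have : (p ++ q).length - m = p.length := by
        simp only [List.length_append]
        omega
      rw [this, List.drop_left]
    rw [e1, e2]
    have e3 : P (p ++ (q ++ [v])) / P (p ++ q) = R ((q ++ [v]).drop 1) / (t * R q) := by
      rw [div_eq_div_iff hP0.ne' (mul_pos ht hRq).ne', h1]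
      ring
    rw [e3, Real.log_div hRv.ne' (mul_pos ht hRq).ne', Real.log_mul ht.ne' hRq.ne']
    ring

/-! ### Predicting with the measure of maximal entropy -/

namespace IsParryMeasure

variable {S : Set (List Bool)} {m : ℕ} {X : StationaryProcess} {c : ℝ} {ρ : List Bool → ℝ}

theorem pos_iff_mem (h : IsParryMeasure S m X c ρ) {w : List Bool} : 0 < X.prob w ↔ w ∈ S := by
  rw [← h.allowed_eq]
  rfl

theorem eq_zero (h : IsParryMeasure S m X c ρ) {w : List Bool} (hw : w ∉ S) : X.prob w = 0 :=
  le_antisymm (not_lt.1 fun hp => hw (h.pos_iff_mem.1 hp)) (X.nonneg w)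

/-- The logarithm of the transition probabilities is a constant plus a coboundary, so the cross
entropy telescopes along a sequence. -/
theorem crossEnt_eq (h : IsParryMeasure S m X c ρ) {n : ℕ} (hn : m ≤ n) {F : List Bool → ℝ}
    (hF : IsWordMeasure F)
    (hS : ∀ w v, w.length = n → F (w ++ [v]) ≠ 0 → w ++ [v] ∈ S) :
    crossEnt n F X.prob = c * F [] + ∑ w ∈ words n, F w * ρ w -
      ∑ w ∈ words n, shiftBy 1 F w * ρ w := by
  have e1 : ∀ w ∈ words n, ∑ v : Bool, F (w ++ [v]) * Real.log (X.prob (w ++ [v]) / X.prob w) =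
      -c * F w + ∑ v : Bool, F (w ++ [v]) * ρ (w ++ [v]) - F w * ρ w := by
    intro w hw
    have hw := mem_words.1 hw
    have : ∀ v : Bool, F (w ++ [v]) * Real.log (X.prob (w ++ [v]) / X.prob w) =
        F (w ++ [v]) * -c + F (w ++ [v]) * ρ (w ++ [v]) - F (w ++ [v]) * ρ w := by
      intro v
      by_cases hz : F (w ++ [v]) = 0
      · simp [hz]
      · rw [h.log_eq w v (by omega) (hS w v hw hz)]
        ring
    simp only [this, Finset.sum_sub_distrib, Finset.sum_add_distrib, ← Finset.sum_mul, hF.sum_bool]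
    ring
  have e2 : ∑ w ∈ words n, ∑ v : Bool, F (w ++ [v]) * ρ (w ++ [v]) =
      ∑ w ∈ words n, shiftBy 1 F w * ρ w := by
    rw [← sum_words_snoc n fun u => F u * ρ u, sum_words_cons, Finset.sum_comm]
    refine Finset.sum_congr rfl fun w hw => ?_
    have hw := mem_words.1 hw
    rw [← shiftBy_cons, shiftBy_zero, Fintype.sum_bool, h.rho_cons _ _ (by omega),
      h.rho_cons _ _ (by omega)]
    ring
  rw [crossEnt, Finset.sum_congr rfl e1, Finset.sum_sub_distrib, Finset.sum_add_distrib, e2,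
    ← Finset.mul_sum, hF.sum_words]
  ring

theorem crossEnt_eq_of_stationary (h : IsParryMeasure S m X c ρ) {n : ℕ} (hn : m ≤ n)
    {Y : StationaryProcess} (hY : Y.allowed ⊆ S) : crossEnt n Y.prob X.prob = c := by
  rw [h.crossEnt_eq hn Y.isWordMeasure fun w v _ hp => hY ((Y.pos_iff _).2 hp), Y.shiftBy_prob,
    Y.prob_nil]
  ring

theorem condEnt_eq (h : IsParryMeasure S m X c ρ) {n : ℕ} (hn : m ≤ n) :
    condEnt X.prob n = c :=
  h.crossEnt_eq_of_stationary hn h.allowed_eq.le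

theorem iInf_condEnt_eq (h : IsParryMeasure S m X c ρ) : ⨅ n, condEnt X.prob n = c :=
  le_antisymm ((X.iInf_condEnt_le m).trans_eq (h.condEnt_eq le_rfl))
    (X.le_iInf_condEnt (N := m) fun k => (h.condEnt_eq (Nat.le_add_left m k)).ge)

/-- The noiseless capacity is the entropy rate of the Parry measure. For the upper bound, every block
law in `S` is predicted with the Parry measure; the coboundary contributes only a bounded amount. -/
theorem noisyCapacity_zero (h : IsParryMeasure S m X c ρ) (hfac : IsFactorial S) :
    noisyCapacity S 0 = c := by
  have hX : X.allowed ⊆ S := h.allowed_eq.le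
  have hc : 0 ≤ c := by
    rw [← h.condEnt_eq le_rfl]
    exact condEnt_nonneg X.isWordMeasure m
  have hz : ∀ F : List Bool → ℝ, noisy 0 F = F := fun F => funext fun w => noisy_zero F w
  apply le_antisymm
  · set B := ∑ w ∈ words m, |ρ w|
    have hB : ∀ F, IsWordMeasure F → F [] = 1 → |∑ w ∈ words m, F w * ρ w| ≤ B := by
      intro F hF hF1
      refine (Finset.abs_sum_le_sum_abs _ _).trans (Finset.sum_le_sum fun w _ => ?_)
      rw [abs_mul, abs_of_nonneg (hF.nonneg w)]
      exact mul_le_of_le_one_left (abs_nonneg _) (hF1 ▸ hF.le_nil w)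
    have hent : ∀ N F, IsInput S N F → blockEntropy F N ≤ m * Real.log 2 + N * c + 2 * B := by
      intro N F hF
      have hW := hF.isWordMeasure
      have hsh : ∀ t, IsWordMeasure (shiftBy t F) ∧ shiftBy t F [] = 1 := fun t =>
        ⟨hW.shiftBy t, shiftBy_nil hW hF.nil t⟩
      set a : ℕ → ℝ := fun t => ∑ w ∈ words m, shiftBy t F w * ρ w
      have hstep : ∀ t ∈ Finset.range (N - m), condEnt F (m + t) ≤ c + (a t - a (t + 1)) := by
        intro t ht
        have ht := Finset.mem_range.1 ht
        have hF' : IsInput S (t + (N - t)) F := by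
          rwa [Nat.add_sub_cancel' (by omega : t ≤ N)]
        have hSt : ∀ w v, w.length = m → shiftBy t F (w ++ [v]) ≠ 0 → w ++ [v] ∈ S :=
          fun w v hw hp => hF'.mem_of_shiftBy_pos hfac (by simp; omega)
            (lt_of_le_of_ne ((hsh t).1.nonneg _) hp.symm)
        -- the symbols before the last `m` ones are forgotten by the predictor
        have h1 := condEnt_add_le (k := t) (n := m) hW hF.nil.le X.isWordMeasure
          (fun y w v hy hw hX0 => by
            by_contra hp
            have : shiftBy t F (w ++ [v]) ≠ 0 := fun e =>
              hp (append_eq_zero_of_shiftBy_eq_zero hW e hy)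
            exact (h.pos_iff_mem.2 (hSt w v hw this)).ne' hX0)
        rw [h.crossEnt_eq le_rfl (hsh t).1 hSt, (hsh t).2] at h1
        have h2 : ∑ w ∈ words m, shiftBy 1 (shiftBy t F) w * ρ w = a (t + 1) := by
          refine Finset.sum_congr rfl fun w _ => ?_
          rw [← shiftBy_cons, shiftBy_zero, shiftBy_cons]
        rw [h2] at h1
        rw [add_comm m t]
        linarith
      calc blockEntropy F N = ∑ j ∈ Finset.range N, condEnt F j :=
            blockEntropy_eq_sum hW hF.nil N
        _ ≤ ∑ j ∈ Finset.range (m + (N - m)), condEnt F j :=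
            Finset.sum_le_sum_of_subset_of_nonneg (Finset.range_mono (by omega))
              fun j _ _ => condEnt_nonneg hW j
        _ = ∑ j ∈ Finset.range m, condEnt F j +
            ∑ t ∈ Finset.range (N - m), condEnt F (m + t) := Finset.sum_range_add _ _ _
        _ ≤ ∑ j ∈ Finset.range m, Real.log 2 +
            ∑ t ∈ Finset.range (N - m), (c + (a t - a (t + 1))) :=
            add_le_add (Finset.sum_le_sum fun j _ => condEnt_le_log_two hW hF.nil j)
              (Finset.sum_le_sum hstep)
        _ = m * Real.log 2 + (N - m : ℕ) * c + (a 0 - a (N - m)) := by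
            rw [Finset.sum_add_distrib, Finset.sum_range_sub']
            simp
            ring
        _ ≤ m * Real.log 2 + N * c + 2 * B := by
            have h1 := abs_le.1 (hB _ (hsh 0).1 (hsh 0).2)
            have h2 := abs_le.1 (hB _ (hsh (N - m)).1 (hsh (N - m)).2)
            have h3 : ((N - m : ℕ) : ℝ) * c ≤ N * c := by
              gcongr
              omega
            linarith [h1.2, h2.1]
    have hmax : ∀ N, maxOutputEntropy S 0 N ≤ m * Real.log 2 + N * c + 2 * B := by
      intro N
      refine csSup_le ⟨_, X.prob, X.isInput hX _, rfl⟩ ?_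
      rintro _ ⟨F, hF, rfl⟩
      rw [hz]
      exact hent N F hF
    have hlim := tendsto_maxOutputEntropy_div hfac hX le_rfl zero_le_one
    rw [Real.binEntropy_zero, add_zero] at hlim
    have hinv : Tendsto (fun N : ℕ => ((N : ℝ) + 1)⁻¹) atTop (𝓝 0) := by
      simpa using tendsto_one_div_add_atTop_nhds_zero_nat (𝕜 := ℝ)
    have hr := (hinv.const_mul (m * Real.log 2 + 2 * B)).add_const c
    rw [mul_zero, zero_add] at hr
    refine le_of_tendsto_of_tendsto' hlim hr fun N => ?_
    have hN : (0 : ℝ) < (N : ℝ) + 1 := by positivity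
    rw [div_le_iff₀ hN]
    have := hmax (N + 1)
    push_cast at this
    have e : ((m * Real.log 2 + 2 * B) * ((N : ℝ) + 1)⁻¹ + c) * ((N : ℝ) + 1) =
        m * Real.log 2 + 2 * B + ((N : ℝ) + 1) * c := by
      field_simp
    rw [e]
    linarith
  · have := iInf_condEnt_le_noisyCapacity_add hfac hX le_rfl zero_le_one
    rwa [hz, h.iInf_condEnt_eq, Real.binEntropy_zero, add_zero] at this

/-! ### Quadratic loss of entropy away from the measure of maximal entropy -/

/-- A stationary signed block weight of total mass zero with the transition probabilities of `X`
vanishes. This is uniqueness of the stationary law, by the maximum principle for `φ / X`. -/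
theorem eq_zero_of_transition (h : IsParryMeasure S m X c ρ) (hfac : IsFactorial S)
    (hirr : IsIrreducibleConstraint S) {n : ℕ} {φ : List Bool → ℝ}
    (hsnoc : ∀ w, w.length = n → φ (w ++ [false]) + φ (w ++ [true]) = φ w)
    (hcons : ∀ w, w.length = n → φ (false :: w) + φ (true :: w) = φ w)
    (hsum : ∑ w ∈ words n, φ w = 0)
    (hsupp : ∀ u, u.length = n + 1 → u ∉ S → φ u = 0)
    (htrans : ∀ w v, w.length = n → w ++ [v] ∈ S →
      φ (w ++ [v]) = φ w * (X.prob (w ++ [v]) / X.prob w))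
    {u : List Bool} (hu : u.length = n + 1) : φ u = 0 := by
  classical
  have hsupp' : ∀ w, w.length = n → w ∉ S → φ w = 0 := by
    intro w hw hwS
    have hv : ∀ v, φ (w ++ [v]) = 0 := fun v => hsupp _ (by simp [hw]) fun hc =>
      hwS (hfac _ _ (List.prefix_append _ _).isInfix hc)
    rw [← hsnoc w hw, hv, hv, add_zero]
  have hzero : ∀ w, w.length = n → φ w = 0 := by
    obtain ⟨w₁, hw₁, hp₁⟩ := X.isWordMeasure.exists_append_pos (w := [])
      (by rw [X.prob_nil]; exact one_pos) n
    have hne : ((words n).filter (· ∈ S)).Nonempty :=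
      ⟨w₁, Finset.mem_filter.2 ⟨mem_words.2 hw₁, h.pos_iff_mem.1 hp₁⟩⟩
    obtain ⟨w₀, hw₀, hmax⟩ := Finset.exists_max_image _ (fun w => φ w / X.prob w) hne
    set M := φ w₀ / X.prob w₀
    have hw₀n := mem_words.1 (Finset.mem_filter.1 hw₀).1
    have hle : ∀ w, w.length = n → w ∈ S → φ w / X.prob w ≤ M := fun w hw hwS =>
      hmax w (Finset.mem_filter.2 ⟨mem_words.2 hw, hwS⟩)
    -- `φ / X` at `w` is an average of its values at the predecessors of `w`, so a maximum at `w`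
    -- propagates to all of them, and along paths to all words of `S`
    have hstep : ∀ b w, w.length = n → b :: w ∈ S → φ w / X.prob w = M →
        φ ((b :: w).take n) / X.prob ((b :: w).take n) = M := by
      intro b w hw hbw hM
      have hwS : w ∈ S := hfac _ _ (List.suffix_cons b w).isInfix hbw
      have key : ∀ b' : Bool, φ (b' :: w) ≤ M * X.prob (b' :: w) ∧
          (φ (b' :: w) = M * X.prob (b' :: w) → b' :: w ∈ S →
            φ ((b' :: w).take n) / X.prob ((b' :: w).take n) = M) := by
        intro b'
        by_cases hb : b' :: w ∈ S
        · obtain ⟨p, v, hpv⟩ : ∃ p v, b' :: w = p ++ [v] :=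
            ⟨_, _, (List.dropLast_append_getLast (List.cons_ne_nil b' w)).symm⟩
          have hpl : p.length = n := by
            have := congrArg List.length hpv
            simp only [List.length_cons, List.length_append, List.length_nil] at this
            omega
          have htk : (b' :: w).take n = p := by rw [hpv, List.take_left' hpl]
          rw [htk]
          rw [hpv] at hb ⊢
          have hpS : p ∈ S := hfac _ _ (List.prefix_append _ _).isInfix hb
          have hXp := h.pos_iff_mem.2 hpS
          have hXv := h.pos_iff_mem.2 hb
          have e : φ (p ++ [v]) = φ p / X.prob p * X.prob (p ++ [v]) := by
            rw [htrans p v hpl hb]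
            ring
          rw [e]
          refine ⟨mul_le_mul_of_nonneg_right (hle p hpl hpS) hXv.le, fun e' _ => ?_⟩
          exact mul_right_cancel₀ hXv.ne' e'
        · rw [hsupp _ (by simp [hw]) hb, h.eq_zero hb]
          exact ⟨by simp, fun _ hc => absurd hc hb⟩
      have hXw := h.pos_iff_mem.2 hwS
      have hφw : φ w = M * X.prob w := by
        rw [← hM]
        field_simp
      have h1 := hcons w hw
      have h2 := X.sum_cons w
      rw [hφw, ← h2] at h1
      have kf := key false
      have kt := key true
      cases b
      · exact kf.2 (by linarith [kf.1, kt.1]) hbw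
      · exact kt.2 (by linarith [kf.1, kt.1]) hbw
    have hpath : ∀ y w, w.length = n → y ++ w ∈ S → φ w / X.prob w = M →
        φ ((y ++ w).take n) / X.prob ((y ++ w).take n) = M := by
      intro y
      induction y with
      | nil =>
        intro w hw _ hM
        rwa [List.nil_append, List.take_of_length_le hw.le]
      | cons b y ih =>
        intro w hw hyw hM
        have hyS : y ++ w ∈ S := hfac _ _ (List.suffix_cons b _).isInfix hyw
        have h1 := ih w hw hyS hM
        have hlt : ((y ++ w).take n).length = n := by simp; omega
        have h2 := hstep b _ hlt (hfac _ (b :: y ++ w) ?_ hyw) h1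
        · have e : (b :: (y ++ w).take n).take n = (b :: y ++ w).take n := by
            cases n with
            | zero => simp
            | succ n => simp [List.take_take]
          rwa [e] at h2
        · simpa using ((List.take_prefix (n + 1) (b :: (y ++ w))).isInfix)
    have hM : ∀ w, w.length = n → φ w = M * X.prob w := by
      intro w hw
      by_cases hwS : w ∈ S
      · obtain ⟨x, -, hx⟩ := hirr w hwS w₀ (Finset.mem_filter.1 hw₀).2
        have h1 := hpath (w ++ x) w₀ hw₀n hx rfl
        rw [List.append_assoc, List.take_left' hw] at h1
        have := (h.pos_iff_mem.2 hwS).ne'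
        rw [← h1]
        field_simp
      · rw [hsupp' w hw hwS, h.eq_zero hwS, mul_zero]
    have hM0 : M = 0 := by
      rw [Finset.sum_congr rfl fun w hw => hM w (mem_words.1 hw), ← Finset.mul_sum,
        X.isWordMeasure.sum_words, X.prob_nil, mul_one] at hsum
      exact hsum
    intro w hw
    rw [hM w hw, hM0, zero_mul]
  by_cases huS : u ∈ S
  · obtain ⟨p, v, rfl⟩ : ∃ p v, u = p ++ [v] := by
      have : u ≠ [] := by
        rintro rfl
        simp at hu
      exact ⟨_, _, (List.dropLast_append_getLast this).symm⟩
    have hp : p.length = n := by simpa using hu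
    rw [htrans p v hp huS, hzero p hp, zero_mul]
  · exact hsupp u hu huS

end IsParryMeasure

/-- The distance of the block laws of length `n` of two processes. -/
def blockDist (n : ℕ) (Y X : StationaryProcess) : ℝ :=
  ∑ u ∈ words n, |Y.prob u - X.prob u|

theorem blockDist_nonneg (n : ℕ) (Y X : StationaryProcess) : 0 ≤ blockDist n Y X :=
  Finset.sum_nonneg fun _ _ => abs_nonneg _

theorem abs_prob_sub_le_blockDist {n : ℕ} (Y X : StationaryProcess) {u : List Bool}
    (hu : u.length = n) : |Y.prob u - X.prob u| ≤ blockDist n Y X :=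
  Finset.single_le_sum (f := fun u => |Y.prob u - X.prob u|) (fun _ _ => abs_nonneg _)
    (mem_words.2 hu)

theorem blockDist_le_succ (n : ℕ) (Y X : StationaryProcess) :
    blockDist n Y X ≤ blockDist (n + 1) Y X := by
  rw [blockDist, blockDist, sum_words_snoc]
  refine Finset.sum_le_sum fun w _ => ?_
  rw [← Y.isWordMeasure.sum_bool w, ← X.isWordMeasure.sum_bool w, ← Finset.sum_sub_distrib]
  exact Finset.abs_sum_le_sum_abs _ _

open Classical in
/-- The total defect of `Y - X` with respect to the transition probabilities of `X`, on the
transitions that `S` allows. -/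
def transitionDefect (S : Set (List Bool)) (n : ℕ) (Y X : StationaryProcess) : ℝ :=
  ∑ w ∈ words n, ∑ v : Bool, if w ++ [v] ∈ S then
    |(Y.prob (w ++ [v]) - X.prob (w ++ [v])) -
      (Y.prob w - X.prob w) * (X.prob (w ++ [v]) / X.prob w)| else 0

namespace IsParryMeasure

variable {S : Set (List Bool)} {m : ℕ} {X : StationaryProcess} {c : ℝ} {ρ : List Bool → ℝ}

/-- By compactness, the transition defect controls the distance to `X`: otherwise normalized
differences `Y - X` would have a limit that contradicts `eq_zero_of_transition`. -/
theorem exists_mul_blockDist_le (h : IsParryMeasure S m X c ρ) (hfac : IsFactorial S)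
    (hirr : IsIrreducibleConstraint S) (n : ℕ) :
    ∃ κ : ℝ, 0 < κ ∧ ∀ Y : StationaryProcess, Y.allowed ⊆ S →
      κ * blockDist (n + 1) Y X ≤ transitionDefect S n Y X := by
  classical
  by_contra! hcon
  have hch : ∀ k : ℕ, ∃ Y : StationaryProcess, Y.allowed ⊆ S ∧
      transitionDefect S n Y X < ((k : ℝ) + 1)⁻¹ * blockDist (n + 1) Y X := fun k =>
    hcon _ (by positivity)
  choose Y hYS hY using hch
  have hdef0 : ∀ k, 0 ≤ transitionDefect S n (Y k) X := fun k =>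
    Finset.sum_nonneg fun w _ => Finset.sum_nonneg fun v _ => by positivity
  have hd : ∀ k, 0 < blockDist (n + 1) (Y k) X := fun k =>
    pos_of_mul_pos_right ((hdef0 k).trans_lt (hY k)) (by positivity)
  set P : ℕ → List Bool → ℝ := fun k u =>
    if u.length = n ∨ u.length = n + 1 then
      ((Y k).prob u - X.prob u) / blockDist (n + 1) (Y k) X else 0 with hP
  have hP1 : ∀ k u, P k u ∈ Set.Icc (-1 : ℝ) 1 := by
    intro k u
    rw [Set.mem_Icc, ← abs_le, hP]
    dsimp only
    split_ifs with hu
    · rw [abs_div, abs_of_pos (hd k)]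
      refine div_le_one_of_le₀ ?_ (hd k).le
      rcases hu with hu | hu
      · exact (abs_prob_sub_le_blockDist _ _ hu).trans (blockDist_le_succ n _ _)
      · exact abs_prob_sub_le_blockDist _ _ hu
    · simp
  have hPe : ∀ k u, u.length = n ∨ u.length = n + 1 →
      P k u = ((Y k).prob u - X.prob u) / blockDist (n + 1) (Y k) X := fun k u hu => if_pos hu
  have hK : IsCompact (Set.univ.pi fun _ : List Bool => Set.Icc (-1 : ℝ) 1) :=
    isCompact_univ_pi fun _ => isCompact_Icc
  obtain ⟨φ, -, hφ⟩ := hK.ultrafilter_le_nhds ((hyperfilter ℕ).map P) (by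
    rw [le_principal_iff]
    exact Filter.mem_map.2 (Filter.univ_mem' fun k u _ => hP1 k u))
  have hlim : ∀ w, Tendsto (fun k => P k w) (hyperfilter ℕ) (𝓝 (φ w)) :=
    fun w => (tendsto_pi_nhds.1 (show Tendsto P (hyperfilter ℕ) (𝓝 φ) from hφ)) w
  have hinv : Tendsto (fun k : ℕ => ((k : ℝ) + 1)⁻¹) (hyperfilter ℕ) (𝓝 0) := by
    have : Tendsto (fun k : ℕ => ((k : ℝ) + 1)⁻¹) atTop (𝓝 0) := by
      simpa using tendsto_one_div_add_atTop_nhds_zero_nat (𝕜 := ℝ)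
    exact this.mono_left Nat.hyperfilter_le_atTop
  have hone : ∑ u ∈ words (n + 1), |φ u| = 1 := by
    refine tendsto_nhds_unique (tendsto_finsetSum _ fun u _ => (hlim u).abs) ?_
    have : ∀ k, ∑ u ∈ words (n + 1), |P k u| = 1 := by
      intro k
      have e : ∀ u ∈ words (n + 1), |P k u| =
          |(Y k).prob u - X.prob u| / blockDist (n + 1) (Y k) X := fun u hu => by
        rw [hPe k u (Or.inr (mem_words.1 hu)), abs_div, abs_of_pos (hd k)]
      rw [Finset.sum_congr rfl e, ← Finset.sum_div]
      exact div_self (hd k).ne'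
    simp only [this]
    exact tendsto_const_nhds
  have hzero : ∀ u, u.length = n + 1 → φ u = 0 := by
    intro u hu
    refine h.eq_zero_of_transition hfac hirr (n := n) (φ := φ) ?_ ?_ ?_ ?_ ?_ hu
    · intro w hw
      refine tendsto_nhds_unique ((hlim _).add (hlim _)) ((hlim w).congr fun k => ?_)
      rw [hPe k _ (Or.inl hw), hPe k _ (Or.inr (by simp [hw])), hPe k _ (Or.inr (by simp [hw])),
        ← (Y k).sum_append w, ← X.sum_append w]
      ring
    · intro w hw
      refine tendsto_nhds_unique ((hlim _).add (hlim _)) ((hlim w).congr fun k => ?_)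
      rw [hPe k _ (Or.inl hw), hPe k _ (Or.inr (by simp [hw])), hPe k _ (Or.inr (by simp [hw])),
        ← (Y k).sum_cons w, ← X.sum_cons w]
      ring
    · refine tendsto_nhds_unique (tendsto_finsetSum _ fun w _ => hlim w)
        (tendsto_const_nhds.congr fun k => ?_)
      rw [Finset.sum_congr rfl fun w hw => hPe k w (Or.inl (mem_words.1 hw)), ← Finset.sum_div,
        Finset.sum_sub_distrib, (Y k).isWordMeasure.sum_words, X.isWordMeasure.sum_words,
        (Y k).prob_nil, X.prob_nil, sub_self, zero_div]
    · intro u hu huS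
      refine tendsto_nhds_unique (hlim u) (tendsto_const_nhds.congr fun k => ?_)
      rw [hPe k u (Or.inr hu), h.eq_zero huS,
        le_antisymm (not_lt.1 fun hp => huS (hYS k hp)) ((Y k).nonneg u), sub_zero, zero_div]
    · intro w v hw hwv
      have h1 := (hlim (w ++ [v])).sub
        ((hlim w).mul_const (X.prob (w ++ [v]) / X.prob w))
      have h2 := squeeze_zero_norm (f := fun k => P k (w ++ [v]) -
        P k w * (X.prob (w ++ [v]) / X.prob w)) (fun k => ?_) hinv
      · exact sub_eq_zero.1 (tendsto_nhds_unique h1 h2)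
      · rw [hPe k _ (Or.inl hw), hPe k _ (Or.inr (by simp [hw])), Real.norm_eq_abs]
        have e : ((Y k).prob (w ++ [v]) - X.prob (w ++ [v])) / blockDist (n + 1) (Y k) X -
            ((Y k).prob w - X.prob w) / blockDist (n + 1) (Y k) X *
              (X.prob (w ++ [v]) / X.prob w) =
            (((Y k).prob (w ++ [v]) - X.prob (w ++ [v])) - ((Y k).prob w - X.prob w) *
              (X.prob (w ++ [v]) / X.prob w)) / blockDist (n + 1) (Y k) X := by ring
        rw [e, abs_div, abs_of_pos (hd k), div_le_iff₀ (hd k)]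
        refine le_trans ?_ (hY k).le
        have hin := Finset.single_le_sum (f := fun v : Bool => if w ++ [v] ∈ S then
          |((Y k).prob (w ++ [v]) - X.prob (w ++ [v])) -
            ((Y k).prob w - X.prob w) * (X.prob (w ++ [v]) / X.prob w)| else 0)
          (fun v _ => by positivity) (Finset.mem_univ v)
        have hout := Finset.single_le_sum (f := fun w => ∑ v : Bool, if w ++ [v] ∈ S then
          |((Y k).prob (w ++ [v]) - X.prob (w ++ [v])) -
            ((Y k).prob w - X.prob w) * (X.prob (w ++ [v]) / X.prob w)| else 0)
          (fun w _ => Finset.sum_nonneg fun v _ => by positivity) (mem_words.2 hw)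
        refine le_trans ?_ (hin.trans hout)
        rw [if_pos hwv]
  rw [Finset.sum_eq_zero fun u hu => by rw [hzero u (mem_words.1 hu), abs_zero]] at hone
  exact zero_ne_one hone

end IsParryMeasure

theorem differentiable_noisy (F : List Bool → ℝ) (w : List Bool) :
    Differentiable ℝ fun ε => noisy ε F w := by
  induction w generalizing F with
  | nil => exact differentiable_const _
  | cons v w ih =>
    have h1 := ih fun x => F (v :: x)
    have h2 := ih fun x => F ((!v) :: x)
    simp only [noisy]
    fun_prop

theorem eventually_abs_sub_le_of_differentiableAt {f : ℝ → ℝ} (hf : DifferentiableAt ℝ f 0) :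
    ∃ C, 0 < C ∧ ∀ᶠ ε in 𝓝[≥] (0 : ℝ), |f ε - f 0| ≤ C * ε := by
  obtain ⟨C, hC, h⟩ := hf.isBigO_sub.exists_pos
  refine ⟨C, hC, ?_⟩
  filter_upwards [nhdsWithin_le_nhds h.bound, self_mem_nhdsWithin] with ε h1 h2
  rwa [sub_zero, Real.norm_eq_abs, Real.norm_eq_abs,
    abs_of_nonneg (show 0 ≤ ε from h2)] at h1

namespace IsParryMeasure

variable {S : Set (List Bool)} {m : ℕ} {X : StationaryProcess} {c : ℝ} {ρ : List Bool → ℝ}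

/-- The perturbed transition probabilities of the allowed transitions, and their logarithms, differ
from the unperturbed ones by `O(ε)`. -/
theorem exists_transition_bounds (h : IsParryMeasure S m X c ρ) (hfac : IsFactorial S) (n : ℕ) :
    ∃ C : ℝ, 0 < C ∧ ∀ᶠ ε in 𝓝[≥] (0 : ℝ), ∀ u ∈ words (n + 1), ∀ w v, u = w ++ [v] → u ∈ S →
      |noisy ε X.prob (w ++ [v]) / noisy ε X.prob w - X.prob (w ++ [v]) / X.prob w| ≤ C * ε ∧
      |Real.log (noisy ε X.prob (w ++ [v]) / noisy ε X.prob w) -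
        Real.log (X.prob (w ++ [v]) / X.prob w)| ≤ C * ε ∧
      |Real.log (noisy ε X.prob (w ++ [v]) / noisy ε X.prob w)| ≤ C := by
  have key : ∀ u : List Bool, ∃ C : ℝ, 0 < C ∧ ∀ᶠ ε in 𝓝[≥] (0 : ℝ), ∀ w v, u = w ++ [v] → u ∈ S →
      |noisy ε X.prob (w ++ [v]) / noisy ε X.prob w - X.prob (w ++ [v]) / X.prob w| ≤ C * ε ∧
      |Real.log (noisy ε X.prob (w ++ [v]) / noisy ε X.prob w) -
        Real.log (X.prob (w ++ [v]) / X.prob w)| ≤ C * ε ∧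
      |Real.log (noisy ε X.prob (w ++ [v]) / noisy ε X.prob w)| ≤ C := by
    intro u
    by_cases hu : ∃ w v, u = w ++ [v] ∧ u ∈ S
    · obtain ⟨w, v, rfl, hwv⟩ := hu
      have hXv := h.pos_iff_mem.2 hwv
      have hXw := h.pos_iff_mem.2 (hfac _ _ (List.prefix_append w [v]).isInfix hwv)
      have hq : DifferentiableAt ℝ
          (fun ε => noisy ε X.prob (w ++ [v]) / noisy ε X.prob w) 0 :=
        (differentiable_noisy _ _ _).div (differentiable_noisy _ _ _)
          (by rw [noisy_zero]; exact hXw.ne')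
      have hl : DifferentiableAt ℝ
          (fun ε => Real.log (noisy ε X.prob (w ++ [v]) / noisy ε X.prob w)) 0 :=
        hq.log (by rw [noisy_zero, noisy_zero]; exact (div_pos hXv hXw).ne')
      obtain ⟨C₁, hC₁, h₁⟩ := eventually_abs_sub_le_of_differentiableAt hq
      obtain ⟨C₂, hC₂, h₂⟩ := eventually_abs_sub_le_of_differentiableAt hl
      simp only [noisy_zero] at h₁ h₂
      set l₀ := Real.log (X.prob (w ++ [v]) / X.prob w)
      refine ⟨C₁ + C₂ + |l₀|, by positivity, ?_⟩
      have hsmall : ∀ᶠ ε in 𝓝[≥] (0 : ℝ), ε ≤ 1 :=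
        nhdsWithin_le_nhds (Iic_mem_nhds one_pos)
      filter_upwards [h₁, h₂, hsmall, self_mem_nhdsWithin] with ε e₁ e₂ e₃ e₀
      have e₀ : 0 ≤ ε := e₀
      intro w' v' hw' _
      obtain ⟨rfl, hv⟩ := List.append_inj' hw' rfl
      obtain rfl : v = v' := by simpa using hv
      have h0 := abs_nonneg l₀
      refine ⟨e₁.trans ?_, e₂.trans ?_, ?_⟩
      · gcongr
        linarith
      · gcongr
        linarith
      · have := abs_sub_abs_le_abs_sub
          (Real.log (noisy ε X.prob (w ++ [v]) / noisy ε X.prob w)) l₀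
        nlinarith
    · refine ⟨1, one_pos, Eventually.of_forall fun ε w v hw hS => absurd ⟨w, v, hw, hS⟩ hu⟩
  choose C hC hev using key
  refine ⟨∑ u ∈ words (n + 1), C u, ?_, ?_⟩
  · refine Finset.sum_pos (fun u _ => hC u) (Finset.card_pos.1 ?_)
    rw [card_words]
    positivity
  · have hall := (Filter.eventually_all_finset (words (n + 1))).2 fun u _ => hev u
    filter_upwards [hall, self_mem_nhdsWithin] with ε hε h0 u hu w v hw hS
    have h0 : 0 ≤ ε := h0
    have hle : C u ≤ ∑ u ∈ words (n + 1), C u :=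
      Finset.single_le_sum (fun u _ => (hC u).le) hu
    obtain ⟨a, b, d⟩ := hε u hu w v hw hS
    refine ⟨a.trans ?_, b.trans ?_, d.trans hle⟩ <;> gcongr

/-- Uniformly over the stationary inputs `Y` in `S`, the conditional output entropy loses a multiple
of the squared distance from `X`, and gains at most a multiple of `ε log (1 / ε)` times the
distance. At `ε = 0` there is no gain, because the cross entropy with respect to `X` is constant. -/
theorem exists_condEnt_le (h : IsParryMeasure S m X c ρ) (hfac : IsFactorial S)
    (hirr : IsIrreducibleConstraint S) {n : ℕ} (hn : m ≤ n) :
    ∃ K κ : ℝ, 0 < K ∧ 0 < κ ∧ ∀ᶠ ε in 𝓝[≥] (0 : ℝ), ∀ Y : StationaryProcess, Y.allowed ⊆ S →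
      condEnt (noisy ε Y.prob) n ≤ condEnt (noisy ε X.prob) n +
        K * (ε * Real.log (1 / ε)) * blockDist (n + 1) Y X - κ * blockDist (n + 1) Y X ^ 2 := by
  classical
  obtain ⟨C, hC, hCev⟩ := h.exists_transition_bounds hfac n
  obtain ⟨κ₀, hκ₀, hκ⟩ := h.exists_mul_blockDist_le hfac hirr n
  set N : ℝ := (2 : ℝ) ^ (n + 1) with hN
  have hN0 : 0 < N := by positivity
  set A : ℝ := 2 * (n + 1) + C with hA
  have hA0 : 0 < A := by positivity
  have hcard : ∑ w ∈ words n, ∑ _v : Bool, (1 : ℝ) = N := by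
    rw [← sum_words_snoc n fun _ => (1 : ℝ)]
    simp [card_words, hN]
  refine ⟨N * (C + (n + 1) * C + (n + 1)), κ₀ ^ 2 / (16 * N), by positivity, by positivity, ?_⟩
  have hs1 : ∀ᶠ ε in 𝓝[≥] (0 : ℝ), ε ≤ κ₀ / (2 * N * A) :=
    nhdsWithin_le_nhds (Iic_mem_nhds (by positivity))
  have hs2 : ∀ᶠ ε in 𝓝[≥] (0 : ℝ), ε ≤ Real.exp (-1) :=
    nhdsWithin_le_nhds (Iic_mem_nhds (Real.exp_pos _))
  have hs3 : ∀ᶠ ε in 𝓝[≥] (0 : ℝ), ε ≤ 1 / 2 :=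
    nhdsWithin_le_nhds (Iic_mem_nhds (by norm_num))
  filter_upwards [hCev, hs1, hs2, hs3, self_mem_nhdsWithin] with ε hε hε1 hε2 hε3 h0 Y hY
  have h0 : 0 ≤ ε := h0
  have h1 : ε ≤ 1 := by linarith
  set d := blockDist (n + 1) Y X with hd
  have hd0 : 0 ≤ d := blockDist_nonneg _ _ _
  set Z := noisy ε Y.prob with hZ
  set G := noisy ε X.prob with hG
  have hZm : IsWordMeasure Z := Y.isWordMeasure.noisy h0 h1
  have hGm : IsWordMeasure G := X.isWordMeasure.noisy h0 h1
  set δ : List Bool → ℝ := fun u => Y.prob u - X.prob u with hδ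
  have hZG : ∀ u, Z u - G u = noisy ε δ u := fun u => (noisy_sub ε _ _ u).symm
  have hδS : ∀ u, u ∉ S → δ u = 0 := fun u hu => by
    rw [hδ]
    dsimp only
    rw [h.eq_zero hu, le_antisymm (not_lt.1 fun hp => hu (hY hp)) (Y.nonneg u), sub_zero]
  have hδ1 : ∀ u, u.length = n + 1 → |δ u| ≤ d := fun u hu => abs_prob_sub_le_blockDist Y X hu
  have hδ0 : ∀ w, w.length = n → |δ w| ≤ d := fun w hw =>
    (abs_prob_sub_le_blockDist Y X hw).trans (blockDist_le_succ n Y X)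
  have hnδ1 : ∀ u, u.length = n + 1 → |noisy ε δ u - δ u| ≤ ε * ((n + 1) * d) := fun u hu => by
    have := abs_noisy_sub_le h0 h1 δ u
    rw [hu] at this
    exact_mod_cast this
  have hnδ0 : ∀ w, w.length = n → |noisy ε δ w - δ w| ≤ ε * ((n + 1) * d) := fun w hw => by
    refine (abs_noisy_sub_le h0 h1 δ w).trans ?_
    rw [hw]
    gcongr
    · linarith
    · exact blockDist_le_succ n Y X
  have hpos : ε ≠ 0 → ∀ u, 0 < G u := fun he u => by
    obtain ⟨x, hx, hp⟩ := X.isWordMeasure.exists_append_pos (w := [])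
      (by rw [X.prob_nil]; exact one_pos) u.length
    exact noisy_pos (lt_of_le_of_ne h0 he.symm) (by linarith) X.nonneg ⟨x, hx, by simpa using hp⟩
  have hac : ∀ w v, w.length = n → G (w ++ [v]) = 0 → Z (w ++ [v]) = 0 := by
    intro w v _ hg
    by_cases he : ε = 0
    · rw [hG, he, noisy_zero] at hg
      rw [hZ, he, noisy_zero]
      by_contra hy
      exact (h.pos_iff_mem.2 (hY ((Y.pos_iff _).2 hy))).ne' hg
    · exact absurd hg (hpos he _).ne'
  have hlog0 : 0 ≤ ε * Real.log (1 / ε) ∧ ε ≤ ε * Real.log (1 / ε) := by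
    rcases h0.eq_or_lt with he | he
    · rw [← he]
      simp
    · have : 1 ≤ Real.log (1 / ε) := by
        rw [Real.le_log_iff_exp_le (by positivity), le_div_iff₀ he]
        calc Real.exp 1 * ε ≤ Real.exp 1 * Real.exp (-1) := by gcongr
          _ = 1 := by rw [← Real.exp_add]; simp
      constructor <;> nlinarith
  set lε := ε * Real.log (1 / ε)
  -- The gain: a first-order perturbation of a constant functional.
  have hcross : crossEnt n Z G ≤ condEnt G n + N * (C + (n + 1) * C + (n + 1)) * lε * d := by
    have hc0 : ∑ w ∈ words n, ∑ v : Bool,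
        δ (w ++ [v]) * Real.log (X.prob (w ++ [v]) / X.prob w) = 0 := by
      have e1 := h.crossEnt_eq_of_stationary hn hY
      have e2 := h.condEnt_eq hn
      rw [crossEnt] at e1
      rw [condEnt] at e2
      simp only [hδ, sub_mul, Finset.sum_sub_distrib]
      linarith
    have hdiff : crossEnt n Z G - condEnt G n = ∑ w ∈ words n, ∑ v : Bool,
        (δ (w ++ [v]) * Real.log (X.prob (w ++ [v]) / X.prob w) -
          noisy ε δ (w ++ [v]) * Real.log (G (w ++ [v]) / G w)) := by
      simp only [Finset.sum_sub_distrib, hc0, crossEnt, condEnt, ← hZG, sub_mul]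
      ring
    have hterm : ∀ w ∈ words n, ∀ v : Bool,
        δ (w ++ [v]) * Real.log (X.prob (w ++ [v]) / X.prob w) -
          noisy ε δ (w ++ [v]) * Real.log (G (w ++ [v]) / G w) ≤
        1 * ((C + (n + 1) * C + (n + 1)) * lε * d) := by
      intro w hw v
      have hw := mem_words.1 hw
      have hwv : (w ++ [v]).length = n + 1 := by simp [hw]
      refine (le_abs_self _).trans ?_
      by_cases hS : w ++ [v] ∈ S
      · obtain ⟨-, b2, b3⟩ := hε _ (mem_words.2 hwv) w v rfl hS
        set l₀ := Real.log (X.prob (w ++ [v]) / X.prob w)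
        set l := Real.log (G (w ++ [v]) / G w)
        have e : δ (w ++ [v]) * l₀ - noisy ε δ (w ++ [v]) * l =
            -(δ (w ++ [v]) * (l - l₀)) - (noisy ε δ (w ++ [v]) - δ (w ++ [v])) * l := by ring
        rw [e]
        have t1 : |δ (w ++ [v]) * (l - l₀)| ≤ d * (C * ε) := by
          rw [abs_mul]
          exact mul_le_mul (hδ1 _ hwv) b2 (abs_nonneg _) hd0
        have t2 : |(noisy ε δ (w ++ [v]) - δ (w ++ [v])) * l| ≤ ε * ((n + 1) * d) * C := by
          rw [abs_mul]
          exact mul_le_mul (hnδ1 _ hwv) b3 (abs_nonneg _) (by positivity)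
        refine (abs_sub _ _).trans ?_
        rw [abs_neg]
        have t3 : (C + (n + 1) * C) * d * ε ≤ (C + (n + 1) * C) * d * lε := by
          have := hlog0.2
          gcongr
        have t4 : 0 ≤ (n + 1) * lε * d := by
          have := hlog0.1
          positivity
        linarith
      -- for forbidden words the logarithm is unbounded, but at most `log (1 / ε)`
      · rw [hδS _ hS, zero_mul, zero_sub, abs_neg, abs_mul]
        have t1 := hnδ1 _ hwv
        rw [hδS _ hS, sub_zero] at t1
        rcases h0.eq_or_lt with he | he
        · have : noisy ε δ (w ++ [v]) = 0 := by rw [← he, noisy_zero, hδS _ hS]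
          rw [this, abs_zero, zero_mul]
          have := hlog0.1
          positivity
        have hGw := hpos he.ne' w
        have hr1 : G (w ++ [v]) / G w ≤ 1 := div_le_one_of_le₀ (hGm.snoc_le w v) hGw.le
        have hr2 : ε ≤ G (w ++ [v]) / G w := by
          rw [le_div_iff₀ hGw]
          exact mul_noisy_le_noisy_snoc h0 hε3 X.nonneg (fun x _ => X.sum_append x) v
        have hl : |Real.log (G (w ++ [v]) / G w)| ≤ Real.log (1 / ε) := by
          rw [abs_of_nonpos (Real.log_nonpos (by linarith) hr1), one_div, Real.log_inv]
          exact neg_le_neg (Real.log_le_log he hr2)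
        have t2 := mul_le_mul t1 hl (abs_nonneg _) (by positivity)
        refine t2.trans ?_
        have e : ε * ((n + 1) * d) * Real.log (1 / ε) = (n + 1) * lε * d := by ring
        rw [e]
        have t4 : 0 ≤ (C + (n + 1) * C) * lε * d := by
          have := hlog0.1
          positivity
        linarith
    have hsum := Finset.sum_le_sum fun w hw =>
      Finset.sum_le_sum fun v (_ : v ∈ Finset.univ) => hterm w hw v
    simp only [← Finset.sum_mul] at hsum
    rw [hcard, ← hdiff] at hsum
    linarith
  -- The loss: the relative entropy is at least quadratic in the transition defect.
  have hkl : κ₀ ^ 2 / (16 * N) * d ^ 2 ≤ klCond n Z G := by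
    have hq := sum_sq_le_klCond hZm Y.prob_nil.le hGm hac
    set r : List Bool → Bool → ℝ := fun w v => Z (w ++ [v]) - Z w * (G (w ++ [v]) / G w) with hr
    have hterm : ∀ w ∈ words n, ∀ v : Bool, (if w ++ [v] ∈ S then
        |δ (w ++ [v]) - δ w * (X.prob (w ++ [v]) / X.prob w)| else 0) ≤
        |r w v| + 1 * (A * ε * d) := by
      intro w hw v
      have hw := mem_words.1 hw
      have hwv : (w ++ [v]).length = n + 1 := by simp [hw]
      split_ifs with hS
      · obtain ⟨b1, -, -⟩ := hε _ (mem_words.2 hwv) w v rfl hS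
        have hXw := h.pos_iff_mem.2 (hfac _ _ (List.prefix_append w [v]).isInfix hS)
        have hGw : G w ≠ 0 := by
          by_cases he : ε = 0
          · rw [hG, he, noisy_zero]
            exact hXw.ne'
          · exact (hpos he w).ne'
        set q₀ := X.prob (w ++ [v]) / X.prob w
        set q := G (w ++ [v]) / G w with hqd
        have hq0 : 0 ≤ q := div_nonneg (hGm.nonneg _) (hGm.nonneg _)
        have hq1 : q ≤ 1 := div_le_one_of_le₀ (hGm.snoc_le w v) (hGm.nonneg _)
        have hre : r w v = noisy ε δ (w ++ [v]) - noisy ε δ w * q := by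
          rw [← hZG, ← hZG, hr, hqd]
          field_simp
          ring
        have e : δ (w ++ [v]) - δ w * q₀ = r w v - (noisy ε δ (w ++ [v]) - δ (w ++ [v])) +
            (noisy ε δ w - δ w) * q + δ w * (q - q₀) := by
          rw [hre]
          ring
        rw [e]
        have t1 := hnδ1 _ hwv
        have t2 : |(noisy ε δ w - δ w) * q| ≤ ε * ((n + 1) * d) := by
          rw [abs_mul, abs_of_nonneg hq0]
          exact (mul_le_of_le_one_right (abs_nonneg _) hq1).trans (hnδ0 _ hw)
        have t3 : |δ w * (q - q₀)| ≤ d * (C * ε) := by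
          rw [abs_mul]
          exact mul_le_mul (hδ0 _ hw) b1 (abs_nonneg _) hd0
        refine (abs_add_le _ _).trans ?_
        refine (add_le_add ((abs_add_le _ _).trans (add_le_add (abs_sub _ _) le_rfl)) le_rfl).trans ?_
        rw [hA]
        linarith
      · positivity
    have hB := hκ Y hY
    have hsum := Finset.sum_le_sum fun w hw =>
      Finset.sum_le_sum fun v (_ : v ∈ Finset.univ) => hterm w hw v
    simp only [Finset.sum_add_distrib, ← Finset.sum_mul] at hsum
    rw [hcard] at hsum
    have hB2 : κ₀ * d ≤ (∑ w ∈ words n, ∑ v : Bool, |r w v|) + N * (A * ε * d) := hB.trans hsum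
    have hsmall : N * (A * ε * d) ≤ κ₀ / 2 * d := by
      have : N * A * ε ≤ κ₀ / 2 := by
        have := mul_le_mul_of_nonneg_left hε1 (by positivity : 0 ≤ N * A)
        refine this.trans_eq ?_
        field_simp
      nlinarith
    have hlow : κ₀ / 2 * d ≤ ∑ w ∈ words n, ∑ v : Bool, |r w v| := by linarith
    have hcs : (∑ w ∈ words n, ∑ v : Bool, |r w v|) ^ 2 ≤
        N * ∑ w ∈ words n, ∑ v : Bool, r w v ^ 2 := by
      rw [← Finset.sum_product', ← Finset.sum_product']
      have := sq_sum_le_card_mul_sum_sq (s := words n ×ˢ (Finset.univ : Finset Bool))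
        (f := fun p => |r p.1 p.2|)
      simp only [sq_abs, Finset.card_product, card_words, Finset.card_univ, Fintype.card_bool] at this
      rw [hN, pow_succ]
      exact_mod_cast this
    have hsq : (κ₀ / 2 * d) ^ 2 ≤ (∑ w ∈ words n, ∑ v : Bool, |r w v|) ^ 2 :=
      pow_le_pow_left₀ (by positivity) hlow 2
    refine le_trans ?_ hq
    rw [div_mul_eq_mul_div, div_le_div_iff₀ (by positivity) (by norm_num)]
    nlinarith
  rw [condEnt_eq_crossEnt_sub_klCond hZm hGm hac]
  linarith

/-- The conditional output entropies of the stationary inputs in `S` exceed that of `X` by at most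
`O((ε log ε)²)`. -/
theorem exists_condEnt_le_add_sq (h : IsParryMeasure S m X c ρ) (hfac : IsFactorial S)
    (hirr : IsIrreducibleConstraint S) {n : ℕ} (hn : m ≤ n) :
    ∃ K : ℝ, ∀ᶠ ε in 𝓝[>] (0 : ℝ), ∀ Y : StationaryProcess, Y.allowed ⊆ S →
      condEnt (noisy ε Y.prob) n ≤
        condEnt (noisy ε X.prob) n + K * (ε ^ 2 * Real.log ε ^ 2) := by
  obtain ⟨K, κ, hK, hκ, hev⟩ := h.exists_condEnt_le hfac hirr hn
  -- the maximum over `d` of `K * (ε * log (1 / ε)) * d - κ * d ^ 2`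
  refine ⟨K ^ 2 / (4 * κ), ?_⟩
  filter_upwards [nhdsWithin_mono 0 Set.Ioi_subset_Ici_self hev] with ε hε Y hY
  refine (hε Y hY).trans ?_
  set d := blockDist (n + 1) Y X
  rw [one_div, Real.log_inv]
  have e : K ^ 2 / (4 * κ) * (ε ^ 2 * Real.log ε ^ 2) =
      K * (ε * -Real.log ε) * d - κ * d ^ 2 +
        κ * (d - K * (ε * -Real.log ε) / (2 * κ)) ^ 2 := by
    field_simp
    ring
  rw [e]
  have : 0 ≤ κ * (d - K * (ε * -Real.log ε) / (2 * κ)) ^ 2 := by positivity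
  linarith

/-- The Parry measure is the only Markov chain of order `n` in `S` with maximal entropy rate. -/
theorem eq_of_le_iInf_condEnt (h : IsParryMeasure S m X c ρ) (hfac : IsFactorial S)
    (hirr : IsIrreducibleConstraint S) {n : ℕ} (hn : m ≤ n) {Y : StationaryProcess}
    (hYm : Y.IsMarkov n) (hY : Y.allowed ⊆ S) (hle : c ≤ ⨅ k, condEnt Y.prob k) : Y = X := by
  obtain ⟨K, κ, -, hκ, hev⟩ := h.exists_condEnt_le hfac hirr hn
  have h0 := hev.self_of_nhdsWithin (Set.self_mem_Ici) Y hY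
  have hz : ∀ F : List Bool → ℝ, noisy 0 F = F := fun F => funext fun w => noisy_zero F w
  rw [hz, hz, h.condEnt_eq hn, zero_mul, mul_zero, zero_mul, add_zero] at h0
  have h1 := hle.trans (Y.iInf_condEnt_le n)
  have hd : blockDist (n + 1) Y X = 0 := by
    have : κ * blockDist (n + 1) Y X ^ 2 ≤ 0 := by linarith
    have h2 : blockDist (n + 1) Y X ^ 2 ≤ 0 := nonpos_of_mul_nonpos_right this hκ
    exact pow_eq_zero_iff two_ne_zero |>.1 (le_antisymm h2 (sq_nonneg _))
  have hlong : ∀ u, u.length = n + 1 → Y.prob u = X.prob u := fun u hu => by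
    have := abs_prob_sub_le_blockDist Y X hu
    rw [hd] at this
    exact sub_eq_zero.1 (abs_nonpos_iff.1 this)
  have hshort : ∀ u, u.length ≤ n + 1 → Y.prob u = X.prob u := fun u hu => by
    rw [← Y.isWordMeasure.sum_append u (n + 1 - u.length),
      ← X.isWordMeasure.sum_append u (n + 1 - u.length)]
    refine Finset.sum_congr rfl fun x hx => hlong _ ?_
    have := mem_words.1 hx
    simp only [List.length_append]
    omega
  have hXm := h.isMarkov.mono hn
  have hall : ∀ u, Y.prob u = X.prob u := by
    intro u
    induction u using List.reverseRecOn with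
    | nil => exact hshort [] (by simp)
    | append_singleton u v ih =>
      by_cases hu : (u ++ [v]).length ≤ n + 1
      · exact hshort _ hu
      · obtain ⟨p, q, rfl, hq⟩ : ∃ p q, u = p ++ q ∧ q.length = n :=
          ⟨u.take (u.length - n), u.drop (u.length - n), by simp, by simp at hu ⊢; omega⟩
        have e1 := hYm p q v hq
        have e2 := hXm p q v hq
        rw [hshort q (by omega), ih, hshort (q ++ [v]) (by simp [hq]), ← e2] at e1
        by_cases hq0 : X.prob q = 0
        · have a1 : X.prob (p ++ q) = 0 := X.prepend_eq_zero hq0 p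
          have a2 : Y.prob (p ++ q) = 0 := by rw [ih, a1]
          rw [X.append_eq_zero a1, Y.append_eq_zero a2]
        · exact mul_right_cancel₀ hq0 e1
  exact StationaryProcess.ext (funext hall)

end IsParryMeasure

/-! ### Flipping one bit in a Markov chain -/

namespace StationaryProcess

variable {X : StationaryProcess} {m : ℕ}

theorem flipSum_eq_zero_of_forall {F : List Bool → ℝ} (h : ∀ t, F t = 0) (z : List Bool) :
    flipSum F z = 0 := by
  rw [show F = fun _ => 0 from funext h, flipSum_zero]

theorem prob_append_eq_zero₃ {w : List Bool} (h : X.prob w = 0) (s t : List Bool) :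
    X.prob (s ++ (w ++ t)) = 0 :=
  X.prepend_eq_zero (X.append_eq_zero h t) s

/-- Flips to the right of a block of length `m` do not interact with the symbols to its left. -/
theorem IsMarkov.flipSum_append_left (hX : X.IsMarkov m) {w : List Bool} (hw : m ≤ w.length)
    (s z : List Bool) : flipSum (fun t => X.prob (s ++ (w ++ t))) z =
      X.prob (s ++ w) / X.prob w * flipSum (fun t => X.prob (w ++ t)) z := by
  rw [← flipSum_mul_left]
  refine flipSum_congr fun t _ => ?_
  by_cases h0 : X.prob w = 0
  · rw [prob_append_eq_zero₃ h0, h0, div_zero, zero_mul]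
  · rw [div_mul_eq_mul_div, eq_div_iff h0]
    exact hX.split hw s t

/-- Flips to the left of a block of length `m` do not interact with the symbols to its right. -/
theorem IsMarkov.flipSum_append_right (hX : X.IsMarkov m) {w : List Bool} (hw : m ≤ w.length)
    (s z b : List Bool) : flipSum (fun t => X.prob (s ++ (t ++ (w ++ b)))) z * X.prob w =
      flipSum (fun t => X.prob (s ++ (t ++ w))) z * X.prob (w ++ b) := by
  rw [mul_comm _ (X.prob w), mul_comm _ (X.prob (w ++ b)), ← flipSum_mul_left, ← flipSum_mul_left]
  refine flipSum_congr fun t _ => ?_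
  have := hX.split hw (s ++ t) b
  simp only [List.append_assoc] at this
  linarith

theorem exists_split {n k : ℕ} {w : List Bool} (hw : w.length = n) (hk : k ≤ n) :
    ∃ p q, w = p ++ q ∧ p.length = k ∧ q.length = n - k :=
  ⟨w.take k, w.drop k, by simp, by simp; omega, by simp [hw]⟩

theorem IsMarkov.tail_snoc_eq_zero (hX : X.IsMarkov m) {a w : List Bool} {v : Bool}
    (hw : m ≤ w.length) (hp : X.prob (a ++ w) ≠ 0) (h0 : X.prob (a ++ (w ++ [v])) = 0) :
    X.prob (w ++ [v]) = 0 := by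
  have := hX.split hw a [v]
  rw [h0, zero_mul] at this
  exact (mul_eq_zero.1 this.symm).resolve_left hp

/-- If the forbidden word is completed by the last symbol, the flips that repair it do not interact
with the symbols `s` in the far past. -/
theorem IsMarkov.flipSum_snoc_of_prob_eq_zero (hX : X.IsMarkov m) {n : ℕ} (hn : 2 * m ≤ n)
    {s w : List Bool} {v : Bool} (hw : w.length = n) (hp : X.prob w ≠ 0)
    (h0 : X.prob (w ++ [v]) = 0) :
    flipSum (fun t => X.prob (s ++ t)) (w ++ [v]) * X.prob w =
      X.prob (s ++ w) * flipSum X.prob (w ++ [v]) := by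
  obtain ⟨w₁, w₂, rfl, h₁, h₂⟩ := exists_split hw (show m ≤ n by omega)
  rw [List.append_assoc] at h0 ⊢
  have hz := hX.tail_snoc_eq_zero (by omega) hp h0
  have hp1 : X.prob w₁ ≠ 0 := fun e => hp (X.append_eq_zero e _)
  have hsp := hX.split h₁.ge s w₂
  rw [flipSum_append _ w₁, flipSum_append _ w₁,
    flipSum_eq_zero_of_forall (F := fun t => X.prob (s ++ (t ++ (w₂ ++ [v]))))
      (fun t => X.prepend_eq_zero (X.prepend_eq_zero hz t) s),
    flipSum_eq_zero_of_forall (F := fun t => X.prob (t ++ (w₂ ++ [v])))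
      (fun t => X.prepend_eq_zero hz t), hX.flipSum_append_left h₁.ge, zero_add, zero_add]
  field_simp
  linear_combination -flipSum (fun t => X.prob (w₁ ++ t)) (w₂ ++ [v]) * hsp

/-- If the far past `s` shows that the allowed word `w` contains an error, the error is close to the
beginning of `w` and does not influence the next symbol. -/
theorem IsMarkov.flipSum_snoc_of_prob_append_eq_zero (hX : X.IsMarkov m) {n : ℕ} (hn : 2 * m ≤ n)
    {s w : List Bool} (v : Bool) (hw : w.length = n) (hp : X.prob w ≠ 0)
    (h0 : X.prob (s ++ w) = 0) :
    flipSum (fun t => X.prob (s ++ t)) (w ++ [v]) * X.prob w =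
      flipSum (fun t => X.prob (s ++ t)) w * X.prob (w ++ [v]) := by
  obtain ⟨w₁, w₂, rfl, h₁, h₂⟩ := exists_split hw (show m ≤ n by omega)
  have hz : X.prob (s ++ w₁) = 0 := by
    have := hX.split h₁.ge s w₂
    rw [h0, zero_mul] at this
    exact (mul_eq_zero.1 this.symm).resolve_right hp
  have hz' : ∀ t, X.prob (s ++ (w₁ ++ t)) = 0 := fun t => by
    rw [← List.append_assoc]
    exact X.append_eq_zero hz t
  have hp2 : X.prob w₂ ≠ 0 := fun e => hp (X.prepend_eq_zero e _)
  have hr := hX.flipSum_append_right (w := w₂) (by omega) s w₁ [v]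
  have hsp := hX.split (s := w₂) (by omega) w₁ [v]
  rw [List.append_assoc, flipSum_append _ w₁, flipSum_append _ w₁,
    flipSum_eq_zero_of_forall hz', flipSum_eq_zero_of_forall hz', add_zero, add_zero]
  apply mul_right_cancel₀ hp2
  linear_combination X.prob (w₁ ++ w₂) * hr -
    flipSum (fun t => X.prob (s ++ (t ++ w₂))) w₁ * hsp

/-- If `w` itself contains an error, then either the error is far from the end of `w` and does not
influence the next symbol, or it is far from the beginning of `w` and does not interact with the
far past `s`. -/
theorem IsMarkov.flipSum_snoc_mul (hX : X.IsMarkov m) {n : ℕ} (hn : 3 * m ≤ n)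
    {s w : List Bool} (v : Bool) (hw : w.length = n) (h0 : X.prob w = 0) :
    flipSum (fun t => X.prob (s ++ t)) (w ++ [v]) * flipSum X.prob w =
      flipSum (fun t => X.prob (s ++ t)) w * flipSum X.prob (w ++ [v]) := by
  -- the error is visible in the first two or in the last two of three blocks
  obtain ⟨w₁, w', rfl, h₁, h'⟩ := exists_split hw (show m ≤ n by omega)
  obtain ⟨w₂, w₃, rfl, h₂, h₃⟩ := exists_split h' (show m ≤ n - m by omega)
  have hcase : X.prob (w₁ ++ w₂) = 0 ∨ X.prob (w₂ ++ w₃) = 0 := by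
    have := hX.split h₂.ge w₁ w₃
    rw [h0, zero_mul] at this
    exact mul_eq_zero.1 this.symm
  rcases hcase with hz | hz
  · have key : ∀ s, flipSum (fun t => X.prob (s ++ t)) (w₁ ++ (w₂ ++ w₃) ++ [v]) * X.prob w₃ =
        flipSum (fun t => X.prob (s ++ t)) (w₁ ++ (w₂ ++ w₃)) * X.prob (w₃ ++ [v]) := by
      intro s
      rw [← List.append_assoc w₁, List.append_assoc (w₁ ++ w₂), flipSum_append _ (w₁ ++ w₂),
        flipSum_append _ (w₁ ++ w₂), flipSum_eq_zero_of_forall (prob_append_eq_zero₃ hz s),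
        flipSum_eq_zero_of_forall (prob_append_eq_zero₃ hz s), add_zero, add_zero]
      exact hX.flipSum_append_right (by omega) s _ _
    have k1 := key s
    have k2 := key []
    simp only [List.nil_append] at k2
    change flipSum X.prob _ * _ = flipSum X.prob _ * _ at k2
    by_cases h3 : X.prob w₃ = 0
    · have hvan : ∀ s, flipSum (fun t => X.prob (s ++ t)) (w₁ ++ (w₂ ++ w₃)) = 0 := fun s => by
        rw [← List.append_assoc w₁, flipSum_append _ (w₁ ++ w₂),
          flipSum_eq_zero_of_forall (prob_append_eq_zero₃ hz s), add_zero]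
        exact flipSum_eq_zero_of_forall (fun t =>
          X.prepend_eq_zero (X.prepend_eq_zero h3 t) s) _
      have hvan' := hvan []
      simp only [List.nil_append] at hvan'
      change flipSum X.prob _ = 0 at hvan'
      rw [hvan s, hvan']
      ring
    · apply mul_right_cancel₀ h3
      linear_combination flipSum X.prob (w₁ ++ (w₂ ++ w₃)) * k1 -
        flipSum (fun t => X.prob (s ++ t)) (w₁ ++ (w₂ ++ w₃)) * k2
  · have key : ∀ s b, flipSum (fun t => X.prob (s ++ t)) (w₁ ++ (w₂ ++ w₃ ++ b)) =
        X.prob (s ++ w₁) / X.prob w₁ * flipSum (fun t => X.prob (w₁ ++ t)) (w₂ ++ w₃ ++ b) := by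
      intro s b
      rw [flipSum_append, flipSum_eq_zero_of_forall (F := fun t =>
        X.prob (s ++ (t ++ (w₂ ++ w₃ ++ b)))) (fun t =>
          X.prepend_eq_zero (prob_append_eq_zero₃ hz t b) s), zero_add]
      exact hX.flipSum_append_left h₁.ge s _
    have k1 := key s []
    have k2 := key [] []
    have k3 := key s [v]
    have k4 := key [] [v]
    simp only [List.nil_append, List.append_nil] at k1 k2 k3 k4
    change flipSum X.prob _ = _ at k2
    change flipSum X.prob _ = _ at k4
    rw [List.append_assoc w₁, k1, k2, k3, k4]
    ring

end StationaryProcess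

/-! ### Leading terms at `ε = 0` -/

/-- `f ε = c ε ^ k + O(ε ^ (k + 1))` as `ε → 0+`. -/
def HasLead (f : ℝ → ℝ) (k : ℕ) (c : ℝ) : Prop :=
  (fun ε => f ε - c * ε ^ k) =O[𝓝[>] 0] fun ε : ℝ => ε ^ (k + 1)

theorem pow_isBigO_pow {k l : ℕ} (h : k ≤ l) :
    (fun ε : ℝ => ε ^ l) =O[𝓝[>] 0] fun ε : ℝ => ε ^ k := by
  refine IsBigO.of_bound 1 ?_
  filter_upwards [nhdsWithin_le_nhds (Iic_mem_nhds (one_pos : (0 : ℝ) < 1)),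
    self_mem_nhdsWithin] with ε h1 h0
  have h0 : 0 < ε := h0
  have h1 : ε ≤ 1 := h1
  rw [one_mul, norm_pow, norm_pow]
  exact pow_le_pow_of_le_one (norm_nonneg _) (by rwa [Real.norm_eq_abs, abs_of_pos h0]) h

namespace HasLead

variable {f g : ℝ → ℝ} {k l : ℕ} {c d : ℝ}

theorem isBigO (hf : HasLead f k c) : f =O[𝓝[>] 0] fun ε : ℝ => ε ^ k := by
  have h1 := hf.trans (pow_isBigO_pow (Nat.le_succ k))
  have h2 : (fun ε : ℝ => c * ε ^ k) =O[𝓝[>] 0] fun ε : ℝ => ε ^ k :=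
    (isBigO_refl _ _).const_mul_left c
  simpa using h1.add h2

theorem isBigO_succ (hf : HasLead f k 0) : f =O[𝓝[>] 0] fun ε : ℝ => ε ^ (k + 1) := by
  simpa [HasLead] using hf

theorem mul (hf : HasLead f k c) (hg : HasLead g l d) :
    HasLead (fun ε => f ε * g ε) (k + l) (c * d) := by
  have h1 := IsBigO.mul hf hg.isBigO
  have h2 := ((isBigO_refl (fun ε : ℝ => ε ^ k) (𝓝[>] 0)).const_mul_left c).mul (show
    (fun ε => g ε - d * ε ^ l) =O[𝓝[>] 0] fun ε : ℝ => ε ^ (l + 1) from hg)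
  have e1 : (fun ε : ℝ => ε ^ (k + 1) * ε ^ l) = fun ε => ε ^ (k + l + 1) := by
    funext ε
    ring
  have e2 : (fun ε : ℝ => ε ^ k * ε ^ (l + 1)) = fun ε => ε ^ (k + l + 1) := by
    funext ε
    ring
  rw [e1] at h1
  rw [e2] at h2
  refine (h1.add h2).congr_left fun ε => ?_
  ring

theorem sub (hf : HasLead f k c) (hg : HasLead g k d) :
    HasLead (fun ε => f ε - g ε) k (c - d) := by
  refine (IsBigO.sub hf hg).congr_left fun ε => ?_
  ring

theorem exists_le (hf : HasLead f k c) (hc : 0 < c) :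
    ∃ c', 0 < c' ∧ ∀ᶠ ε in 𝓝[>] (0 : ℝ), c' * ε ^ k ≤ f ε := by
  obtain ⟨C, hC, h⟩ := hf.exists_pos
  refine ⟨c / 2, by positivity, ?_⟩
  have hs : ∀ᶠ ε in 𝓝[>] (0 : ℝ), ε ≤ c / (2 * C) :=
    nhdsWithin_le_nhds (Iic_mem_nhds (by positivity))
  filter_upwards [h.bound, hs, self_mem_nhdsWithin] with ε h1 h2 h0
  have h0 : 0 < ε := h0
  rw [Real.norm_eq_abs, Real.norm_eq_abs, abs_of_pos (pow_pos h0 _), pow_succ] at h1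
  have h3 := (abs_le.1 h1).1
  have hk : 0 < ε ^ k := pow_pos h0 k
  have h4 : C * (ε ^ k * ε) ≤ c / 2 * ε ^ k := by
    have : C * ε ≤ c / 2 := by
      calc C * ε ≤ C * (c / (2 * C)) := by gcongr
        _ = c / 2 := by field_simp
    nlinarith
  linarith

end HasLead

theorem hasLead_noisy_zero (F : List Bool → ℝ) (w : List Bool) :
    HasLead (fun ε => noisy ε F w) 0 (F w) := by
  have h1 := (noisy_sub_isBigO F w).trans (pow_isBigO_pow (show 1 ≤ 2 by norm_num))
  have h2 : (fun ε : ℝ => ε * noisyDeriv F w) =O[𝓝[>] 0] fun ε : ℝ => ε ^ 1 := by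
    simpa [mul_comm] using (isBigO_refl (fun ε : ℝ => ε) (𝓝[>] 0)).const_mul_left (noisyDeriv F w)
  refine (h1.add h2).congr_left fun ε => ?_
  ring

theorem hasLead_noisy_one {F : List Bool → ℝ} {w : List Bool} (h : F w = 0) :
    HasLead (fun ε => noisy ε F w) 1 (flipSum F w) := by
  refine (noisy_sub_isBigO F w).congr_left fun ε => ?_
  rw [noisyDeriv, h]
  ring

/-- Bound for a term of the chi-square divergence: `D ^ 2 / (a * b * e)` is `O(ε ^ 2)` when the
numerator vanishes to a high enough order. -/
theorem sq_div_isBigO {D a b e : ℝ → ℝ} {l p q r : ℕ}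
    (hD : D =O[𝓝[>] 0] fun ε : ℝ => ε ^ l)
    (ha : ∃ c, 0 < c ∧ ∀ᶠ ε in 𝓝[>] (0 : ℝ), c * ε ^ p ≤ a ε)
    (hb : ∃ c, 0 < c ∧ ∀ᶠ ε in 𝓝[>] (0 : ℝ), c * ε ^ q ≤ b ε)
    (he : ∃ c, 0 < c ∧ ∀ᶠ ε in 𝓝[>] (0 : ℝ), c * ε ^ r ≤ e ε) (h : p + q + r + 2 ≤ 2 * l) :
    (fun ε => D ε ^ 2 / (a ε * b ε * e ε)) =O[𝓝[>] 0] fun ε : ℝ => ε ^ 2 := by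
  obtain ⟨C, hC, hD⟩ := hD.exists_pos
  obtain ⟨c₁, hc₁, ha⟩ := ha
  obtain ⟨c₂, hc₂, hb⟩ := hb
  obtain ⟨c₃, hc₃, he⟩ := he
  refine IsBigO.of_bound (C ^ 2 / (c₁ * c₂ * c₃)) ?_
  filter_upwards [hD.bound, ha, hb, he, self_mem_nhdsWithin,
    nhdsWithin_le_nhds (Iic_mem_nhds (one_pos : (0 : ℝ) < 1))] with ε h1 h2 h3 h4 h0 h5
  have h0 : 0 < ε := h0
  have h5 : ε ≤ 1 := h5
  have a1 : 0 < c₁ * ε ^ p := by positivity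
  have a2 : 0 < c₂ * ε ^ q := by positivity
  have a3 : 0 < c₃ * ε ^ r := by positivity
  have b1 : 0 ≤ a ε := a1.le.trans h2
  have b2 : 0 ≤ b ε := a2.le.trans h3
  have hden : (c₁ * c₂ * c₃) * ε ^ (p + q + r) ≤ a ε * b ε * e ε := by
    calc (c₁ * c₂ * c₃) * ε ^ (p + q + r) = c₁ * ε ^ p * (c₂ * ε ^ q) * (c₃ * ε ^ r) := by ring
      _ ≤ a ε * b ε * e ε := by gcongr
  have hpos : 0 < a ε * b ε * e ε := lt_of_lt_of_le (by positivity) hden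
  rw [Real.norm_eq_abs, Real.norm_eq_abs, abs_of_pos (by positivity : 0 < ε ^ 2),
    abs_of_nonneg (by positivity), div_le_iff₀ hpos]
  rw [Real.norm_eq_abs, Real.norm_eq_abs, abs_of_pos (by positivity : 0 < ε ^ l)] at h1
  calc D ε ^ 2 = |D ε| ^ 2 := (sq_abs _).symm
    _ ≤ (C * ε ^ l) ^ 2 := by gcongr
    _ = C ^ 2 * ε ^ (2 * l) := by ring
    _ ≤ C ^ 2 * ε ^ (p + q + r + 2) := by
        gcongr C ^ 2 * ?_
        exact pow_le_pow_of_le_one h0.le h5 h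
    _ = C ^ 2 / (c₁ * c₂ * c₃) * ε ^ 2 * (c₁ * c₂ * c₃ * ε ^ (p + q + r)) := by
        field_simp
        ring
    _ ≤ C ^ 2 / (c₁ * c₂ * c₃) * ε ^ 2 * (a ε * b ε * e ε) := by gcongr

theorem sq_isBigO_sq_mul_log_sq :
    (fun ε : ℝ => ε ^ 2) =O[𝓝[>] 0] fun ε : ℝ => ε ^ 2 * Real.log ε ^ 2 := by
  refine IsBigO.of_bound 1 ?_
  filter_upwards [nhdsWithin_le_nhds (Iic_mem_nhds (Real.exp_pos (-1))),
    self_mem_nhdsWithin] with ε h1 h0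
  have h0 : 0 < ε := h0
  have hl : Real.log ε ≤ -1 := by
    rw [Real.log_le_iff_le_exp h0]
    exact h1
  rw [one_mul, Real.norm_eq_abs, Real.norm_eq_abs, abs_of_nonneg (by positivity),
    abs_of_nonneg (by positivity)]
  refine le_mul_of_one_le_right (by positivity) ?_
  nlinarith

theorem sq_mul_log_isBigO_sq_mul_log_sq :
    (fun ε : ℝ => ε ^ 2 * Real.log ε) =O[𝓝[>] 0] fun ε : ℝ => ε ^ 2 * Real.log ε ^ 2 := by
  refine IsBigO.of_bound 1 ?_
  filter_upwards [nhdsWithin_le_nhds (Iic_mem_nhds (Real.exp_pos (-1))),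
    self_mem_nhdsWithin] with ε h1 h0
  have h0 : 0 < ε := h0
  have hl : Real.log ε ≤ -1 := by
    rw [Real.log_le_iff_le_exp h0]
    exact h1
  rw [one_mul, Real.norm_eq_abs, Real.norm_eq_abs, abs_mul, abs_mul, abs_of_nonneg (sq_nonneg ε),
    abs_of_nonneg (sq_nonneg (Real.log ε)), abs_of_neg (by linarith)]
  exact mul_le_mul_of_nonneg_left (by nlinarith) (sq_nonneg ε)

/-! ### The loss of a predictor of bounded memory -/

/-- The contribution of the context `w` to the conditional relative entropy. -/
def klTerm (F G : List Bool → ℝ) (w : List Bool) : ℝ :=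
  ∑ v : Bool, F (w ++ [v]) * Real.log (F (w ++ [v]) / (F w * (G (w ++ [v]) / G w)))

theorem klCond_eq_sum (n : ℕ) (F G : List Bool → ℝ) :
    klCond n F G = ∑ w ∈ words n, klTerm F G w := rfl

section klTerm

variable {F G : List Bool → ℝ}

theorem klTerm_nonneg (hF : IsWordMeasure F) (hG : IsWordMeasure G) (hpos : ∀ w, 0 < G w)
    (w : List Bool) : 0 ≤ klTerm F G w := by
  have key : ∀ v : Bool, F (w ++ [v]) - F w * (G (w ++ [v]) / G w) ≤
      F (w ++ [v]) * Real.log (F (w ++ [v]) / (F w * (G (w ++ [v]) / G w))) := fun v =>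
    sub_le_mul_log_div (hF.nonneg _)
      (mul_nonneg (hF.nonneg _) (div_pos (hpos _) (hpos _)).le) fun e =>
        hF.append_eq_zero ((mul_eq_zero.1 e).resolve_right (div_pos (hpos _) (hpos _)).ne') _
  have hs := Finset.sum_le_sum fun v (_ : v ∈ Finset.univ) => key v
  rwa [Finset.sum_sub_distrib, hF.sum_bool, ← Finset.mul_sum, ← Finset.sum_div, hG.sum_bool,
    div_self (hpos w).ne', mul_one, sub_self] at hs

/-- If the predictor gives both symbols probability at least `ε`, at most `log (1 / ε)` is lost. -/
theorem klTerm_le_mul_log {ε : ℝ} (h0 : 0 < ε) (hF : IsWordMeasure F) (hpos : ∀ w, 0 < G w)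
    {w : List Bool} (h : ∀ v, ε * G w ≤ G (w ++ [v])) :
    klTerm F G w ≤ F w * -Real.log ε := by
  rw [← hF.sum_bool w, Finset.sum_mul, klTerm]
  refine Finset.sum_le_sum fun v _ => ?_
  rcases (hF.nonneg (w ++ [v])).eq_or_lt with hz | hz
  · rw [← hz, zero_mul, zero_mul]
  have hw : 0 < F w := hz.trans_le (hF.snoc_le w v)
  refine mul_le_mul_of_nonneg_left ?_ hz.le
  rw [← Real.log_inv]
  have hq : ε ≤ G (w ++ [v]) / G w := (le_div_iff₀ (hpos w)).2 (h v)
  refine Real.log_le_log (div_pos hz (mul_pos hw (h0.trans_le hq))) ?_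
  rw [div_le_iff₀ (mul_pos hw (h0.trans_le hq))]
  calc F (w ++ [v]) ≤ F w := hF.snoc_le w v
    _ = ε⁻¹ * (F w * ε) := by field_simp
    _ ≤ ε⁻¹ * (F w * (G (w ++ [v]) / G w)) := by gcongr

/-- The chi-square bound for the relative entropy. -/
theorem klTerm_le_chiSq (hF : IsWordMeasure F) (hG : IsWordMeasure G) (hpos : ∀ w, 0 < G w)
    {w : List Bool} (hw : 0 < F w) :
    klTerm F G w ≤ ∑ v : Bool, (F (w ++ [v]) * G w - F w * G (w ++ [v])) ^ 2 /
      (F w * G w * G (w ++ [v])) := by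
  have key : ∀ v : Bool,
      F (w ++ [v]) * Real.log (F (w ++ [v]) / (F w * (G (w ++ [v]) / G w))) ≤
        (F (w ++ [v]) - F w * (G (w ++ [v]) / G w)) +
          (F (w ++ [v]) * G w - F w * G (w ++ [v])) ^ 2 / (F w * G w * G (w ++ [v])) := by
    intro v
    have hy : 0 < F w * (G (w ++ [v]) / G w) := mul_pos hw (div_pos (hpos _) (hpos _))
    rcases (hF.nonneg (w ++ [v])).eq_or_lt with hz | hz
    · rw [← hz]
      have g1 := hpos w
      have g2 := hpos (w ++ [v])
      refine le_of_eq ?_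
      field_simp
      ring
    have hl := mul_le_mul_of_nonneg_left (Real.log_le_sub_one_of_pos (div_pos hz hy)) hz.le
    refine hl.trans (le_of_eq ?_)
    have g1 := hpos w
    have g2 := hpos (w ++ [v])
    field_simp
    ring
  have hs := Finset.sum_le_sum fun v (_ : v ∈ Finset.univ) => key v
  rwa [Finset.sum_add_distrib, Finset.sum_sub_distrib, hF.sum_bool, ← Finset.mul_sum,
    ← Finset.sum_div, hG.sum_bool, div_self (hpos w).ne', mul_one, sub_self, zero_add] at hs

end klTerm

theorem klCond_mul_left (n : ℕ) (c : ℝ) (F G : List Bool → ℝ) :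
    klCond n (fun u => c * F u) G = c * klCond n F G := by
  rcases eq_or_ne c 0 with rfl | hc
  · simp [klCond]
  · simp only [klCond, mul_assoc, mul_div_mul_left _ _ hc, ← Finset.mul_sum]

/-- The conditional relative entropy with respect to a fixed measure is subadditive. -/
theorem klCond_add_le {F F' G : List Bool → ℝ} (n : ℕ) (hF : IsWordMeasure F)
    (hF' : IsWordMeasure F') (hpos : ∀ w, 0 < G w) :
    klCond n (fun u => F u + F' u) G ≤ klCond n F G + klCond n F' G := by
  rw [klCond, klCond, klCond, ← Finset.sum_add_distrib]
  refine Finset.sum_le_sum fun w _ => ?_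
  rw [← Finset.sum_add_distrib]
  refine Finset.sum_le_sum fun v _ => ?_
  have hq : 0 < G (w ++ [v]) / G w := div_pos (hpos _) (hpos _)
  rw [add_mul (F w)]
  exact mul_log_div_add_le (hF.nonneg _) (hF'.nonneg _) (mul_nonneg (hF.nonneg _) hq.le)
    (mul_nonneg (hF'.nonneg _) hq.le)
    (fun e => hF.append_eq_zero ((mul_eq_zero.1 e).resolve_right hq.ne') _)
    (fun e => hF'.append_eq_zero ((mul_eq_zero.1 e).resolve_right hq.ne') _)

/-- Convexity of the relative entropy, applied to the mixture over the channel inputs that may have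
produced the output `y`. -/
theorem klCond_noisy_le {Φ : List Bool → List Bool → ℝ} {G : List Bool → ℝ} {ε : ℝ} (n : ℕ)
    (h0 : 0 ≤ ε) (h1 : ε ≤ 1) (hΦ : ∀ x, IsWordMeasure (Φ x)) (hpos : ∀ w, 0 < G w)
    (y : List Bool) :
    klCond n (fun u => noisy ε (fun x => Φ x u) y) G ≤ noisy ε (fun x => klCond n (Φ x) G) y := by
  induction y generalizing Φ with
  | nil => exact le_rfl
  | cons v y ih =>
    have hm : ∀ (Ψ : List Bool → List Bool → ℝ), (∀ x, IsWordMeasure (Ψ x)) → ∀ y,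
        IsWordMeasure fun u => noisy ε (fun x => Ψ x u) y := by
      intro Ψ hΨ y
      refine ⟨fun w => noisy_nonneg h0 h1 fun x _ => (hΨ x).nonneg w, fun w => ?_⟩
      rw [← noisy_add]
      exact noisy_congr fun x _ => (hΨ x).snoc w
    simp only [noisy]
    have k1 := ih (Φ := fun x => Φ (v :: x)) fun x => hΦ _
    have k2 := ih (Φ := fun x => Φ ((!v) :: x)) fun x => hΦ _
    have h1' : 0 ≤ 1 - ε := by linarith
    refine (klCond_add_le n ((hm (fun x => Φ (v :: x)) (fun x => hΦ _) y).const_mul h1')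
      ((hm (fun x => Φ ((!v) :: x)) (fun x => hΦ _) y).const_mul h0) hpos).trans ?_
    rw [klCond_mul_left, klCond_mul_left]
    exact add_le_add (mul_le_mul_of_nonneg_left k1 h1') (mul_le_mul_of_nonneg_left k2 h0)

theorem isBigO_finset_sum {ι : Type*} {s : Finset ι} {A : ι → ℝ → ℝ} {l : Filter ℝ} {g : ℝ → ℝ}
    (h : ∀ i ∈ s, (fun ε => A i ε) =O[l] g) : (fun ε => ∑ i ∈ s, A i ε) =O[l] g :=
  (IsBigO.sum h).congr_left fun ε => Finset.sum_apply ε s A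

namespace StationaryProcess

variable {X : StationaryProcess} {m n : ℕ}

theorem noisy_prob_pos (X : StationaryProcess) {ε : ℝ} (h0 : 0 < ε) (h1 : ε < 1) (w : List Bool) :
    0 < noisy ε X.prob w := by
  refine noisy_pos h0 h1 X.nonneg ?_
  obtain ⟨x, hx, hp⟩ := X.isWordMeasure.exists_append_pos (w := [])
    (by rw [X.prob_nil]; exact one_pos) w.length
  exact ⟨x, hx, by simpa using hp⟩

theorem exists_le_noisy_snoc (X : StationaryProcess) {w : List Bool} {q : ℕ}
    (h : ∃ c, 0 < c ∧ ∀ᶠ ε in 𝓝[>] (0 : ℝ), c * ε ^ q ≤ noisy ε X.prob w) (v : Bool) :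
    ∃ c, 0 < c ∧ ∀ᶠ ε in 𝓝[>] (0 : ℝ), c * ε ^ (q + 1) ≤ noisy ε X.prob (w ++ [v]) := by
  obtain ⟨c, hc, h⟩ := h
  refine ⟨c, hc, ?_⟩
  filter_upwards [h, self_mem_nhdsWithin,
    nhdsWithin_le_nhds (Iic_mem_nhds (by norm_num : (0 : ℝ) < 1 / 2))] with ε h1 h0 h2
  have h0 : 0 < ε := h0
  calc c * ε ^ (q + 1) = ε * (c * ε ^ q) := by ring
    _ ≤ ε * noisy ε X.prob w := by gcongr
    _ ≤ _ := mul_noisy_le_noisy_snoc h0.le h2 X.nonneg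
        (fun x _ => X.isWordMeasure.snoc x) v

/-- Terms of the chi-square divergence between the output given the far past `s` of the input, and
the stationary output. In each case the leading terms of the two products in the numerator cancel,
by the Markov property. -/
theorem IsMarkov.chiSq_isBigO (hX : X.IsMarkov m) (hn : 3 * m ≤ n) (s : List Bool) {w : List Bool}
    (v : Bool) (hw : w.length = n)
    (h : X.prob (s ++ w) = 0 → flipSum (fun t => X.prob (s ++ t)) w ≠ 0) :
    (fun ε => (noisy ε (fun t => X.prob (s ++ t)) (w ++ [v]) * noisy ε X.prob w -
        noisy ε (fun t => X.prob (s ++ t)) w * noisy ε X.prob (w ++ [v])) ^ 2 /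
      (noisy ε (fun t => X.prob (s ++ t)) w * noisy ε X.prob w * noisy ε X.prob (w ++ [v])))
      =O[𝓝[>] 0] fun ε : ℝ => ε ^ 2 := by
  set A : List Bool → ℝ := fun t => X.prob (s ++ t) with hA
  have hA0 : ∀ t, 0 ≤ A t := fun t => X.nonneg _
  have hAm : IsWordMeasure A := X.isWordMeasure.append s
  have hAX : ∀ t, X.prob t = 0 → A t = 0 := fun t ht => X.prepend_eq_zero ht s
  by_cases hAw : A w = 0
  · have hfA : 0 < flipSum A w := lt_of_le_of_ne (flipSum_nonneg hA0 w) (Ne.symm (h hAw))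
    have hAwv : A (w ++ [v]) = 0 := hAm.append_eq_zero hAw _
    by_cases hXw : X.prob w = 0
    · have hXwv : X.prob (w ++ [v]) = 0 := X.append_eq_zero hXw _
      have hfX : 0 < flipSum X.prob w :=
         hfA.trans_le (flipSum_mono (fun t => X.prepend_le s t) w)
      have hD := ((hasLead_noisy_one hAwv).mul (hasLead_noisy_one hXw)).sub
        ((hasLead_noisy_one hAw).mul (hasLead_noisy_one hXwv))
      rw [sub_eq_zero.2 (hX.flipSum_snoc_mul hn v hw hXw)] at hD
      have hb := (hasLead_noisy_one hXw).exists_le hfX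
      exact sq_div_isBigO hD.isBigO_succ ((hasLead_noisy_one hAw).exists_le hfA) hb
        (X.exists_le_noisy_snoc hb v) (by norm_num)
    · have hD := ((hasLead_noisy_one hAwv).mul (hasLead_noisy_zero X.prob w)).sub
        ((hasLead_noisy_one hAw).mul (hasLead_noisy_zero X.prob (w ++ [v])))
      rw [sub_eq_zero.2 (hX.flipSum_snoc_of_prob_append_eq_zero (by omega) v hw hXw hAw)] at hD
      have hb := (hasLead_noisy_zero X.prob w).exists_le
        (lt_of_le_of_ne (X.nonneg w) (Ne.symm hXw))
      exact sq_div_isBigO hD.isBigO_succ ((hasLead_noisy_one hAw).exists_le hfA) hb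
        (X.exists_le_noisy_snoc hb v) (by norm_num)
  · have hXw : X.prob w ≠ 0 := fun e => hAw (hAX w e)
    have ha := (hasLead_noisy_zero A w).exists_le (lt_of_le_of_ne (hA0 w) (Ne.symm hAw))
    have hb := (hasLead_noisy_zero X.prob w).exists_le
      (lt_of_le_of_ne (X.nonneg w) (Ne.symm hXw))
    by_cases hXwv : X.prob (w ++ [v]) = 0
    · have hD := ((hasLead_noisy_one (hAX _ hXwv)).mul (hasLead_noisy_zero X.prob w)).sub
        ((hasLead_noisy_zero A w).mul (hasLead_noisy_one hXwv))
      rw [sub_eq_zero.2 (hX.flipSum_snoc_of_prob_eq_zero (by omega) hw hXw hXwv)] at hD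
      exact sq_div_isBigO hD.isBigO_succ ha hb (X.exists_le_noisy_snoc hb v) (by norm_num)
    · have hD := ((hasLead_noisy_zero A (w ++ [v])).mul (hasLead_noisy_zero X.prob w)).sub
        ((hasLead_noisy_zero A w).mul (hasLead_noisy_zero X.prob (w ++ [v])))
      have hs := hX.split (show m ≤ w.length by omega) s [v]
      rw [sub_eq_zero.2 hs] at hD
      exact sq_div_isBigO hD.isBigO_succ ha hb ((hasLead_noisy_zero X.prob (w ++ [v])).exists_le
        (lt_of_le_of_ne (X.nonneg _) (Ne.symm hXwv))) (by norm_num)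

/-- Given `s` in the far past, the prediction of the next output symbol from the last `n` output
symbols of the stationary chain loses only `O(ε ^ 2 log ^ 2 ε)`. -/
theorem IsMarkov.klCond_noisy_isBigO (hX : X.IsMarkov m) (hn : 3 * m ≤ n) (s : List Bool) :
    (fun ε => klCond n (noisy ε fun t => X.prob (s ++ t)) (noisy ε X.prob))
      =O[𝓝[>] 0] fun ε : ℝ => ε ^ 2 * Real.log ε ^ 2 := by
  simp only [klCond_eq_sum]
  refine isBigO_finset_sum fun w hw => ?_
  have hw := mem_words.1 hw
  have hsmall : ∀ᶠ ε in 𝓝[>] (0 : ℝ), 0 < ε ∧ ε ≤ 1 / 2 :=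
    eventually_mem_nhdsWithin.and
      (nhdsWithin_le_nhds (Iic_mem_nhds (by norm_num : (0 : ℝ) < 1 / 2)))
  -- contexts that need two errors have probability `O(ε ^ 2)`, and lose at most `log (1 / ε)`;
  -- the chi-square bound serves for all others
  by_cases h : X.prob (s ++ w) = 0 ∧ flipSum (fun t => X.prob (s ++ t)) w = 0
  · have h1 : (fun ε => noisy ε (fun t => X.prob (s ++ t)) w) =O[𝓝[>] 0] fun ε : ℝ => ε ^ 2 := by
      have := hasLead_noisy_one (F := fun t => X.prob (s ++ t)) h.1
      rw [h.2] at this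
      exact this.isBigO_succ
    have h2 := h1.mul (isBigO_refl (fun ε => Real.log ε) (𝓝[>] 0))
    refine IsBigO.trans ?_ (h2.trans sq_mul_log_isBigO_sq_mul_log_sq)
    refine IsBigO.of_bound 1 ?_
    filter_upwards [hsmall] with ε ⟨h0, h1⟩
    have hA := (X.isWordMeasure.append s).noisy h0.le (by linarith : ε ≤ 1)
    have hG := X.isWordMeasure.noisy h0.le (by linarith : ε ≤ 1)
    have hpos := X.noisy_prob_pos h0 (by linarith : ε < 1)
    rw [one_mul, Real.norm_eq_abs, Real.norm_eq_abs, abs_of_nonneg (klTerm_nonneg hA hG hpos w),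
      abs_mul, abs_of_nonneg (hA.nonneg w), abs_of_neg (Real.log_neg h0 (by linarith))]
    exact klTerm_le_mul_log h0 hA hpos fun v =>
      mul_noisy_le_noisy_snoc h0.le h1 X.nonneg (fun x _ => X.isWordMeasure.snoc x) v
  · have h' : X.prob (s ++ w) = 0 → flipSum (fun t => X.prob (s ++ t)) w ≠ 0 :=
      fun e e' => h ⟨e, e'⟩
    have hex : ∃ t, t.length = w.length ∧ 0 < X.prob (s ++ t) := by
      by_contra! hno
      have hz : ∀ t, t.length = w.length → X.prob (s ++ t) = 0 := fun t ht =>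
        le_antisymm (hno t ht) (X.nonneg _)
      refine h ⟨hz w rfl, ?_⟩
      rw [flipSum_congr (G := fun _ => 0) hz, flipSum_zero]
    refine IsBigO.trans ?_ ((isBigO_finset_sum fun v (_ : v ∈ (Finset.univ : Finset Bool)) =>
      hX.chiSq_isBigO hn s v hw h').trans sq_isBigO_sq_mul_log_sq)
    refine IsBigO.of_bound 1 ?_
    filter_upwards [hsmall] with ε ⟨h0, h1⟩
    have hA := (X.isWordMeasure.append s).noisy h0.le (by linarith : ε ≤ 1)
    have hG := X.isWordMeasure.noisy h0.le (by linarith : ε ≤ 1)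
    have hpos := X.noisy_prob_pos h0 (by linarith : ε < 1)
    rw [one_mul, Real.norm_eq_abs, Real.norm_eq_abs, abs_of_nonneg (klTerm_nonneg hA hG hpos w)]
    refine (klTerm_le_chiSq hA hG hpos ?_).trans (le_abs_self _)
    exact noisy_pos h0 (by linarith) (fun t => X.nonneg _) hex

/-- The entropy rate of the output of a Markov chain of order `m` is bounded below, up to
`O(ε ^ 2 log ^ 2 ε)`, by the conditional entropy of a symbol given the preceding `3 m` symbols. -/
theorem IsMarkov.exists_le_iInf_condEnt_noisy (hX : X.IsMarkov m) (hn : 3 * m ≤ n) :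
    ∃ K, ∀ᶠ ε in 𝓝[>] (0 : ℝ), condEnt (noisy ε X.prob) n - K * (ε ^ 2 * Real.log ε ^ 2) ≤
      ⨅ k, condEnt (noisy ε X.prob) k := by
  have hb : ∀ s, ∃ K, 0 ≤ K ∧ ∀ᶠ ε in 𝓝[>] (0 : ℝ),
      klCond n (noisy ε fun t => X.prob (s ++ t)) (noisy ε X.prob) ≤
        K * (ε ^ 2 * Real.log ε ^ 2) := by
    intro s
    obtain ⟨K, hK, h⟩ := (hX.klCond_noisy_isBigO hn s).exists_nonneg
    refine ⟨K, hK, h.bound.mono fun ε hε => ?_⟩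
    have hL : 0 ≤ ε ^ 2 * Real.log ε ^ 2 := by positivity
    rw [Real.norm_eq_abs, Real.norm_eq_abs, abs_of_nonneg hL] at hε
    exact (le_abs_self _).trans hε
  choose K hK hle using hb
  -- pasts `s` of probability zero contribute `K s / 0 = 0`
  set C := ∑ s ∈ words m, K s / X.prob s with hC
  refine ⟨C, ?_⟩
  have hall : ∀ᶠ ε in 𝓝[>] (0 : ℝ), ∀ s ∈ words m,
      klCond n (noisy ε fun t => X.prob (s ++ t)) (noisy ε X.prob) ≤
        K s * (ε ^ 2 * Real.log ε ^ 2) :=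
    (Finset.eventually_all _).2 fun s _ => hle s
  filter_upwards [hall, self_mem_nhdsWithin,
    nhdsWithin_le_nhds (Iio_mem_nhds (one_pos : (0 : ℝ) < 1))] with ε h h0 h1
  have h0 : 0 < ε := h0
  have h1 : ε < 1 := h1
  have hL : 0 ≤ ε ^ 2 * Real.log ε ^ 2 := by positivity
  have hpos := X.noisy_prob_pos h0 h1
  have hG := X.isWordMeasure.noisy h0.le h1.le
  -- a past `x` of length at least `m` acts through its last `m` symbols only
  have hpast : ∀ x : List Bool, m ≤ x.length →
      klCond n (noisy ε fun t => X.prob (x ++ t)) (noisy ε X.prob) ≤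
        X.prob x * (C * (ε ^ 2 * Real.log ε ^ 2)) := by
    intro x hx
    obtain ⟨p, s, rfl, -, hs⟩ := exists_split (k := x.length - m) rfl (Nat.sub_le _ _)
    have hs : s.length = m := by omega
    by_cases hz : X.prob s = 0
    · have e : ∀ t, X.prob (p ++ s ++ t) = 0 := fun t => by
        rw [List.append_assoc]
        exact prob_append_eq_zero₃ hz p t
      have : (noisy ε fun t => X.prob (p ++ s ++ t)) = fun _ => 0 * (0 : ℝ) := by
        funext u
        rw [noisy_congr (G := fun _ => 0) fun t _ => e t, noisy_const, zero_mul]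
      rw [this, klCond_mul_left, zero_mul, X.prepend_eq_zero hz, zero_mul]
    · have e : (noisy ε fun t => X.prob (p ++ s ++ t)) =
          fun u => X.prob (p ++ s) / X.prob s * noisy ε (fun t => X.prob (s ++ t)) u := by
        funext u
        rw [← noisy_mul_left]
        refine noisy_congr fun t _ => ?_
        rw [div_mul_eq_mul_div, eq_div_iff hz, List.append_assoc]
        exact hX.split hs.ge p t
      have hsC : K s / X.prob s ≤ C :=
        Finset.single_le_sum (f := fun s => K s / X.prob s)
          (fun s _ => div_nonneg (hK s) (X.nonneg s)) (mem_words.2 hs)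
      rw [e, klCond_mul_left]
      calc X.prob (p ++ s) / X.prob s * klCond n (noisy ε fun t => X.prob (s ++ t)) (noisy ε X.prob)
          ≤ X.prob (p ++ s) / X.prob s * (K s * (ε ^ 2 * Real.log ε ^ 2)) :=
            mul_le_mul_of_nonneg_left (h s (mem_words.2 hs))
              (div_nonneg (X.nonneg _) (X.nonneg _))
        _ = X.prob (p ++ s) * (K s / X.prob s * (ε ^ 2 * Real.log ε ^ 2)) := by ring
        _ ≤ _ := mul_le_mul_of_nonneg_left (mul_le_mul_of_nonneg_right hsC hL) (X.nonneg _)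
  refine (X.output ε h0.le h1.le).le_iInf_condEnt (N := n + m) fun k => ?_
  change _ ≤ condEnt (noisy ε X.prob) (k + (n + m))
  have hsh : shiftBy (k + m) (noisy ε X.prob) = noisy ε X.prob := by
    funext w
    rw [shiftBy_noisy, X.shiftBy_prob]
  rw [show k + (n + m) = k + m + n by ring,
    condEnt_add_eq hG hG fun y w v _ _ e => absurd e (hpos _).ne', hsh, crossEnt_self]
  refine sub_le_sub_left ?_ _
  calc ∑ y ∈ words (k + m), klCond n (fun x => noisy ε X.prob (y ++ x)) (noisy ε X.prob)
      ≤ ∑ y ∈ words (k + m),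
          noisy ε (fun x => X.prob x * (C * (ε ^ 2 * Real.log ε ^ 2))) y := by
        refine Finset.sum_le_sum fun y hy => ?_
        have hy := mem_words.1 hy
        simp only [noisy_append]
        refine (klCond_noisy_le (Φ := fun x u => noisy ε (fun t => X.prob (x ++ t)) u) n h0.le h1.le
          (fun x => (X.isWordMeasure.append x).noisy h0.le h1.le) hpos y).trans ?_
        exact noisy_mono h0.le h1.le fun x hx => hpast x (by omega)
    _ = C * (ε ^ 2 * Real.log ε ^ 2) := by
        rw [sum_noisy, ← Finset.sum_mul, X.isWordMeasure.sum_words, X.prob_nil, one_mul]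

end StationaryProcess

/-! ### Asymptotics of `a log (a / b)` -/

/-- The first-order expansion of the logarithm at a positive value. -/
theorem log_sub_isBigO {a : ℝ → ℝ} {a₀ : ℝ} (h : (fun ε => a ε - a₀) =O[𝓝[>] 0] fun ε : ℝ => ε)
    (h0 : 0 < a₀) :
    (fun ε => Real.log (a ε) - Real.log a₀ - (a ε - a₀) / a₀) =O[𝓝[>] 0] fun ε : ℝ => ε ^ 2 := by
  have hl : HasLead a 0 a₀ := by simpa [HasLead] using h
  obtain ⟨c, hc, hev⟩ := hl.exists_le h0
  have h2 : (fun ε => (a ε - a₀) ^ 2) =O[𝓝[>] 0] fun ε : ℝ => ε ^ 2 := h.pow 2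
  refine IsBigO.trans (IsBigO.of_bound (1 / (c * a₀)) ?_) h2
  filter_upwards [hev] with ε he
  rw [pow_zero, mul_one] at he
  have ha : 0 < a ε := hc.trans_le he
  have k1 : Real.log (a ε / a₀) ≤ a ε / a₀ - 1 := Real.log_le_sub_one_of_pos (by positivity)
  have k2 : Real.log (a₀ / a ε) ≤ a₀ / a ε - 1 := Real.log_le_sub_one_of_pos (by positivity)
  rw [Real.log_div ha.ne' h0.ne'] at k1
  rw [Real.log_div h0.ne' ha.ne'] at k2
  have e1 : (a ε - a₀) / a₀ = a ε / a₀ - 1 := by field_simp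
  have e2 : (a ε / a₀ - 1) - (1 - a₀ / a ε) = (a ε - a₀) ^ 2 / (a ε * a₀) := by
    field_simp
  have e3 : (a ε - a₀) ^ 2 / (a ε * a₀) ≤ 1 / (c * a₀) * (a ε - a₀) ^ 2 := by
    rw [div_eq_mul_one_div, mul_comm]
    gcongr
  rw [Real.norm_eq_abs, Real.norm_eq_abs, abs_of_nonneg (sq_nonneg (a ε - a₀)),
    abs_of_nonpos (by linarith)]
  linarith

/-- A function with a positive leading term has a logarithm of the form `k log ε + log c + O(ε)`. -/
theorem HasLead.log_sub_isBigO {f : ℝ → ℝ} {k : ℕ} {c : ℝ} (hf : HasLead f k c) (hc : 0 < c) :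
    (fun ε => Real.log (f ε) - (k * Real.log ε + Real.log c)) =O[𝓝[>] 0] fun ε : ℝ => ε := by
  have hpos : ∀ᶠ ε in 𝓝[>] (0 : ℝ), 0 < ε := eventually_mem_nhdsWithin
  have h1 : (fun ε => f ε / ε ^ k - c) =O[𝓝[>] 0] fun ε : ℝ => ε := by
    have := IsBigO.mul hf (isBigO_refl (fun ε : ℝ => (ε ^ k)⁻¹) (𝓝[>] 0))
    refine this.congr' ?_ ?_
    · filter_upwards [hpos] with ε h
      field_simp
    · filter_upwards [hpos] with ε h
      field_simp
      ring
  have h2 := _root_.log_sub_isBigO h1 hc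
  have h3 : (fun ε => (f ε / ε ^ k - c) / c) =O[𝓝[>] 0] fun ε : ℝ => ε := by
    simpa only [div_eq_inv_mul _ c] using h1.const_mul_left c⁻¹
  have h4 := ((h2.trans (pow_isBigO_pow one_le_two)).trans
    (isBigO_of_le _ fun ε => by rw [pow_one])).add h3
  obtain ⟨c', hc', hev⟩ := hf.exists_le hc
  refine h4.congr' ?_ EventuallyEq.rfl
  filter_upwards [hpos, hev] with ε h he
  have hf0 : 0 < f ε := lt_of_lt_of_le (by positivity) he
  rw [Real.log_div hf0.ne' (by positivity), Real.log_pow]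
  ring

/-- Expansion of `a log (a / b)` when both quantities have a positive limit. -/
theorem mul_log_div_sub_isBigO {a b : ℝ → ℝ} {a₀ a₁ b₀ b₁ : ℝ}
    (ha : (fun ε => a ε - (a₀ + ε * a₁)) =O[𝓝[>] 0] fun ε : ℝ => ε ^ 2)
    (hb : (fun ε => b ε - (b₀ + ε * b₁)) =O[𝓝[>] 0] fun ε : ℝ => ε ^ 2)
    (ha0 : 0 < a₀) (hb0 : 0 < b₀) :
    (fun ε => a ε * Real.log (a ε / b ε) - (a₀ * Real.log (a₀ / b₀) +
      (a₁ * Real.log (a₀ / b₀) + (a₁ * b₀ - b₁ * a₀) / b₀) * ε))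
      =O[𝓝[>] 0] fun ε : ℝ => ε ^ 2 := by
  have lin : ∀ {f : ℝ → ℝ} {c d : ℝ},
      ((fun ε => f ε - (c + ε * d)) =O[𝓝[>] 0] fun ε : ℝ => ε ^ 2) →
      (fun ε => f ε - c) =O[𝓝[>] 0] fun ε : ℝ => ε := by
    intro f c d h
    have h1 := h.trans (pow_isBigO_pow one_le_two)
    simp only [pow_one] at h1
    have h2 : (fun ε : ℝ => d * ε) =O[𝓝[>] 0] fun ε : ℝ => ε :=
      (isBigO_refl _ _).const_mul_left d
    refine (h1.add h2).congr_left fun ε => ?_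
    ring
  have la := lin ha
  have lb := lin hb
  have hla : HasLead a 0 a₀ := by simpa [HasLead] using la
  have hlb : HasLead b 0 b₀ := by simpa [HasLead] using lb
  have a1 : a =O[𝓝[>] 0] fun _ : ℝ => (1 : ℝ) := by simpa using hla.isBigO
  have ea := log_sub_isBigO la ha0
  have eb := log_sub_isBigO lb hb0
  have hsq : (fun ε : ℝ => ε * ε) = fun ε => ε ^ 2 := by
    funext ε
    ring
  have t1 := ha.const_mul_left (Real.log a₀ - Real.log b₀)
  have t2 := (la.mul la).const_mul_left a₀⁻¹
  have t3 := (la.mul lb).const_mul_left b₀⁻¹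
  rw [hsq] at t2 t3
  have t4 := hb.const_mul_left (a₀ / b₀)
  have t5 := a1.mul (ea.sub eb)
  simp only [one_mul] at t5
  obtain ⟨c, hc, hca⟩ := hla.exists_le ha0
  obtain ⟨d, hd, hdb⟩ := hlb.exists_le hb0
  refine (((((t1.add t2).add ha).sub t3).sub t4).add t5).congr' ?_ EventuallyEq.rfl
  filter_upwards [hca, hdb] with ε h1 h2
  rw [pow_zero, mul_one] at h1 h2
  rw [Real.log_div (hc.trans_le h1).ne' (hd.trans_le h2).ne', Real.log_div ha0.ne' hb0.ne']
  field_simp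
  ring

/-- Expansion of `a log (a / b)` when `a` is of order `ε` and `b` of order `ε ^ l`. The term in
`ε log (1 / ε)` disappears for `l = 1`. -/
theorem HasLead.mul_log_div_sub_isBigO {a b : ℝ → ℝ} {a₁ b₁ : ℝ} {l : ℕ}
    (ha : HasLead a 1 a₁) (hb : HasLead b l b₁) (ha0 : 0 < a₁) (hb0 : 0 < b₁) :
    (fun ε => a ε * Real.log (a ε / b ε) -
      (-((1 - l) * a₁) * (ε * Real.log (1 / ε)) + a₁ * Real.log (a₁ / b₁) * ε))
      =O[𝓝[>] 0] fun ε : ℝ => ε ^ 2 * Real.log ε ^ 2 := by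
  have ea := ha.log_sub_isBigO ha0
  have eb := hb.log_sub_isBigO hb0
  have t1 := ha.isBigO.mul (ea.sub eb)
  have hsq : (fun ε : ℝ => ε ^ 1 * ε) = fun ε => ε ^ 2 := by
    funext ε
    ring
  rw [hsq] at t1
  have hda : (fun ε => a ε - a₁ * ε ^ 1) =O[𝓝[>] 0] fun ε : ℝ => ε ^ 2 := ha
  have t2 := (hda.mul (isBigO_refl (fun ε => Real.log ε) (𝓝[>] 0))).const_mul_left (1 - (l : ℝ))
  have t3 := hda.const_mul_left (Real.log a₁ - Real.log b₁)
  obtain ⟨c, hc, hca⟩ := ha.exists_le ha0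
  obtain ⟨d, hd, hdb⟩ := hb.exists_le hb0
  refine (((t1.trans sq_isBigO_sq_mul_log_sq).add
    (t2.trans sq_mul_log_isBigO_sq_mul_log_sq)).add
    (t3.trans sq_isBigO_sq_mul_log_sq)).congr' ?_ EventuallyEq.rfl
  filter_upwards [hca, hdb, self_mem_nhdsWithin] with ε h1 h2 h0
  have h0 : 0 < ε := h0
  have p1 : 0 < a ε := lt_of_lt_of_le (by positivity) h1
  have p2 : 0 < b ε := lt_of_lt_of_le (by positivity) h2
  rw [Real.log_div p1.ne' p2.ne', Real.log_div ha0.ne' hb0.ne', one_div, Real.log_inv]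
  push_cast
  ring

/-! ### Expansion of the conditional entropies of the output -/

namespace StationaryProcess

open Classical in
/-- The contribution of the word `w ++ [v]` to the coefficient of `ε log (1 / ε)`. -/
def fTerm (X : StationaryProcess) (w : List Bool) (v : Bool) : ℝ :=
  if 0 < X.prob w ∧ ¬ 0 < X.prob (w ++ [v]) then noisyDeriv X.prob (w ++ [v]) else 0

open Classical in
/-- The contribution of the word `w ++ [v]` to the coefficient of `ε`. -/
def gTerm (X : StationaryProcess) (w : List Bool) (v : Bool) : ℝ :=
  -(if 0 < X.prob (w ++ [v]) then
      noisyDeriv X.prob (w ++ [v]) * Real.log (X.prob (w ++ [v]) / X.prob w) +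
        (noisyDeriv X.prob (w ++ [v]) * X.prob w - noisyDeriv X.prob w * X.prob (w ++ [v])) /
          X.prob w
    else 0)
  - (if 0 < X.prob w ∧ ¬ 0 < X.prob (w ++ [v]) then
      noisyDeriv X.prob (w ++ [v]) * Real.log (noisyDeriv X.prob (w ++ [v]) / X.prob w)
    else 0)
  - (if (¬ 0 < X.prob w ∧ 0 < flipSum X.prob w) ∧
        (¬ 0 < X.prob (w ++ [v]) ∧ 0 < flipSum X.prob (w ++ [v])) then
      noisyDeriv X.prob (w ++ [v]) * Real.log (noisyDeriv X.prob (w ++ [v]) / noisyDeriv X.prob w)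
    else 0)

variable (X : StationaryProcess)

theorem oneFlip_iff {n : ℕ} (u : Fin n → Bool) :
    X.OneFlip u ↔ ¬ 0 < X.prob (List.ofFn u) ∧ 0 < flipSum X.prob (List.ofFn u) := by
  refine and_congr Iff.rfl ?_
  rw [flipSum_ofFn, Finset.sum_pos_iff_of_nonneg fun i _ => X.nonneg _]
  simp [law]

theorem law_snocBit {n : ℕ} (w : Fin n → Bool) (v : Bool) :
    X.law (n + 1) (snocBit w v) = X.prob (List.ofFn w ++ [v]) := by
  rw [law, ofFn_snocBit]

theorem hCoeff_snocBit {n : ℕ} (w : Fin n → Bool) (v : Bool) :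
    X.hCoeff (snocBit w v) = noisyDeriv X.prob (List.ofFn w ++ [v]) := by
  rw [hCoeff_eq, ofFn_snocBit]

theorem fBlock_eq_sum (n : ℕ) : X.fBlock n = ∑ w ∈ words n, ∑ v : Bool, X.fTerm w v := by
  rw [← sum_ofFn, fBlock]
  refine Finset.sum_congr rfl fun w _ => Finset.sum_congr rfl fun v _ => ?_
  simp only [fTerm, law_snocBit, hCoeff_snocBit]
  rfl

theorem gBlock_eq_sum (n : ℕ) : X.gBlock n = ∑ w ∈ words n, ∑ v : Bool, X.gTerm w v := by
  rw [← sum_ofFn, gBlock, ← Finset.sum_neg_distrib, ← Finset.sum_sub_distrib,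
    ← Finset.sum_sub_distrib]
  refine Finset.sum_congr rfl fun w _ => ?_
  rw [← Finset.sum_neg_distrib, ← Finset.sum_sub_distrib, ← Finset.sum_sub_distrib]
  refine Finset.sum_congr rfl fun v _ => ?_
  simp only [gTerm, oneFlip_iff, hCoeff_eq, ofFn_snocBit, law]

theorem flipSum_snoc_le (w : List Bool) (v : Bool) :
    flipSum X.prob (w ++ [v]) ≤ flipSum X.prob w + X.prob (w ++ [!v]) := by
  rw [flipSum_append]
  refine add_le_add (flipSum_mono (fun x => X.isWordMeasure.snoc_le x v) w) ?_
  simp [flipSum]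

theorem prob_snoc_not_le_flipSum (w : List Bool) (v : Bool) :
    X.prob (w ++ [!v]) ≤ flipSum X.prob (w ++ [v]) := by
  rw [flipSum_append]
  have : 0 ≤ flipSum (fun x => X.prob (x ++ [v])) w := flipSum_nonneg (fun x => X.nonneg _) w
  simpa [flipSum] using this

theorem prob_snoc_add_not (w : List Bool) (v : Bool) :
    X.prob (w ++ [v]) + X.prob (w ++ [!v]) = X.prob w := by
  rw [← X.sum_append w]
  cases v
  · rfl
  · exact add_comm _ _

theorem noisyDeriv_of_prob_eq_zero {w : List Bool} (h : X.prob w = 0) :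
    noisyDeriv X.prob w = flipSum X.prob w := by
  rw [noisyDeriv, h, mul_zero, sub_zero]

/-- Words `w ++ [v]` with output probability `O(ε ^ 2)` do not contribute, because the conditional
probability of an output symbol is at least `ε`. -/
theorem term_expansion (w : List Bool) (v : Bool) :
    (fun ε => noisy ε X.prob (w ++ [v]) *
        Real.log (noisy ε X.prob (w ++ [v]) / noisy ε X.prob w) -
      (X.prob (w ++ [v]) * Real.log (X.prob (w ++ [v]) / X.prob w) -
        X.fTerm w v * (ε * Real.log (1 / ε)) - X.gTerm w v * ε))
      =O[𝓝[>] 0] fun ε : ℝ => ε ^ 2 * Real.log ε ^ 2 := by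
  by_cases hwv : 0 < X.prob (w ++ [v])
  · have hw : 0 < X.prob w := hwv.trans_le (X.isWordMeasure.snoc_le w v)
    refine ((mul_log_div_sub_isBigO (noisy_sub_isBigO X.prob (w ++ [v]))
      (noisy_sub_isBigO X.prob w) hwv hw).trans sq_isBigO_sq_mul_log_sq).congr_left fun ε => ?_
    simp only [fTerm, gTerm, hwv, hw, not_true_eq_false, and_false, false_and, if_true, if_false]
    ring
  have hwv0 : X.prob (w ++ [v]) = 0 := le_antisymm (not_lt.1 hwv) (X.nonneg _)
  by_cases hw : 0 < X.prob w
  · have hf : 0 < flipSum X.prob (w ++ [v]) := by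
      have h1 := X.prob_snoc_not_le_flipSum w v
      have h2 := X.prob_snoc_add_not w v
      linarith
    refine ((hasLead_noisy_one hwv0).mul_log_div_sub_isBigO (hasLead_noisy_zero X.prob w)
      hf hw).congr_left fun ε => ?_
    simp only [fTerm, gTerm, hw, X.noisyDeriv_of_prob_eq_zero hwv0, hwv0, not_true_eq_false,
      not_false_eq_true, and_self, false_and, if_true, if_false, lt_irrefl]
    push_cast
    ring
  have hw0 : X.prob w = 0 := le_antisymm (not_lt.1 hw) (X.nonneg _)
  by_cases hf : 0 < flipSum X.prob (w ++ [v])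
  · have hfw : 0 < flipSum X.prob w := by
      have h1 := X.flipSum_snoc_le w v
      rw [X.append_eq_zero hw0, add_zero] at h1
      exact hf.trans_le h1
    refine ((hasLead_noisy_one hwv0).mul_log_div_sub_isBigO (hasLead_noisy_one hw0)
      hf hfw).congr_left fun ε => ?_
    simp only [fTerm, gTerm, X.noisyDeriv_of_prob_eq_zero hwv0, X.noisyDeriv_of_prob_eq_zero hw0,
      hwv0, hw0, hf, hfw, not_false_eq_true, and_self, false_and, if_true, if_false, lt_irrefl]
    push_cast
    ring
  have hf0 : flipSum X.prob (w ++ [v]) = 0 :=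
    le_antisymm (not_lt.1 hf) (flipSum_nonneg X.nonneg _)
  have hl := hasLead_noisy_one hwv0
  rw [hf0] at hl
  refine IsBigO.trans (IsBigO.of_bound 1 ?_) ((hl.isBigO_succ.mul
    (isBigO_refl (fun ε => Real.log ε) (𝓝[>] 0))).trans sq_mul_log_isBigO_sq_mul_log_sq)
  filter_upwards [self_mem_nhdsWithin,
    nhdsWithin_le_nhds (Iic_mem_nhds (by norm_num : (0 : ℝ) < 1 / 2))] with ε h0 h1
  have h0 : 0 < ε := h0
  have h1 : ε ≤ 1 / 2 := h1
  have hp := X.noisy_prob_pos h0 (by linarith)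
  simp only [fTerm, gTerm, hwv0, hw0, hf0, false_and, and_false, if_false, lt_irrefl]
  -- the conditional probability of the output symbol lies between `ε` and `1`
  have hq1 : noisy ε X.prob (w ++ [v]) / noisy ε X.prob w ≤ 1 :=
    div_le_one_of_le₀ ((X.isWordMeasure.noisy h0.le (by linarith)).snoc_le w v) (hp w).le
  have hq0 : ε ≤ noisy ε X.prob (w ++ [v]) / noisy ε X.prob w :=
    (le_div_iff₀ (hp w)).2 (mul_noisy_le_noisy_snoc h0.le h1 X.nonneg
      (fun x _ => X.isWordMeasure.snoc x) v)
  have hl1 := Real.log_nonpos (h0.le.trans hq0) hq1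
  have hl2 := Real.log_le_log h0 hq0
  rw [show ∀ x : ℝ, x - (0 * Real.log (0 / 0) - 0 * (ε * Real.log (1 / ε)) - (-0 - 0 - 0) * ε) = x
    from fun x => by ring, one_mul, norm_mul, norm_mul]
  refine mul_le_mul_of_nonneg_left ?_ (norm_nonneg _)
  rw [Real.norm_eq_abs, Real.norm_eq_abs, abs_of_nonpos hl1,
    abs_of_neg (Real.log_neg h0 (by linarith))]
  linarith

/-- The expansion of the conditional entropies of the output of the channel. -/
theorem condEnt_noisy_expansion (n : ℕ) :
    (fun ε => condEnt (noisy ε X.prob) n - (condEnt X.prob n +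
        X.fBlock n * (ε * Real.log (1 / ε)) + X.gBlock n * ε))
      =O[𝓝[>] 0] fun ε : ℝ => ε ^ 2 * Real.log ε ^ 2 := by
  refine (isBigO_finset_sum (s := words n) fun w _ =>
    isBigO_finset_sum (s := Finset.univ) fun v _ =>
      (X.term_expansion w v).neg_left).congr_left fun ε => ?_
  rw [fBlock_eq_sum, gBlock_eq_sum, condEnt, condEnt]
  simp only [Finset.sum_neg_distrib, Finset.sum_sub_distrib, Finset.sum_mul]
  ring

/-- For a Markov chain, the coefficient of `ε log (1 / ε)` does not depend on the block length: flips
among the additional symbols `a` do not repair a word whose last `m + 1` symbols are forbidden, and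
summing the other flips over `a` gives back the term of the shorter block. -/
theorem IsMarkov.fBlock_add {X : StationaryProcess} {m n : ℕ} (hX : X.IsMarkov m) (hn : 2 * m ≤ n)
    (k : ℕ) : X.fBlock (k + n) = X.fBlock n := by
  rw [fBlock_eq_sum, fBlock_eq_sum, sum_words_add, Finset.sum_comm]
  refine Finset.sum_congr rfl fun w hw => ?_
  have hw := mem_words.1 hw
  rw [Finset.sum_comm]
  refine Finset.sum_congr rfl fun v _ => ?_
  simp only [fTerm, List.append_assoc]
  by_cases h : 0 < X.prob w ∧ ¬ 0 < X.prob (w ++ [v])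
  · have h0 : X.prob (w ++ [v]) = 0 := le_antisymm (not_lt.1 h.2) (X.nonneg _)
    have e : ∀ a : List Bool, flipSum X.prob (a ++ (w ++ [v])) =
        flipSum (fun t => X.prob (a ++ t)) (w ++ [v]) := fun a => by
      rw [flipSum_append, flipSum_eq_zero_of_forall (fun t => X.prepend_eq_zero h0 t), zero_add]
    rw [if_pos h, X.noisyDeriv_of_prob_eq_zero h0,
      ← flipSum_congr (F := fun t => ∑ a ∈ words k, X.prob (a ++ t))
        (fun t _ => X.sum_prepend k t), flipSum_sum]
    refine Finset.sum_congr rfl fun a _ => ?_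
    have ha : X.prob (a ++ (w ++ [v])) = 0 := X.prepend_eq_zero h0 a
    rw [X.noisyDeriv_of_prob_eq_zero ha, e]
    split_ifs with hc
    · rfl
    · have hz : X.prob (a ++ w) = 0 := by
        by_contra hne
        exact hc ⟨lt_of_le_of_ne (X.nonneg _) (Ne.symm hne), by rw [ha]; exact lt_irrefl 0⟩
      have := hX.flipSum_snoc_of_prob_eq_zero (s := a) hn hw h.1.ne' h0
      rw [hz, zero_mul] at this
      exact ((mul_eq_zero.1 this).resolve_right h.1.ne').symm
  · rw [if_neg h]
    refine Finset.sum_eq_zero fun a _ => if_neg fun hc => h ?_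
    refine ⟨hc.1.trans_le (X.prepend_le a w), ?_⟩
    rw [hX.tail_snoc_eq_zero (a := a) (by omega) hc.1.ne' (le_antisymm (not_lt.1 hc.2) (X.nonneg _))]
    exact lt_irrefl 0

end StationaryProcess

/-! ### The output entropy of Markov inputs and the capacity -/

/-- The binary entropy is `ε log (1 / ε) + ε` up to `O(ε ^ 2 log ^ 2 ε)`. -/
theorem binEntropy_isBigO :
    (fun ε : ℝ => Real.binEntropy ε - (ε * Real.log (1 / ε) + ε))
      =O[𝓝[>] 0] fun ε : ℝ => ε ^ 2 * Real.log ε ^ 2 := by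
  have hl : (fun ε : ℝ => (1 - ε) - 1) =O[𝓝[>] 0] fun ε : ℝ => ε :=
    (isBigO_refl (fun ε : ℝ => ε) (𝓝[>] 0)).neg_left.congr_left fun ε => by ring
  have h1 := log_sub_isBigO hl one_pos
  have hb : (fun ε : ℝ => 1 - ε) =O[𝓝[>] 0] fun _ : ℝ => (1 : ℝ) :=
    (ContinuousAt.tendsto (by fun_prop : ContinuousAt (fun ε : ℝ => 1 - ε) 0)).mono_left
      nhdsWithin_le_nhds |>.isBigO_one ℝ
  have h2 := hb.mul h1
  simp only [one_mul] at h2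
  refine ((h2.neg_left.sub (isBigO_refl (fun ε : ℝ => ε ^ 2) (𝓝[>] 0))).trans
    sq_isBigO_sq_mul_log_sq).congr_left fun ε => ?_
  rw [Real.binEntropy, Real.log_one, Real.log_inv, Real.log_inv, one_div, Real.log_inv]
  ring

theorem isBigO_sub_of_sandwich {V E L : ℝ → ℝ} {l : Filter ℝ} {K K' : ℝ} (hL : ∀ ε, 0 ≤ L ε)
    (h : ∀ᶠ ε in l, E ε - K * L ε ≤ V ε) (h' : ∀ᶠ ε in l, V ε ≤ E ε + K' * L ε) :
    (fun ε => V ε - E ε) =O[l] L := by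
  refine IsBigO.of_bound (max K K') ?_
  filter_upwards [h, h'] with ε h1 h2
  have k1 := mul_le_mul_of_nonneg_right (le_max_left K K') (hL ε)
  have k2 := mul_le_mul_of_nonneg_right (le_max_right K K') (hL ε)
  rw [Real.norm_eq_abs, Real.norm_eq_abs, abs_of_nonneg (hL ε), abs_le]
  constructor <;> linarith

section markovOutputEntropy

variable {S : Set (List Bool)} {m : ℕ} {X : StationaryProcess} {ε : ℝ}

theorem le_noisyCapacity_of_mem (hfac : IsFactorial S) (h0 : 0 ≤ ε) (h1 : ε ≤ 1) {r : ℝ}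
    (hr : r ∈ {r : ℝ | ∃ X : StationaryProcess, X.IsMarkov m ∧ IsIrreducibleConstraint X.allowed ∧
      X.allowed ⊆ S ∧ r = entropyRate fun n => bscOutput ε (X.law n)}) :
    r ≤ noisyCapacity S ε + Real.binEntropy ε := by
  obtain ⟨Y, -, -, hY, rfl⟩ := hr
  rw [Y.entropyRate_output h0 h1]
  exact iInf_condEnt_le_noisyCapacity_add hfac hY h0 h1

theorem iInf_condEnt_le_markovOutputEntropy (hfac : IsFactorial S) (h0 : 0 ≤ ε) (h1 : ε ≤ 1)
    (hX : X.IsMarkov m) (hirr : IsIrreducibleConstraint X.allowed) (hS : X.allowed ⊆ S) :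
    ⨅ n, condEnt (noisy ε X.prob) n ≤ markovOutputEntropy S m ε :=
  le_csSup ⟨_, fun _ => le_noisyCapacity_of_mem hfac h0 h1⟩
    ⟨X, hX, hirr, hS, (X.entropyRate_output h0 h1).symm⟩

theorem markovOutputEntropy_le (hfac : IsFactorial S) (h0 : 0 ≤ ε) (h1 : ε ≤ 1)
    (hX : X.IsMarkov m) (hirr : IsIrreducibleConstraint X.allowed) (hS : X.allowed ⊆ S) :
    markovOutputEntropy S m ε ≤ noisyCapacity S ε + Real.binEntropy ε :=
  csSup_le ⟨_, X, hX, hirr, hS, rfl⟩ fun _ => le_noisyCapacity_of_mem hfac h0 h1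

end markovOutputEntropy

namespace IsParryMeasure

variable {S : Set (List Bool)} {m : ℕ} {X : StationaryProcess} {c : ℝ} {ρ : List Bool → ℝ}

/-- The Parry measure is the unique maximizer of the entropy rate for every order `n ≥ m`. -/
theorem isMaxEntropyMarkov_iff (h : IsParryMeasure S m X c ρ) (hfac : IsFactorial S)
    (hirr : IsIrreducibleConstraint S) {n : ℕ} (hn : m ≤ n) (Y : StationaryProcess) :
    IsMaxEntropyMarkov S n Y ↔ Y = X := by
  constructor
  · rintro ⟨hYm, hY, hmax⟩
    refine h.eq_of_le_iInf_condEnt hfac hirr hn hYm hY.le ?_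
    have := hmax X (h.isMarkov.mono hn) h.allowed_eq
    rwa [X.entropyRate_law, Y.entropyRate_law, h.iInf_condEnt_eq] at this
  · rintro rfl
    refine ⟨h.isMarkov.mono hn, h.allowed_eq, fun Z _ hZ => ?_⟩
    rw [Y.entropyRate_law, Z.entropyRate_law, h.iInf_condEnt_eq, ← h.noisyCapacity_zero hfac]
    have := iInf_condEnt_le_noisyCapacity_add hfac hZ.le le_rfl zero_le_one
    rwa [Real.binEntropy_zero, add_zero, show noisy 0 Z.prob = Z.prob from
      funext fun w => noisy_zero Z.prob w] at this

theorem condEnt_noisy_isBigO (h : IsParryMeasure S m X c ρ) (hfac : IsFactorial S) :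
    (fun ε => condEnt (noisy ε X.prob) (3 * m) - Real.binEntropy ε -
      (noisyCapacity S 0 + (X.fCoeff m - 1) * (ε * Real.log (1 / ε)) + (X.gCoeff m - 1) * ε))
      =O[𝓝[>] 0] fun ε : ℝ => ε ^ 2 * Real.log ε ^ 2 := by
  refine ((X.condEnt_noisy_expansion (3 * m)).sub binEntropy_isBigO).congr_left fun ε => ?_
  rw [h.noisyCapacity_zero hfac, h.condEnt_eq (by omega : m ≤ 3 * m), StationaryProcess.fCoeff,
    StationaryProcess.gCoeff, show 3 * m = m + 2 * m by ring, h.isMarkov.fBlock_add le_rfl]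
  ring

/-- A quantity that lies between the output entropy rate of `X` and the noisy capacity (up to the
entropy of the noise) has the same expansion as the conditional output entropy of `X`. -/
theorem expansion_of_sandwich (h : IsParryMeasure S m X c ρ) (hfac : IsFactorial S)
    (hirr : IsIrreducibleConstraint S) {V : ℝ → ℝ}
    (hlow : ∀ ε, 0 ≤ ε → ε ≤ 1 → ⨅ n, condEnt (noisy ε X.prob) n ≤ V ε)
    (hup : ∀ ε, 0 ≤ ε → ε ≤ 1 → V ε ≤ noisyCapacity S ε + Real.binEntropy ε) :
    (fun ε => V ε - Real.binEntropy ε -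
      (noisyCapacity S 0 + (X.fCoeff m - 1) * (ε * Real.log (1 / ε)) + (X.gCoeff m - 1) * ε))
      =O[𝓝[>] 0] fun ε : ℝ => ε ^ 2 * Real.log ε ^ 2 := by
  obtain ⟨K, hK⟩ := h.isMarkov.exists_le_iInf_condEnt_noisy (n := 3 * m) le_rfl
  obtain ⟨K', hK'⟩ := h.exists_condEnt_le_add_sq hfac hirr (by omega : m ≤ 3 * m)
  have hsmall : ∀ᶠ ε in 𝓝[>] (0 : ℝ), 0 < ε ∧ ε < 1 :=
    eventually_mem_nhdsWithin.and (nhdsWithin_le_nhds (Iio_mem_nhds one_pos))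
  have hV := isBigO_sub_of_sandwich (V := V) (E := fun ε => condEnt (noisy ε X.prob) (3 * m))
    (L := fun ε => ε ^ 2 * Real.log ε ^ 2) (K := K) (K' := K') (l := 𝓝[>] 0)
    (fun ε => by positivity)
    (by
      filter_upwards [hK, hsmall] with ε h1 h2
      exact h1.trans (hlow ε h2.1.le h2.2.le))
    (by
      filter_upwards [hK', hsmall] with ε h1 h2
      obtain ⟨Y, hY, hle⟩ := exists_noisyCapacity_add_le hfac h.allowed_eq.le h2.1 h2.2
      exact ((hup ε h2.1.le h2.2.le).trans (hle (3 * m))).trans (h1 Y hY))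
  refine (hV.add (h.condEnt_noisy_isBigO hfac)).congr_left fun ε => ?_
  ring

end IsParryMeasure

end

theorem corollary3p3 (S : Set (List Bool)) (hS : IsFiniteType S) (hirr : IsIrreducibleConstraint S)
    (hne : ∃ w ∈ S, w ≠ []) :
    -- the limit that defines the capacity exists
    (∀ ε ∈ Set.Icc (0 : ℝ) 1, Tendsto (blockCapacity S ε) atTop (𝓝 (noisyCapacity S ε))) ∧
    ∃ X : StationaryProcess,
      -- for every `m ≥ m̂(S)`, `X` is the unique maximum-entropy Markov chain of order `m`
      (∀ m, topologicalOrder S ≤ m → ∀ Y, IsMaxEntropyMarkov S m Y ↔ Y = X) ∧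
      ((fun ε : ℝ => noisyCapacity S ε -
          (noisyCapacity S 0
            + (X.fCoeff (topologicalOrder S) - 1) * (ε * Real.log (1 / ε))
            + (X.gCoeff (topologicalOrder S) - 1) * ε))
        =O[𝓝[>] 0] fun ε : ℝ => ε ^ 2 * Real.log ε ^ 2) ∧
      ∀ m, topologicalOrder S ≤ m →
        ((fun ε : ℝ => (markovOutputEntropy S m ε - Real.binEntropy ε) -
            (noisyCapacity S 0
              + (X.fCoeff (topologicalOrder S) - 1) * (ε * Real.log (1 / ε))
              + (X.gCoeff (topologicalOrder S) - 1) * ε))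
          =O[𝓝[>] 0] fun ε : ℝ => ε ^ 2 * Real.log ε ^ 2) := by

  have hfac := hS.isFactorial
  obtain ⟨X, c, ρ, h⟩ := exists_isParryMeasure hfac hirr hne hS.hasMemory
  have hX : X.allowed ⊆ S := h.allowed_eq.le
  have hXirr : IsIrreducibleConstraint X.allowed := h.allowed_eq ▸ hirr
  refine ⟨fun ε hε => tendsto_blockCapacity hfac hX hε.1 hε.2, X,
    fun m hm => h.isMaxEntropyMarkov_iff hfac hirr hm, ?_, fun m hm => ?_⟩
  · refine (h.expansion_of_sandwich hfac hirr
      (V := fun ε => noisyCapacity S ε + Real.binEntropy ε)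
      (fun ε h0 h1 => iInf_condEnt_le_noisyCapacity_add hfac hX h0 h1)
      fun ε _ _ => le_rfl).congr_left fun ε => ?_
    ring
  · have hXm := h.isMarkov.mono hm
    exact h.expansion_of_sandwich hfac hirr
      (fun ε h0 h1 => iInf_condEnt_le_markovOutputEntropy hfac h0 h1 hXm hXirr hX)
      (fun ε h0 h1 => markovOutputEntropy_le hfac h0 h1 hXm hXirr hX)
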